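/- **Setting.** Let $0<R<r$, $a>0$, $d>R$, $k>0$ and an integer $N\ge 1$ be fixed. Let $\Omega=\{\mathbf x=(x,y,z)\in\mathbb R^3:|x|,|y|,|z|<R\}$ and $\Gamma=\{|x|,|y|<R,\ z=-R\}\subset\partial\Omega$. Let $\Psi_0,\Psi_1,\dots$ be the Gram–Schmidt orthonormalization in $L^2(-a,a)$ of the functions $\alpha\mapsto\alpha^n e^{\alpha}$, $n=0,1,\dots$, and $S_N=(s_{mn})_{m,n=0}^{N-1}$, $s_{mn}=\int_{-a}^a\Psi_n'\Psi_m\,d\alpha$. With $\mathbf x_\alpha=(\alpha,0,-d)$ put $$\tilde{\mathbf x}_\alpha=\frac{ik(\mathbf x-\mathbf x_\alpha)}{|\mathbf x-\mathbf x_\alpha|}-\frac{\mathbf x-\mathbf x_\alpha}{|\mathbf x-\mathbf x_\alpha|^2},\qquad \hat{\mathbf x}_\alpha=\partial_\alpha\tilde{\mathbf x}_\alpha .$$ For $V=(v_0,\dots,v_{N-1})$ with complex valued components (regarded as a function with $2N$ real components) let $L(V)=\Delta V+S_N^{-1}f(\nabla V)$, where $f=(f_m)_{m=0}^{N-1}$,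 $$f_m(\nabla V)=2\sum_{n,l=0}^{N-1}\nabla v_n\cdot\nabla v_l\int_{-a}^a\Psi_m\Psi_n\Psi_l'\,d\alpha+2\sum_{n=0}^{N-1}\int_{-a}^a\Psi_m\Psi_n'\,\nabla v_n\cdot\tilde{\mathbf x}_\alpha\,d\alpha+2\sum_{n=0}^{N-1}\int_{-a}^a\Psi_m\Psi_n\,\hat{\mathbf x}_\alpha\cdot\nabla v_n\,d\alpha$$ and $\cdot$ is the bilinear dot product. Let $H^s$ denote the Sobolev space $H^s(\Omega;\mathbb C^N)$ as a real Hilbert space, with $\|V\|_{H^s}^2=\sum_{n}\sum_{|\beta|\le s}\|\partial^\beta v_n\|_{L^2(\Omega)}^2$, and let $H_0^3=\{V\in H^3: V|_{\partial\Omega}=0,\ \partial_zV|_\Gamma=0\}$. For $\lambda>0$, $\gamma\in(0,1)$ and $V\in H^3$ put $$J_{\lambda,\gamma}(V)=e^{-2\lambda(R+r)^2}\int_\Omega|L(V)|^2e^{2\lambda(z-r)^2}\,d\mathbf x+\gamma\|V\|_{H^3}^2 .$$ Let $J'_{\lambda,\gamma}(V)(\cdot)$ be the Fréchet derivative at $V$,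 and let $\nabla J_{\lambda,\gamma}(V)\in H_0^3$ be the Riesz representative of its restriction to $H_0^3$. For $\rho>0$ let $B_0(\rho)=\{W\in H_0^3:\|W\|_{H^3}<\rho\}$, let $\overline{B_0(\rho)}$ be the closed ball, and let $P_\rho:H_0^3\to\overline{B_0(\rho)}$ be the orthogonal projection onto it. For $G\in H^3$ (an extension of the given boundary data $\psi_0=G|_{\partial\Omega}$, $\psi_1=\partial_zG|_\Gamma$), $W^{(0)}\in B_0(2M)$ and $\eta>0$ the gradient projection method is $$W^{(n)}=P_{2M}\bigl(W^{(n-1)}-\eta\,\nabla J_{\lambda,\gamma}(W^{(n-1)}+G)\bigr),\qquad n=1,2,\dots$$ **Theorem 6.1.** There is a function $M\mapsto\lambda_2(M)=\lambda_2(M,N,r,\Omega)>1$ of $M>0$ (it also depends on the fixed numbers $a,d,k$) with the following two properties. (a) (Strict convexity, the property that defines $\lambda_2$.) For all $M>0$ and $\lambda\ge\lambda_2(M)$ there is $C>0$ such that for all $\gamma\in(0,1)$ the functional $J_{\lambda,\gamma}$ is Fréchet differentiable on $H^3$, and for all $V_1,V_2\in H^3$ with $\|V_1\|_{H^3},\|V_2\|_{H^3}\le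 M$ and the same boundary data ($V_2-V_1\in H_0^3$) $$J_{\lambda,\gamma}(V_2)-J_{\lambda,\gamma}(V_1)-J'_{\lambda,\gamma}(V_1)(V_2-V_1)\ \ge\ C\|V_2-V_1\|_{H^2}^2+\gamma\|V_2-V_1\|_{H^3}^2 .$$ (b) (Global convergence.) For all $M>0$ and $\lambda\ge\lambda_2(2M)$ there is $\eta_0\in(0,1)$, depending only on $M,N,r,\Omega,\lambda$ (and $a,d,k$), such that for all $\gamma\in(0,1)$ and $\eta\in(0,\eta_0)$ there is $\theta\in(0,1)$ such that for every $G\in H^3$ with $\|G\|_{H^3}<M$: the functional $W\mapsto J_{\lambda,\gamma}(W+G)$ has a unique minimizer $W_{\min}$ on $\overline{B_0(2M)}$, and for every starting point $W^{(0)}\in B_0(2M)$ the iterates $W^{(n)}$ converge to $W_{\min}$ in $H^3$, with $$\|W_{\min}-W^{(n)}\|_{H^3}\le\theta^n\,\|W_{\min}-W^{(0)}\|_{H^3},\qquad n=1,2,\dots$$ -/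

import Mathlib

open MeasureTheory Set Filter Topology
open scoped ContDiff

noncomputable section

namespace Convexification

/-! ### The domain -/

/-- Three-dimensional Euclidean space; the coordinates `x, y, z` are numbered `0, 1, 2`. -/
abbrev E3 : Type := EuclideanSpace ℝ (Fin 3)

/-- The open cube `Ω = {|x|, |y|, |z| < R}`. -/
def cube (R : ℝ) : Set E3 := {x | ∀ i, |x i| < R}

/-- The part `Γ = {|x|, |y| < R, z = -R}` of the boundary of the cube. -/
def bottomFace (R : ℝ) : Set E3 := {x | |x 0| < R ∧ |x 1| < R ∧ x 2 = -R}

/-! ### Classical partial derivatives of test functions -/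

/-- The partial derivative `∂_i φ`. -/
def pd (i : Fin 3) (φ : E3 → ℝ) : E3 → ℝ :=
  fun x => fderiv ℝ φ x (EuclideanSpace.single i (1 : ℝ))

/-- The multi-indices `β ∈ ℕ³` with `|β| ≤ 3`. -/
abbrev MIdx : Type := {β : Fin 3 → Fin 4 // ∑ i, (β i : ℕ) ≤ 3}

/-- The order `|β|` of a multi-index. -/
def MIdx.order (β : MIdx) : ℕ := ∑ i, (β.1 i : ℕ)

/-- The multi-index `0`. -/
def idx0 : MIdx := ⟨fun _ => 0, by decide⟩

/-- The multi-index of `∂_i`. -/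
def idx1 (i : Fin 3) : MIdx := ⟨fun j => if j = i then 1 else 0, by revert i; decide⟩

/-- The multi-index of `∂_i²`. -/
def idx2 (i : Fin 3) : MIdx := ⟨fun j => if j = i then 2 else 0, by revert i; decide⟩

/-- The classical derivative `∂^β φ`. -/
def mpd (β : MIdx) (φ : E3 → ℝ) : E3 → ℝ :=
  (pd 0)^[(β.1 0 : ℕ)] ((pd 1)^[(β.1 1 : ℕ)] ((pd 2)^[(β.1 2 : ℕ)] φ))

/-- Smooth compactly supported functions on `ℝ³`. -/
def IsTest (φ : E3 → ℝ) : Prop := ContDiff ℝ ∞ φ ∧ HasCompactSupport φ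

theorem IsTest.pd {φ : E3 → ℝ} (h : IsTest φ) (i : Fin 3) : IsTest (pd i φ) := by
  refine ⟨?_, ?_⟩
  · have h1 : ContDiff ℝ ∞ (fderiv ℝ φ) := h.1.fderiv_right (by simp)
    exact h1.clm_apply contDiff_const
  · exact h.2.fderiv_apply (𝕜 := ℝ) _

theorem IsTest.iterate {φ : E3 → ℝ} (h : IsTest φ) (i : Fin 3) (n : ℕ) :
    IsTest ((Convexification.pd i)^[n] φ) := by
  induction n with
  | zero => exact h
  | succ n ih => rw [Function.iterate_succ_apply']; exact ih.pd i

theorem IsTest.mpd {φ : E3 → ℝ} (h : IsTest φ) (β : MIdx) : IsTest (mpd β φ) :=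
  ((h.iterate _ _).iterate _ _).iterate _ _

/-! ### The Sobolev space `H³(Ω)` -/

/-- The space `L²(Ω)` of complex valued functions, regarded as a real Hilbert space. -/
abbrev L2 (R : ℝ) : Type := Lp ℂ 2 ((volume : Measure E3).restrict (cube R))

/-- Families `(u_β)_{|β| ≤ 3}` in `L²(Ω)` with the norm `(∑_β ‖u_β‖²)^{1/2}`. -/
abbrev Jet (R : ℝ) : Type := PiLp 2 (fun _ : MIdx => L2 R)

/-- Integration against a test function is a continuous linear functional on `L²(Ω)`. -/
theorem exists_pairing (R : ℝ) {φ : E3 → ℝ} (h : IsTest φ) :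
    ∃ T : L2 R →L[ℝ] ℂ, ∀ f : L2 R, T f = ∫ x in cube R, φ x • f x := by
  have hc : Continuous (fun x => (φ x : ℂ)) :=
    Complex.continuous_ofReal.comp h.1.continuous
  have hs : HasCompactSupport (fun x => (φ x : ℂ)) :=
    h.2.comp_left (g := fun t : ℝ => (t : ℂ)) (by simp)
  have hm : MemLp (fun x => (φ x : ℂ)) 2 ((volume : Measure E3).restrict (cube R)) :=
    (hc.memLp_of_hasCompactSupport hs).restrict _
  refine ⟨(innerSL ℂ (hm.toLp _)).restrictScalars ℝ, fun f => ?_⟩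
  simp only [ContinuousLinearMap.coe_restrictScalars', innerSL_apply_apply]
  rw [L2.inner_def]
  refine integral_congr_ae ?_
  filter_upwards [hm.coeFn_toLp] with x hx
  rw [hx]
  simp [mul_comm]

/-- `H³(Ω)`: a function `u = u_0 ∈ L²(Ω)` together with all its weak derivatives
`u_β = ∂^β u ∈ L²(Ω)`, `|β| ≤ 3`. Since weak derivatives are unique, an element is determined by
`u_0`, and the norm inherited from `Jet` is `(∑_{|β| ≤ 3} ‖∂^β u‖²_{L²})^{1/2}`. -/
def sobolev (R : ℝ) : Submodule ℝ (Jet R) where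
  carrier := {U | ∀ (β : MIdx) (φ : E3 → ℝ), IsTest φ → tsupport φ ⊆ cube R →
    ∫ x in cube R, φ x • U β x
      = (-1 : ℝ) ^ β.order • ∫ x in cube R, mpd β φ x • U idx0 x}
  add_mem' := by
    intro U V hU hV β φ hφ hs
    obtain ⟨T, hT⟩ := exists_pairing R hφ
    obtain ⟨T', hT'⟩ := exists_pairing R (hφ.mpd β)
    have h1 := hU β φ hφ hs
    have h2 := hV β φ hφ hs
    rw [← hT, ← hT'] at *
    simp [h1, h2]
  zero_mem' := by
    intro β φ hφ hs
    obtain ⟨T, hT⟩ := exists_pairing R hφ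
    obtain ⟨T', hT'⟩ := exists_pairing R (hφ.mpd β)
    rw [← hT, ← hT']
    simp
  smul_mem' := by
    intro c U hU β φ hφ hs
    obtain ⟨T, hT⟩ := exists_pairing R hφ
    obtain ⟨T', hT'⟩ := exists_pairing R (hφ.mpd β)
    have h1 := hU β φ hφ hs
    rw [← hT, ← hT'] at *
    simp only [PiLp.smul_apply, map_smul, h1]
    exact smul_comm _ _ _

theorem isClosed_sobolev (R : ℝ) : IsClosed (sobolev R : Set (Jet R)) := by
  have : (sobolev R : Set (Jet R)) =
      ⋂ (β : MIdx) (φ : E3 → ℝ) (_ : IsTest φ) (_ : tsupport φ ⊆ cube R),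
        {U : Jet R | ∫ x in cube R, φ x • U β x
          = (-1 : ℝ) ^ β.order • ∫ x in cube R, mpd β φ x • U idx0 x} := by
    ext U; simp [sobolev]
  rw [this]
  refine isClosed_iInter fun β => isClosed_iInter fun φ => isClosed_iInter fun hφ =>
    isClosed_iInter fun _ => ?_
  obtain ⟨T, hT⟩ := exists_pairing R hφ
  obtain ⟨T', hT'⟩ := exists_pairing R (hφ.mpd β)
  simp only [← hT, ← hT']
  exact isClosed_eq (by fun_prop) (by fun_prop)

/-- The real Hilbert space `H³(Ω)` of complex valued functions. -/
abbrev H3 (R : ℝ) : Type := sobolev R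

instance (R : ℝ) : CompleteSpace (H3 R) := (isClosed_sobolev R).completeSpace_coe

/-- The (weak) derivative `∂^β u` of `u ∈ H³(Ω)`. -/
def wd {R : ℝ} (u : H3 R) (β : MIdx) : L2 R := u.1 β

/-- The gradient `∇u`. -/
def grad {R : ℝ} (u : H3 R) (x : E3) : Fin 3 → ℂ := fun i => wd u (idx1 i) x

/-- The Laplacian `Δu`. -/
def lap {R : ℝ} (u : H3 R) (x : E3) : ℂ := ∑ i, wd u (idx2 i) x

/-- The space `H³(Ω)^N` of `ℂ^N`-valued functions (identified with `ℝ^{2N}`-valued functions),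
with the norm `(∑_n ‖V_n‖²)^{1/2}`. -/
abbrev H3N (R : ℝ) (N : ℕ) : Type := PiLp 2 (fun _ : Fin N => H3 R)

instance (R : ℝ) : InnerProductSpace ℝ (L2 R) := L2.innerProductSpace

instance (R : ℝ) : InnerProductSpace ℝ (Jet R) := PiLp.innerProductSpace _

instance (R : ℝ) : InnerProductSpace ℝ (H3 R) := Submodule.innerProductSpace _

instance (R : ℝ) (N : ℕ) : InnerProductSpace ℝ (H3N R N) := PiLp.innerProductSpace _

/-- The square of the norm of `H²(Ω)^N`. -/
def normSqH2 {R : ℝ} {N : ℕ} (V : H3N R N) : ℝ :=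
  ∑ n, ∑ β : MIdx, if β.order ≤ 2 then ‖wd (V n) β‖ ^ 2 else 0

/-! ### Homogeneous boundary conditions -/

/-- `u|_{∂Ω} = 0` in the sense of traces: Green's formula
`∫_Ω (φ ∂_i u + u ∂_i φ) = ∫_{∂Ω} φ u ν_i dS` holds without boundary contribution. -/
def ZeroOnBoundary {R : ℝ} (u : H3 R) : Prop :=
  ∀ (i : Fin 3) (φ : E3 → ℝ), IsTest φ →
    (∫ x in cube R, φ x • wd u (idx1 i) x) + (∫ x in cube R, pd i φ x • wd u idx0 x) = 0

/-- `∂_z u|_Γ = 0` in the sense of traces: Green's formula for `∂_z u` holds without boundary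
contribution, for all test functions vanishing near `∂Ω ∖ Γ`. -/
def ZeroNormalOnBottom {R : ℝ} (u : H3 R) : Prop :=
  ∀ φ : E3 → ℝ, IsTest φ → Disjoint (tsupport φ) (frontier (cube R) \ bottomFace R) →
    (∫ x in cube R, φ x • wd u (idx2 2) x) + (∫ x in cube R, pd 2 φ x • wd u (idx1 2) x) = 0

/-- The space `H_0³(Ω)^N` of all `V ∈ H³(Ω)^N` with `V|_{∂Ω} = 0` and `V_z|_Γ = 0`. -/
def H03N (R : ℝ) (N : ℕ) : Submodule ℝ (H3N R N) where
  carrier := {V | ∀ n, ZeroOnBoundary (V n) ∧ ZeroNormalOnBottom (V n)}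
  add_mem' := by
    intro U V hU hV n
    refine ⟨fun i φ hφ => ?_, fun φ hφ hd => ?_⟩
    · have h1 := (hU n).1 i φ hφ
      have h2 := (hV n).1 i φ hφ
      obtain ⟨T, hT⟩ := exists_pairing R hφ
      obtain ⟨T', hT'⟩ := exists_pairing R (hφ.pd i)
      rw [← hT, ← hT'] at *
      simp only [wd, PiLp.add_apply, Submodule.coe_add, map_add] at *
      linear_combination h1 + h2
    · have h1 := (hU n).2 φ hφ hd
      have h2 := (hV n).2 φ hφ hd
      obtain ⟨T, hT⟩ := exists_pairing R hφ
      obtain ⟨T', hT'⟩ := exists_pairing R (hφ.pd 2)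
      rw [← hT, ← hT'] at *
      simp only [wd, PiLp.add_apply, Submodule.coe_add, map_add] at *
      linear_combination h1 + h2
  zero_mem' := by
    intro n
    refine ⟨fun i φ hφ => ?_, fun φ hφ _ => ?_⟩
    · obtain ⟨T, hT⟩ := exists_pairing R hφ
      obtain ⟨T', hT'⟩ := exists_pairing R (hφ.pd i)
      rw [← hT, ← hT']
      simp [wd]
    · obtain ⟨T, hT⟩ := exists_pairing R hφ
      obtain ⟨T', hT'⟩ := exists_pairing R (hφ.pd 2)
      rw [← hT, ← hT']
      simp [wd]
  smul_mem' := by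
    intro c U hU n
    refine ⟨fun i φ hφ => ?_, fun φ hφ hd => ?_⟩
    · have h1 := (hU n).1 i φ hφ
      obtain ⟨T, hT⟩ := exists_pairing R hφ
      obtain ⟨T', hT'⟩ := exists_pairing R (hφ.pd i)
      rw [← hT, ← hT'] at *
      simp only [wd, PiLp.smul_apply, Submodule.coe_smul, map_smul] at *
      rw [← smul_add, h1, smul_zero]
    · have h1 := (hU n).2 φ hφ hd
      obtain ⟨T, hT⟩ := exists_pairing R hφ
      obtain ⟨T', hT'⟩ := exists_pairing R (hφ.pd 2)
      rw [← hT, ← hT'] at *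
      simp only [wd, PiLp.smul_apply, Submodule.coe_smul, map_smul] at *
      rw [← smul_add, h1, smul_zero]

theorem continuous_wd {R : ℝ} {N : ℕ} (n : Fin N) (β : MIdx) :
    Continuous (fun V : H3N R N => wd (V n) β) := by
  unfold wd
  fun_prop

theorem isClosed_H03N (R : ℝ) (N : ℕ) : IsClosed (H03N R N : Set (H3N R N)) := by
  have : (H03N R N : Set (H3N R N)) =
      (⋂ (n : Fin N) (i : Fin 3) (φ : E3 → ℝ) (_ : IsTest φ),
        {V : H3N R N | (∫ x in cube R, φ x • wd (V n) (idx1 i) x)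
          + (∫ x in cube R, pd i φ x • wd (V n) idx0 x) = 0}) ∩
      (⋂ (n : Fin N) (φ : E3 → ℝ) (_ : IsTest φ)
        (_ : Disjoint (tsupport φ) (frontier (cube R) \ bottomFace R)),
        {V : H3N R N | (∫ x in cube R, φ x • wd (V n) (idx2 2) x)
          + (∫ x in cube R, pd 2 φ x • wd (V n) (idx1 2) x) = 0}) := by
    ext V
    simp only [H03N, ZeroOnBoundary, ZeroNormalOnBottom, Submodule.coe_set_mk,
      AddSubmonoid.coe_set_mk, AddSubsemigroup.coe_set_mk, mem_ofPred_eq, mem_inter_iff,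
      mem_iInter, forall_and]
  rw [this]
  refine IsClosed.inter ?_ ?_
  · refine isClosed_iInter fun n => isClosed_iInter fun i => isClosed_iInter fun φ =>
      isClosed_iInter fun hφ => ?_
    obtain ⟨T, hT⟩ := exists_pairing R hφ
    obtain ⟨T', hT'⟩ := exists_pairing R (hφ.pd i)
    simp only [← hT, ← hT']
    exact isClosed_eq ((T.continuous.comp (continuous_wd _ _)).add
      (T'.continuous.comp (continuous_wd _ _))) continuous_const
  · refine isClosed_iInter fun n => isClosed_iInter fun φ => isClosed_iInter fun hφ =>
      isClosed_iInter fun _ => ?_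
    obtain ⟨T, hT⟩ := exists_pairing R hφ
    obtain ⟨T', hT'⟩ := exists_pairing R (hφ.pd 2)
    simp only [← hT, ← hT']
    exact isClosed_eq ((T.continuous.comp (continuous_wd _ _)).add
      (T'.continuous.comp (continuous_wd _ _))) continuous_const

instance (R : ℝ) (N : ℕ) : CompleteSpace (H03N R N) := (isClosed_H03N R N).completeSpace_coe

/-! ### The quasilinear operator -/

/-- The functions `Ψ_0, Ψ_1, …`: the Gram–Schmidt orthonormalization in `L²(-a,a)` of the
functions `α ↦ α^n e^α`, `n = 0, 1, …`. -/
def Psi (a : ℝ) : ℕ → ℝ → ℝ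
  | n =>
    let p : ℝ → ℝ := fun α => α ^ n * Real.exp α
      - ∑ j : Fin n, (∫ t in (-a)..a, t ^ n * Real.exp t * Psi a j t) * Psi a j α
    fun α => p α / √(∫ t in (-a)..a, p t ^ 2)
termination_by n => n
decreasing_by all_goals exact j.2

/-- The matrix `S_N = (s_{mn})`, `s_{mn} = ∫ Ψ_n' Ψ_m`. -/
def Smat (a : ℝ) (N : ℕ) : Matrix (Fin N) (Fin N) ℝ :=
  Matrix.of fun m n => ∫ t in (-a)..a, deriv (Psi a n) t * Psi a m t

/-- The vector `x - x_α` from the source `x_α = (α, 0, -d)` to `x`. -/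
def srcVec (d : ℝ) (x : E3) (α : ℝ) : Fin 3 → ℝ := ![x 0 - α, x 1, x 2 + d]

/-- The distance `|x - x_α|`. -/
def srcDist (d : ℝ) (x : E3) (α : ℝ) : ℝ := √((x 0 - α) ^ 2 + x 1 ^ 2 + (x 2 + d) ^ 2)

/-- `∇ log u_0 = i k (x - x_α)/|x - x_α| - (x - x_α)/|x - x_α|²`. -/
def srcTilde (k d : ℝ) (x : E3) (α : ℝ) : Fin 3 → ℂ := fun i =>
  Complex.I * k * srcVec d x α i / srcDist d x α - srcVec d x α i / srcDist d x α ^ 2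

/-- The derivative of `srcTilde` with respect to `α`. -/
def srcHat (k d : ℝ) (x : E3) (α : ℝ) : Fin 3 → ℂ := fun i =>
  Complex.I * k / srcDist d x α ^ 3 *
      ((![-(x 1) ^ 2 - (x 2 + d) ^ 2, (x 0 - α) * x 1, (x 0 - α) * (x 2 + d)] i : ℝ) : ℂ)
    - 1 / srcDist d x α ^ 4 *
      ((![(x 0 - α) ^ 2 - (x 1) ^ 2 - (x 2 + d) ^ 2, 2 * (x 0 - α) * x 1,
          2 * (x 0 - α) * (x 2 + d)] i : ℝ) : ℂ)

/-- The nonlinearity `f = (f_m)` at the point `x`, as a function of the gradients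
`P n = ∇v_n(x)`; the dot products are bilinear. -/
def fvec (a d k : ℝ) (N : ℕ) (x : E3) (P : Fin N → Fin 3 → ℂ) : Fin N → ℂ := fun m =>
  2 * (∑ n : Fin N, ∑ l : Fin N, (P n ⬝ᵥ P l) *
      ((∫ t in (-a)..a, Psi a m t * Psi a n t * deriv (Psi a l) t : ℝ) : ℂ))
  + 2 * (∑ n : Fin N, ∫ t in (-a)..a,
      ((Psi a m t * deriv (Psi a n) t : ℝ) : ℂ) * (P n ⬝ᵥ srcTilde k d x t))
  + 2 * (∑ n : Fin N, ∫ t in (-a)..a,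
      ((Psi a m t * Psi a n t : ℝ) : ℂ) * (srcHat k d x t ⬝ᵥ P n))

/-- `L(V) = ΔV + K(∇V)` with `K = S_N⁻¹ f`. -/
def Lop (a d k : ℝ) {R : ℝ} {N : ℕ} (V : H3N R N) (x : E3) : Fin N → ℂ := fun m =>
  lap (V m) x
    + Matrix.mulVec ((Smat a N)⁻¹.map ((↑) : ℝ → ℂ)) (fvec a d k N x (fun n => grad (V n) x)) m

/-! ### The functional and the gradient projection method -/

/-- The Carleman weight function `μ_λ(z) = exp(2 λ (z - r)²)`. -/
def cwf (lam r z : ℝ) : ℝ := Real.exp (2 * lam * (z - r) ^ 2)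

/-- `J_{λ,γ}(V) = exp(-2λ(R+r)²) ∫_Ω |L(V)|² μ_λ(z) dx + γ ‖V‖²`. -/
def J (r a d k lam gam : ℝ) {R : ℝ} {N : ℕ} (V : H3N R N) : ℝ :=
  Real.exp (-2 * lam * (R + r) ^ 2) *
      (∫ x in cube R, (∑ m, ‖Lop a d k V x m‖ ^ 2) * cwf lam r (x 2))
    + gam * ‖V‖ ^ 2

/-- The gradient `J'(V) ∈ H_0³(Ω)^N`: the Riesz representative, in `H_0³(Ω)^N`, of the Fréchet
derivative of `J` at `V`. -/
def gradJ (r a d k lam gam : ℝ) {R : ℝ} {N : ℕ} (V : H3N R N) : H03N R N :=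
  (InnerProductSpace.toDual ℝ (H03N R N)).symm
    ((fderiv ℝ (J r a d k lam gam) V).comp (H03N R N).subtypeL)

/-- The orthogonal projection onto the closed ball of radius `ρ` about `0`. -/
def ballProj {H : Type*} [NormedAddCommGroup H] [NormedSpace ℝ H] (ρ : ℝ) (x : H) : H :=
  if ‖x‖ ≤ ρ then x else (ρ / ‖x‖) • x

/-- `ballProj ρ x` is a point of the closed ball nearest to `x`. -/
theorem ballProj_spec {H : Type*} [NormedAddCommGroup H] [NormedSpace ℝ H] {ρ : ℝ} (hρ : 0 ≤ ρ)
    (x : H) : ballProj ρ x ∈ Metric.closedBall (0 : H) ρ ∧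
      ∀ y ∈ Metric.closedBall (0 : H) ρ, ‖x - ballProj ρ x‖ ≤ ‖x - y‖ := by
  unfold ballProj
  split_ifs with h
  · exact ⟨by simpa using h, fun y _ => by simp⟩
  · have hx : 0 < ‖x‖ := hρ.trans_lt (not_le.1 h)
    refine ⟨?_, fun y hy => ?_⟩
    · simp [norm_smul, abs_of_nonneg hρ, hx.ne']
    · have e : x - (ρ / ‖x‖) • x = (1 - ρ / ‖x‖) • x := by rw [sub_smul, one_smul]
      have h1 : ρ / ‖x‖ ≤ 1 := (div_le_one hx).2 (not_le.1 h).le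
      have hy' : ‖y‖ ≤ ρ := by simpa using hy
      rw [e, norm_smul, Real.norm_eq_abs, abs_of_nonneg (by linarith), sub_mul, one_mul,
        div_mul_cancel₀ _ hx.ne']
      linarith [norm_sub_norm_le x y]

/-- The gradient projection iterates
`W^(n+1) = P(W^(n) - η J'(W^(n) + G))` with `P` the projection onto the closed ball of
radius `ρ` of `H_0³(Ω)^N`, started from `W^(0) = W0`. -/
def gpSeq (r a d k lam gam : ℝ) {R : ℝ} {N : ℕ} (ρ η : ℝ) (G : H3N R N) (W0 : H03N R N) :
    ℕ → H03N R N
  | 0 => W0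
  | n + 1 => ballProj ρ (gpSeq r a d k lam gam ρ η G W0 n
      - η • gradJ r a d k lam gam ((gpSeq r a d k lam gam ρ η G W0 n : H3N R N) + G))

end Convexification

end

noncomputable section

namespace Convexification

/-! ### Partial derivatives of smooth functions -/

/-! Inside the cube the operator is quadratic: `exists_coefficients` writes it as `ΔV + b·∇V + c
∇V·∇V` with bounded `b` and constant `c`. Hence `J` is a sum of squares `‖A V + B V V‖²` plus
`γ‖V‖²`, with the square root `w` of the normalized weight built into `A` and `B`. The Taylor
remainder in (a) is then an exact expression (`sumQuad_sub`): `γ‖h‖²` plus, over all components, `∫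
w²|Δh + e|² + 2∫ w²⟨L(V), c∇h·∇h⟩`, where `e` contains only first derivatives of `h`. Convexity says
that `w²|Δh|²` dominates everything else when `λ` is large.

The domination comes from the Carleman estimate `exists_carleman`, whose core is `λ∫w²|∇h|² ≤
K∫w²|Δh|²`. It is proved by conjugating the Laplacian with the weight, splitting it into symmetric
and antisymmetric parts and integrating the cross terms by parts
(`CarlemanData.le_integral_conjLap`). The only surviving boundary term, on the top face, has a
favourable sign.

First derivatives of `V` and `h` are bounded by their `H³` norms (`exists_ae_norm_grad_le`), so most
error terms are at most a constant times `w²|∇h|²`, hence of relative size `1/λ`. The exception is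
`w² ΔV · c∇h·∇h`, because `ΔV` is only in `H¹`. Here `H¹ ⊂ L⁶` and interpolation give `∫w²|ΔV|²|∇h|²
≤ K‖V‖²∫w²|Δh|²` uniformly in `λ` (`exists_integral_lap_mul_grad_le`): the power of `λ` lost in the
`H¹` norm of `w∇h` is regained in its `L²` norm. Young's inequality with a large parameter `κ` makes
this contribution small at the price of `κ∫w²|∇h|²`, which a larger `λ` absorbs
(`exists_energy_le_remainder`).

Vanishing traces are encoded by the class of test functions for which integration by parts holds
(`IBPOn`). Cutoffs depending on selected coordinates and a mollifier composed with a contraction of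
the cube turn this into integration by parts for Sobolev functions (`ZeroPD.integral_mul`).

For (b), strong convexity with constant `γ` and a quadratic upper bound with a constant independent
of `γ` make the gradient of `φ - γ‖·‖²` cocoercive (`GradData.cocoercive`), where `φ W = J(W + G)`.
A gradient step therefore contracts by `1 - 2ηγ` for all `η` below a threshold independent of `γ`.
The ball projection is nonexpansive, and Banach's fixed point theorem yields the minimizer and the
rate (`GradData.exists_minimizer`). -/

theorem pd_eq_zero_of_const {i : Fin 3} {X : E3 → ℝ} (hX : Differentiable ℝ X)
    (h : ∀ x (t : ℝ), X (x + t • EuclideanSpace.single i (1 : ℝ)) = X x) : pd i X = 0 := by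
  funext x
  unfold pd
  rw [← (hX x).lineDeriv_eq_fderiv]
  simp [lineDeriv, h]

theorem pd_mul {i : Fin 3} {φ ψ : E3 → ℝ} (hφ : Differentiable ℝ φ) (hψ : Differentiable ℝ ψ)
    (x : E3) : pd i (fun y => φ y * ψ y) x = φ x * pd i ψ x + pd i φ x * ψ x := by
  unfold pd
  rw [fderiv_fun_mul (hφ x) (hψ x)]
  simp [mul_comm]

theorem pd_comm {φ : E3 → ℝ} (hφ : ContDiff ℝ ∞ φ) (i j : Fin 3) :
    pd i (pd j φ) = pd j (pd i φ) := by
  funext x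
  have h1 : Differentiable ℝ (fderiv ℝ φ) :=
    (hφ.fderiv_right (m := ∞) (by simp)).differentiable (by simp)
  have key : ∀ v w : E3, fderiv ℝ (fun y => fderiv ℝ φ y v) x w = fderiv ℝ (fderiv ℝ φ) x w v := by
    intro v w
    rw [fderiv_clm_apply (h1 x) (differentiableAt_const v)]
    simp
  have hs : IsSymmSndFDerivAt ℝ φ x :=
    (hφ.contDiffAt).isSymmSndFDerivAt (by
      rw [minSmoothness_of_isRCLikeNormedField]
      exact WithTop.coe_le_coe.2 (le_top : (2 : ℕ∞) ≤ ⊤))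
  change fderiv ℝ (fun y => fderiv ℝ φ y _) x _ = fderiv ℝ (fun y => fderiv ℝ φ y _) x _
  rw [key, key]
  exact hs _ _

theorem contDiff_pd {φ : E3 → ℝ} (h : ContDiff ℝ ∞ φ) (i : Fin 3) : ContDiff ℝ ∞ (pd i φ) :=
  (h.fderiv_right (m := ∞) (by simp)).clm_apply contDiff_const

theorem IsTest.differentiable {φ : E3 → ℝ} (h : IsTest φ) : Differentiable ℝ φ :=
  h.1.differentiable (by simp)

theorem IsTest.mul_smooth {φ ψ : E3 → ℝ} (h : IsTest φ) (hψ : ContDiff ℝ ∞ ψ) :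
    IsTest (fun x => φ x * ψ x) :=
  ⟨h.1.mul hψ, h.2.mul_right⟩

theorem tsupport_pd_subset (i : Fin 3) (φ : E3 → ℝ) :
    tsupport (Convexification.pd i φ) ⊆ tsupport φ :=
  tsupport_fderiv_apply_subset ℝ _

/-! ### The cube -/

theorem isOpen_cube (R : ℝ) : IsOpen (cube R) := by
  have : cube R = ⋂ i, {x : E3 | |x i| < R} := by ext; simp [cube]
  rw [this]
  exact isOpen_iInter_of_finite fun i => isOpen_lt (by fun_prop) continuous_const

theorem measurableSet_cube (R : ℝ) : MeasurableSet (cube R) := (isOpen_cube R).measurableSet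

theorem isCompact_closedCube (R : ℝ) : IsCompact {x : E3 | ∀ i, |x i| ≤ R} := by
  have h : {x : E3 | ∀ i, |x i| ≤ R} =
      (EuclideanSpace.equiv (Fin 3) ℝ).toHomeomorph ⁻¹' (Set.pi univ fun _ => Icc (-R) R) := by
    ext x; simp [abs_le, Pi.le_def, forall_and]
  rw [h]
  exact (Homeomorph.isCompact_preimage _).2 (isCompact_univ_pi fun _ => isCompact_Icc)

theorem cube_subset_closedCube (R : ℝ) : cube R ⊆ {x : E3 | ∀ i, |x i| ≤ R} :=
  fun _ hx i => (hx i).le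

theorem volume_cube_lt_top (R : ℝ) : volume (cube R) < ⊤ :=
  (measure_mono (cube_subset_closedCube R)).trans_lt (isCompact_closedCube R).measure_lt_top

/-- Lebesgue measure on the cube. -/
abbrev cubeMeasure (R : ℝ) : Measure E3 := (volume : Measure E3).restrict (cube R)

instance (R : ℝ) : IsFiniteMeasure (cubeMeasure R) :=
  ⟨by simpa using volume_cube_lt_top R⟩

theorem ae_mem_cube (R : ℝ) : ∀ᵐ x ∂cubeMeasure R, x ∈ cube R :=
  ae_restrict_mem (measurableSet_cube R)

theorem memLp_of_continuous {R : ℝ} {p : ENNReal} {ψ : E3 → ℝ} (h : Continuous ψ) :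
    MemLp ψ p (cubeMeasure R) := by
  obtain ⟨C, hC⟩ := (isCompact_closedCube R).exists_bound_of_continuousOn h.continuousOn
  refine MemLp.of_bound h.aestronglyMeasurable C ?_
  filter_upwards [ae_mem_cube R] with x hx
  exact hC x (cube_subset_closedCube R hx)

theorem MemLp.smooth_mul {R : ℝ} {ψ f : E3 → ℝ} (h : Continuous ψ)
    (hf : MemLp f 2 (cubeMeasure R)) : MemLp (fun x => ψ x * f x) 2 (cubeMeasure R) :=
  hf.mul (memLp_of_continuous (p := ⊤) h)

/-- Frontier points of the cube lie on one of the six faces. -/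
theorem frontier_cube_subset (R : ℝ) :
    frontier (cube R) ⊆ {x | (∀ i, |x i| ≤ R) ∧ ∃ i, |x i| = R} := by
  intro x hx
  rw [(isOpen_cube R).frontier_eq] at hx
  have h1 : ∀ i, |x i| ≤ R :=
    closure_minimal (cube_subset_closedCube R) (isCompact_closedCube R).isClosed hx.1
  refine ⟨h1, ?_⟩
  by_contra! h
  exact hx.2 fun i => lt_of_le_of_ne (h1 i) (h i)

/-! ### Integration by parts against classes of test functions -/

/-- `g` is the derivative `∂_i f` in the cube, in the sense that the integration by parts formula
holds without boundary terms for all test functions supported in `A`. -/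
def IBPOn (R : ℝ) (A : Set E3) (i : Fin 3) (f g : E3 → ℝ) : Prop :=
  ∀ φ : E3 → ℝ, IsTest φ → tsupport φ ⊆ A →
    ∫ x in cube R, (φ x * g x + pd i φ x * f x) = 0

/-- `g` is the weak derivative `∂_i f` in the cube. -/
abbrev WeakPD (R : ℝ) (i : Fin 3) (f g : E3 → ℝ) : Prop := IBPOn R (cube R) i f g

/-- `g` is the weak derivative `∂_i f`, and `f` vanishes on the two faces `x_i = ±R`. -/
abbrev ZeroPD (R : ℝ) (i : Fin 3) (f g : E3 → ℝ) : Prop := IBPOn R univ i f g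

theorem IBPOn.mono {R : ℝ} {A B : Set E3} {i : Fin 3} {f g : E3 → ℝ} (h : IBPOn R A i f g)
    (hB : B ⊆ A) : IBPOn R B i f g := fun φ hφ hs => h φ hφ (hs.trans hB)

/-- The factor `ψ` is moved onto the test function, whose support then shrinks into `A`. Thus
multiplying by a cutoff can enlarge the class of admissible test functions, which is how a cutoff
near the top face restores a zero boundary value there. -/
theorem IBPOn.mul_smooth_of_subset {R : ℝ} {A B : Set E3} {i : Fin 3} {f g ψ : E3 → ℝ}
    (h : IBPOn R A i f g) (hψ : ContDiff ℝ ∞ ψ) (hs : tsupport ψ ∩ B ⊆ A) :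
    IBPOn R B i (fun x => ψ x * f x) (fun x => ψ x * g x + pd i ψ x * f x) := by
  intro φ hφ hφs
  have h1 := h (fun x => φ x * ψ x) (hφ.mul_smooth hψ)
    (fun x hx => hs ⟨tsupport_mul_subset_right hx, hφs (tsupport_mul_subset_left hx)⟩)
  rw [← h1]
  congr 1
  funext x
  rw [pd_mul hφ.differentiable (hψ.differentiable (by simp))]
  ring

theorem IBPOn.mul_smooth {R : ℝ} {A : Set E3} {i : Fin 3} {f g ψ : E3 → ℝ}
    (h : IBPOn R A i f g) (hψ : ContDiff ℝ ∞ ψ) :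
    IBPOn R A i (fun x => ψ x * f x) (fun x => ψ x * g x + pd i ψ x * f x) :=
  h.mul_smooth_of_subset hψ inter_subset_right

theorem integrable_mul_of_test {R : ℝ} {φ f : E3 → ℝ} (hφ : Continuous φ)
    (hf : MemLp f 2 (cubeMeasure R)) : Integrable (fun x => φ x * f x) (cubeMeasure R) :=
  (MemLp.smooth_mul hφ hf).integrable (by norm_num)

theorem IBPOn.integrable {R : ℝ} {φ f g : E3 → ℝ} (i : Fin 3) (hφ : IsTest φ)
    (hf : MemLp f 2 (cubeMeasure R)) (hg : MemLp g 2 (cubeMeasure R)) :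
    Integrable (fun x => φ x * g x + pd i φ x * f x) (cubeMeasure R) :=
  (integrable_mul_of_test hφ.1.continuous hg).add
    (integrable_mul_of_test (hφ.pd i).1.continuous hf)

theorem IBPOn.add {R : ℝ} {A : Set E3} {i : Fin 3} {f g f' g' : E3 → ℝ}
    (h : IBPOn R A i f g) (h' : IBPOn R A i f' g')
    (hf : MemLp f 2 (cubeMeasure R)) (hg : MemLp g 2 (cubeMeasure R))
    (hf' : MemLp f' 2 (cubeMeasure R)) (hg' : MemLp g' 2 (cubeMeasure R)) :
    IBPOn R A i (fun x => f x + f' x) (fun x => g x + g' x) := by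
  intro φ hφ hs
  have h1 := h φ hφ hs
  have h2 := h' φ hφ hs
  have h3 := integral_add (IBPOn.integrable i hφ hf hg) (IBPOn.integrable i hφ hf' hg')
  rw [h1, h2] at h3
  rw [← add_zero (0 : ℝ), ← h3]
  congr 1
  funext x
  ring

/-! ### Cutoff functions -/

/-- A bump function on the line, equal to `1` on most of `(-R, R)` and supported inside. -/
def lineBump {R : ℝ} (hR : 0 < R) (n : ℕ) : ContDiffBump (0 : ℝ) where
  rIn := R * (1 - 2 / (n + 3))
  rOut := R * (1 - 1 / (n + 3))
  rIn_pos := by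
    refine mul_pos hR ?_
    rw [sub_pos, div_lt_one (by positivity)]
    linarith [n.cast_nonneg (α := ℝ)]
  rIn_lt_rOut := by
    refine mul_lt_mul_of_pos_left ?_ hR
    have : (1 : ℝ) / (n + 3) < 2 / (n + 3) := by gcongr; norm_num
    linarith

/-- The product of `lineBump` over the coordinates in `s`. -/
def cutoff {R : ℝ} (hR : 0 < R) (s : Finset (Fin 3)) (n : ℕ) (x : E3) : ℝ :=
  ∏ j ∈ s, lineBump hR n (x j)

theorem contDiff_cutoff {R : ℝ} (hR : 0 < R) (s : Finset (Fin 3)) (n : ℕ) :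
    ContDiff ℝ ∞ (cutoff hR s n) := by
  unfold cutoff
  refine contDiff_prod fun j _ => (lineBump hR n).contDiff.comp ?_
  fun_prop

theorem cutoff_nonneg {R : ℝ} (hR : 0 < R) (s : Finset (Fin 3)) (n : ℕ) (x : E3) :
    0 ≤ cutoff hR s n x := Finset.prod_nonneg fun _ _ => (lineBump hR n).nonneg

theorem cutoff_le_one {R : ℝ} (hR : 0 < R) (s : Finset (Fin 3)) (n : ℕ) (x : E3) :
    cutoff hR s n x ≤ 1 :=
  Finset.prod_le_one (fun _ _ => (lineBump hR n).nonneg) fun _ _ => (lineBump hR n).le_one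

theorem pd_cutoff {R : ℝ} (hR : 0 < R) {s : Finset (Fin 3)} (n : ℕ) {i : Fin 3} (hi : i ∉ s) :
    pd i (cutoff hR s n) = 0 := by
  refine pd_eq_zero_of_const ((contDiff_cutoff hR s n).differentiable (by simp)) fun x t => ?_
  unfold cutoff
  refine Finset.prod_congr rfl fun j hj => ?_
  have : j ≠ i := fun h => hi (h ▸ hj)
  simp [this]

theorem tsupport_cutoff_subset {R : ℝ} (hR : 0 < R) (s : Finset (Fin 3)) (n : ℕ) :
    tsupport (cutoff hR s n) ⊆ {x | ∀ j ∈ s, |x j| < R} := by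
  have hlt : (lineBump hR n).rOut < R := by
    change R * (1 - 1 / ((n : ℝ) + 3)) < R
    have : (0 : ℝ) < 1 / (n + 3) := by positivity
    nlinarith
  have hcl : IsClosed {x : E3 | ∀ j ∈ s, |x j| ≤ (lineBump hR n).rOut} := by
    simp only [Set.ofPred_forall]
    exact isClosed_biInter fun j _ => isClosed_le (by fun_prop) continuous_const
  have hsub : Function.support (cutoff hR s n) ⊆
      {x : E3 | ∀ j ∈ s, |x j| ≤ (lineBump hR n).rOut} := by
    intro x hx j hj
    by_contra! h
    refine hx (Finset.prod_eq_zero hj ((lineBump hR n).zero_of_le_dist ?_))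
    simpa [Real.dist_eq] using h.le
  exact fun x hx j hj => (closure_minimal hsub hcl hx j hj).trans_lt hlt

theorem eventually_cutoff_eq_one {R : ℝ} (hR : 0 < R) (s : Finset (Fin 3)) {x : E3}
    (hx : x ∈ cube R) : ∀ᶠ n in atTop, cutoff hR s n x = 1 := by
  have h : ∀ j : Fin 3, ∀ᶠ n : ℕ in atTop, |x j| < (lineBump hR n).rIn := by
    intro j
    have ht : Tendsto (fun n : ℕ => R * (1 - 2 / ((n : ℝ) + 3))) atTop (𝓝 (R * (1 - 0))) := by
      refine Tendsto.const_mul _ (tendsto_const_nhds.sub ?_)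
      exact tendsto_const_nhds.div_atTop
        (tendsto_atTop_add_const_right _ _ tendsto_natCast_atTop_atTop)
    rw [sub_zero, mul_one] at ht
    exact ht.eventually (lt_mem_nhds (hx j))
  filter_upwards [eventually_all.2 h] with n hn
  refine Finset.prod_eq_one fun j _ => (lineBump hR n).one_of_mem_closedBall ?_
  simpa [Real.dist_eq] using (hn j).le

/-- Cutoffs which do not depend on `x_i` do not affect the formula for `∂_i`. -/
theorem IBPOn.of_cutoff {R : ℝ} (hR : 0 < R) {A B : Set E3} {i : Fin 3} {f g : E3 → ℝ}
    (s : Finset (Fin 3)) (hi : i ∉ s) (hs : {x | ∀ j ∈ s, |x j| < R} ∩ B ⊆ A)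
    (h : IBPOn R A i f g) (hf : MemLp f 2 (cubeMeasure R)) (hg : MemLp g 2 (cubeMeasure R)) :
    IBPOn R B i f g := by
  intro φ hφ hφB
  -- The cutoff does not depend on `x_i`, so `∂_i` falls on `φ` alone and the cutoff multiplies the
  -- whole integrand.
  have hn : ∀ n, ∫ x in cube R, cutoff hR s n x * (φ x * g x + pd i φ x * f x) = 0 := by
    intro n
    have h1 := h (fun x => φ x * cutoff hR s n x) (hφ.mul_smooth (contDiff_cutoff hR s n))
      (fun x hx => hs ⟨tsupport_cutoff_subset hR s n (tsupport_mul_subset_right hx),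
        hφB (tsupport_mul_subset_left hx)⟩)
    rw [← h1]
    congr 1
    funext x
    rw [pd_mul hφ.differentiable ((contDiff_cutoff hR s n).differentiable (by simp)),
      pd_cutoff hR n hi]
    simp only [Pi.zero_apply]
    ring
  have hint := IBPOn.integrable i hφ hf hg
  have hlim : Tendsto (fun n => ∫ x in cube R, cutoff hR s n x * (φ x * g x + pd i φ x * f x))
      atTop (𝓝 (∫ x in cube R, (φ x * g x + pd i φ x * f x))) := by
    refine tendsto_integral_of_dominated_convergence
      (fun x => ‖φ x * g x + pd i φ x * f x‖) (fun n => ?_) hint.norm (fun n => ?_) ?_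
    · exact (contDiff_cutoff hR s n).continuous.aestronglyMeasurable.mul hint.1
    · refine ae_of_all _ fun x => ?_
      rw [norm_mul, Real.norm_of_nonneg (cutoff_nonneg hR s n x)]
      exact mul_le_of_le_one_left (norm_nonneg _) (cutoff_le_one hR s n x)
    · filter_upwards [ae_mem_cube R] with x hx
      refine Tendsto.congr' ?_ tendsto_const_nhds
      filter_upwards [eventually_cutoff_eq_one hR s hx] with n hn
      rw [hn, one_mul]
  simp only [hn] at hlim
  exact (tendsto_nhds_unique hlim tendsto_const_nhds)

/-- Only the faces orthogonal to the `i`-axis contribute a boundary term to the formula for `∂_i`;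
cutoffs in the other two coordinates remove the remaining support restriction. -/
theorem WeakPD.slab {R : ℝ} (hR : 0 < R) {i : Fin 3} {f g : E3 → ℝ} (h : WeakPD R i f g)
    (hf : MemLp f 2 (cubeMeasure R)) (hg : MemLp g 2 (cubeMeasure R)) :
    IBPOn R {x | |x i| < R} i f g := by
  refine h.of_cutoff hR (Finset.univ.erase i) (by simp) ?_ hf hg
  rintro x ⟨h1, h2⟩ j
  by_cases hj : j = i
  · exact hj ▸ h2
  · exact h1 j (by simp [hj])

/-- If `f` vanishes on the faces `x_i = ±R`, then so does its derivative along a different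
axis. -/
theorem ZeroPD.transfer {R : ℝ} (hR : 0 < R) {i j : Fin 3} (hij : i ≠ j) {f fi fj fij : E3 → ℝ}
    (h : ZeroPD R i f fi) (hj : WeakPD R j f fj) (hij' : WeakPD R j fi fij)
    (hf : MemLp f 2 (cubeMeasure R)) (hfi : MemLp fi 2 (cubeMeasure R))
    (hfj : MemLp fj 2 (cubeMeasure R)) (hfij : MemLp fij 2 (cubeMeasure R)) :
    ZeroPD R i fj fij := by
  refine IBPOn.of_cutoff (A := {x | |x j| < R}) hR {j} (by simpa using hij) ?_ ?_ hfj hfij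
  · rintro x ⟨h1, -⟩
    exact h1 j (by simp)
  intro φ hφ hs
  have e1 := hij'.slab hR hfi hfij φ hφ hs
  have e2 := hj.slab hR hf hfj (pd i φ) (hφ.pd i) ((tsupport_pd_subset i φ).trans hs)
  have e3 := h (pd j φ) (hφ.pd j) (subset_univ _)
  have i1 := IBPOn.integrable j hφ hfi hfij
  have i2 := IBPOn.integrable j (hφ.pd i) hf hfj
  have i3 := IBPOn.integrable i (hφ.pd j) hf hfi
  -- Combining the three formulas, the `∂_jφ · f_i` terms cancel, as do the mixed derivatives of
  -- `φ`, leaving the desired formula for `f_j`.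
  have e : ∫ x in cube R, ((φ x * fij x + pd j φ x * fi x)
      + (pd i φ x * fj x + pd j (pd i φ) x * f x)
      - (pd j φ x * fi x + pd i (pd j φ) x * f x)) = 0 := by
    have a := integral_sub (i1.add i2) i3
    simp only [Pi.add_apply] at a
    rw [a, integral_add i1 i2, e1, e2, e3]
    simp
  rw [← e]
  congr 1
  funext x
  rw [pd_comm hφ.1 j i]
  ring

/-! ### Smoothing inside the cube -/

theorem sq_lintegral_mul_le {α : Type*} [MeasurableSpace α] {μ : Measure α} {f g : α → ENNReal}
    (hf : AEMeasurable f μ) (hg : AEMeasurable g μ) :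
    (∫⁻ x, f x * g x ∂μ) ^ 2 ≤ (∫⁻ x, f x ^ 2 ∂μ) * ∫⁻ x, g x ^ 2 ∂μ := by
  have h := ENNReal.lintegral_mul_le_Lp_mul_Lq μ Real.HolderConjugate.two_two hf hg
  have h2 := pow_le_pow_left' h 2
  simp only [Pi.mul_apply, ENNReal.rpow_two] at h2
  refine h2.trans (le_of_eq ?_)
  rw [mul_pow]
  congr 1 <;> rw [← ENNReal.rpow_two, ← ENNReal.rpow_mul] <;> norm_num

theorem eLpNorm_two_sq {α : Type*} [MeasurableSpace α] {μ : Measure α} (f : α → ℝ) :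
    eLpNorm f 2 μ ^ 2 = ∫⁻ x, ‖f x‖ₑ ^ 2 ∂μ := by
  have := eLpNorm_nnreal_pow_eq_lintegral (μ := μ) (f := f) (p := 2) (by norm_num)
  simpa using this

/-- The contraction factor used at stage `n` of the smoothing. -/
def contr (n : ℕ) : ℝ := 1 - 1 / (n + 2)

theorem half_le_contr (n : ℕ) : 1 / 2 ≤ contr n := by
  have : (1 : ℝ) / (n + 2) ≤ 1 / 2 := by
    apply one_div_le_one_div_of_le (by norm_num); linarith [n.cast_nonneg (α := ℝ)]
  unfold contr; linarith

theorem contr_pos (n : ℕ) : 0 < contr n := lt_of_lt_of_le (by norm_num) (half_le_contr n)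

theorem contr_le_one (n : ℕ) : contr n ≤ 1 := by
  have : (0 : ℝ) ≤ 1 / (n + 2) := by positivity
  unfold contr; linarith

theorem tendsto_one_div_add_two : Tendsto (fun n : ℕ => 1 / ((n : ℝ) + 2)) atTop (𝓝 0) :=
  tendsto_const_nhds.div_atTop
    (tendsto_atTop_add_const_right _ _ tendsto_natCast_atTop_atTop)

theorem tendsto_contr : Tendsto contr atTop (𝓝 1) := by
  have := (tendsto_const_nhds (x := (1 : ℝ))).sub tendsto_one_div_add_two
  rw [sub_zero] at this
  exact this

/-- The bump function in `ℝ³` used at stage `n` of the smoothing. -/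
def spaceBump {R : ℝ} (hR : 0 < R) (n : ℕ) : ContDiffBump (0 : E3) where
  rIn := R / (n + 2) / 2
  rOut := R / (n + 2)
  rIn_pos := by positivity
  rIn_lt_rOut := half_lt_self (by positivity)

/-- The kernel `ρ_n`. -/
def kern {R : ℝ} (hR : 0 < R) (n : ℕ) : E3 → ℝ := (spaceBump hR n).normed volume

theorem isTest_kern {R : ℝ} (hR : 0 < R) (n : ℕ) : IsTest (kern hR n) :=
  ⟨(spaceBump hR n).contDiff_normed, (spaceBump hR n).hasCompactSupport_normed⟩

theorem kern_nonneg {R : ℝ} (hR : 0 < R) (n : ℕ) (x : E3) : 0 ≤ kern hR n x :=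
  (spaceBump hR n).nonneg_normed x

/-- The smoothing `x ↦ ∫ ρ_n (c_n x - z) g(z) dz`. -/
def smoothing {R : ℝ} (hR : 0 < R) (n : ℕ) (g : E3 → ℝ) (x : E3) : ℝ :=
  ∫ z in cube R, kern hR n (contr n • x - z) * g z

theorem contDiff_kern_sub {R : ℝ} (hR : 0 < R) (n : ℕ) (y : E3) :
    ContDiff ℝ ∞ fun z => kern hR n (y - z) :=
  (isTest_kern hR n).1.comp (contDiff_const.sub contDiff_id)

theorem isTest_kern_sub {R : ℝ} (hR : 0 < R) (n : ℕ) (y : E3) :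
    IsTest fun z => kern hR n (y - z) :=
  ⟨contDiff_kern_sub hR n y,
    (isTest_kern hR n).2.comp_homeomorph (Homeomorph.subLeft y)⟩

/-- The kernel radius is exactly the margin freed by the contraction, `c_n R + R/(n+2) = R`.
Consequently `z ↦ ρ_n(c_n x - z)` is a test function supported in the cube, and weak derivatives can
be tested against it without extending the function. -/
theorem mem_cube_of_contr {R : ℝ} (n : ℕ) {x z : E3} (hx : x ∈ cube R)
    (hz : dist z (contr n • x) ≤ R / (n + 2)) : z ∈ cube R := by
  intro i
  have h1 : |z i - contr n * x i| ≤ R / (n + 2) := by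
    have := (EuclideanSpace.norm_eq (z - contr n • x)) ▸ PiLp.norm_apply_le (z - contr n • x) i
    rw [dist_eq_norm] at hz
    have h := (PiLp.norm_apply_le (z - contr n • x) i).trans hz
    simpa using h
  have h2 : |contr n * x i| < contr n * R := by
    rw [abs_mul, abs_of_pos (contr_pos n)]
    exact mul_lt_mul_of_pos_left (hx i) (contr_pos n)
  have h3 : contr n * R + R / (n + 2) = R := by unfold contr; ring
  calc |z i| = |(z i - contr n * x i) + contr n * x i| := by ring_nf
    _ ≤ |z i - contr n * x i| + |contr n * x i| := abs_add_le _ _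
    _ < R := by linarith

theorem smoothing_eq_convolution {R : ℝ} (hR : 0 < R) (n : ℕ) (g : E3 → ℝ) :
    smoothing hR n g = fun x => (convolution (kern hR n) ((cube R).indicator g)
      (ContinuousLinearMap.lsmul ℝ ℝ) volume) (contr n • x) := by
  funext x
  rw [convolution_eq_swap, smoothing, ← integral_indicator (measurableSet_cube R)]
  congr 1
  funext z
  by_cases hz : z ∈ cube R <;> simp [hz]

theorem locallyIntegrable_indicator {R : ℝ} {g : E3 → ℝ} (hg : MemLp g 2 (cubeMeasure R)) :
    LocallyIntegrable ((cube R).indicator g) volume :=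
  ((integrable_indicator_iff (measurableSet_cube R)).2
    (hg.integrable (by norm_num))).locallyIntegrable

theorem isTest_smoothing {R : ℝ} (hR : 0 < R) (n : ℕ) {g : E3 → ℝ}
    (hg : MemLp g 2 (cubeMeasure R)) : IsTest (smoothing hR n g) := by
  rw [smoothing_eq_convolution]
  constructor
  · refine ((isTest_kern hR n).2.contDiff_convolution_left _ (n := ⊤) (isTest_kern hR n).1
      (locallyIntegrable_indicator hg)).comp ?_
    fun_prop
  · have h1 : HasCompactSupport ((cube R).indicator g) :=
      HasCompactSupport.of_support_subset_isCompact (isCompact_closedCube R)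
        (support_indicator_subset.trans (cube_subset_closedCube R))
    exact ((isTest_kern hR n).2.convolution _ h1).comp_homeomorph
      (Homeomorph.smulOfNeZero (contr n) (contr_pos n).ne')

theorem fderiv_smoothing {R : ℝ} (hR : 0 < R) (n : ℕ) {g : E3 → ℝ}
    (hg : MemLp g 2 (cubeMeasure R)) (i : Fin 3) (x : E3) :
    pd i (smoothing hR n g) x
      = contr n * ∫ z in cube R, pd i (kern hR n) (contr n • x - z) * g z := by
  have hk := isTest_kern hR n
  have h1 := hk.2.hasFDerivAt_convolution_left (ContinuousLinearMap.lsmul ℝ ℝ) (μ := volume)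
    (hk.1.of_le (by simp)) (locallyIntegrable_indicator hg) (contr n • x)
  have h2 : HasFDerivAt (fun x : E3 => contr n • x) (contr n • ContinuousLinearMap.id ℝ E3) x :=
    (hasFDerivAt_id x).const_smul (contr n)
  have h3 := h1.comp x h2
  unfold pd
  rw [smoothing_eq_convolution]
  have h4 := h3.fderiv
  simp only [Function.comp_def] at h4
  rw [h4]
  simp only [ContinuousLinearMap.comp_apply, smul_apply, map_smul,
    ContinuousLinearMap.id_apply, smul_eq_mul]
  congr 1
  rw [convolution_eq_swap, ContinuousLinearMap.integral_apply,
    ← integral_indicator (measurableSet_cube R)]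
  · congr 1
    funext z
    by_cases hz : z ∈ cube R <;> simp [hz]
  · exact (hk.2.fderiv (𝕜 := ℝ)).convolutionExists_left _
      (hk.1.continuous_fderiv (by simp)) (locallyIntegrable_indicator hg) _ |>.integrable_swap

theorem pd_kern_sub {R : ℝ} (hR : 0 < R) (n : ℕ) (i : Fin 3) (y z : E3) :
    pd i (fun z => kern hR n (y - z)) z = - pd i (kern hR n) (y - z) := by
  have h1 : HasFDerivAt (fun z : E3 => y - z) (-ContinuousLinearMap.id ℝ E3) z :=
    (hasFDerivAt_id z).const_sub y
  have h2 := (((isTest_kern hR n).differentiable (y - z)).hasFDerivAt).comp z h1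
  have h3 := h2.fderiv
  simp only [Function.comp_def] at h3
  unfold pd
  rw [h3]
  simp

/-- Smoothing commutes with weak derivatives, up to the factor `c_n`. -/
theorem pd_smoothing {R : ℝ} (hR : 0 < R) (n : ℕ) {i : Fin 3} {g g' : E3 → ℝ}
    (hg : MemLp g 2 (cubeMeasure R)) (hg' : MemLp g' 2 (cubeMeasure R)) (h : WeakPD R i g g')
    {x : E3} (hx : x ∈ cube R) :
    pd i (smoothing hR n g) x = contr n * smoothing hR n g' x := by
  rw [fderiv_smoothing hR n hg]
  congr 1
  have ht := isTest_kern_sub hR n (contr n • x)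
  have hs : tsupport (fun z => kern hR n (contr n • x - z)) ⊆ cube R := by
    intro z hz
    refine mem_cube_of_contr n hx ?_
    have hsub : Function.support (fun z => kern hR n (contr n • x - z)) ⊆
        Metric.closedBall (contr n • x) (R / (n + 2)) := by
      intro w hw
      have h1 : contr n • x - w ∈ Function.support (kern hR n) := hw
      rw [kern, ContDiffBump.support_normed_eq] at h1
      have h2 : ‖contr n • x - w‖ < R / (n + 2) := mem_ball_zero_iff.1 h1
      rw [Metric.mem_closedBall, dist_comm, dist_eq_norm]
      exact h2.le
    exact closure_minimal hsub Metric.isClosed_closedBall hz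
  have h1 := h _ ht hs
  rw [integral_add (integrable_mul_of_test ht.1.continuous hg')
    (integrable_mul_of_test (ht.pd i).1.continuous hg)] at h1
  simp only [pd_kern_sub, neg_mul, integral_neg] at h1
  unfold smoothing
  linarith

theorem smoothing_sub {R : ℝ} (hR : 0 < R) (n : ℕ) {f g : E3 → ℝ}
    (hf : MemLp f 2 (cubeMeasure R)) (hg : MemLp g 2 (cubeMeasure R)) (x : E3) :
    smoothing hR n (f - g) x = smoothing hR n f x - smoothing hR n g x := by
  unfold smoothing
  rw [← integral_sub (integrable_mul_of_test (contDiff_kern_sub hR n _).continuous hf)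
    (integrable_mul_of_test (contDiff_kern_sub hR n _).continuous hg)]
  simp [mul_sub]

theorem lintegral_kern_le {R : ℝ} (hR : 0 < R) (n : ℕ) (x : E3) :
    ∫⁻ z, ENNReal.ofReal (kern hR n (x - z)) = 1 := by
  rw [← ofReal_integral_eq_lintegral_ofReal]
  · rw [integral_sub_left_eq_self, kern, ContDiffBump.integral_normed, ENNReal.ofReal_one]
  · exact (isTest_kern_sub hR n x).1.continuous.integrable_of_hasCompactSupport
      (isTest_kern_sub hR n x).2
  · exact ae_of_all _ fun z => kern_nonneg hR n _

/-- The dilation costs the Jacobian `c_n⁻³`, at most `2³` because `c_n ≥ 1/2`. -/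
theorem lintegral_kern_contr_le {R : ℝ} (hR : 0 < R) (n : ℕ) (z : E3) :
    ∫⁻ x, ENNReal.ofReal (kern hR n (contr n • x - z)) ≤ 8 := by
  have hc : Continuous fun x => kern hR n (x - z) := by
    have := (isTest_kern hR n).1.continuous
    fun_prop
  have hs : HasCompactSupport fun x => kern hR n (x - z) :=
    (isTest_kern hR n).2.comp_homeomorph (Homeomorph.subRight z)
  have hi := hc.integrable_of_hasCompactSupport (μ := volume) hs
  have hi' : Integrable (fun x => kern hR n (contr n • x - z)) :=
    hi.comp_smul (contr_pos n).ne'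
  rw [← ofReal_integral_eq_lintegral_ofReal hi' (ae_of_all _ fun z => kern_nonneg hR n _)]
  rw [Measure.integral_comp_smul volume (fun x => kern hR n (x - z)) (contr n),
    integral_sub_right_eq_self (kern hR n) z, kern, ContDiffBump.integral_normed]
  rw [show (8 : ENNReal) = ENNReal.ofReal 8 by simp]
  refine ENNReal.ofReal_le_ofReal ?_
  have h := half_le_contr n
  have h3 : (1 / 8 : ℝ) ≤ contr n ^ 3 := by
    calc (1 / 8 : ℝ) = (1 / 2) ^ 3 := by norm_num
      _ ≤ _ := by gcongr
  have h0 : 0 < contr n ^ 3 := pow_pos (contr_pos n) 3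
  simp only [finrank_euclideanSpace, Fintype.card_fin, smul_eq_mul, mul_one]
  rw [abs_of_pos (inv_pos.2 h0)]
  rw [inv_le_comm₀ h0 (by norm_num)]
  linarith

/-- Schur's test: Cauchy–Schwarz with the kernel split as `√ρ · √ρ g`, then Tonelli. The kernel has
mass at most `1` in `z` and at most `8` in `x`, and `8 ≤ 3²`. -/
theorem eLpNorm_smoothing_le {R : ℝ} (hR : 0 < R) (n : ℕ) {g : E3 → ℝ}
    (hg : MemLp g 2 (cubeMeasure R)) :
    eLpNorm (smoothing hR n g) 2 (cubeMeasure R) ≤ 3 * eLpNorm g 2 (cubeMeasure R) := by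
  have hpt : ∀ x, ‖smoothing hR n g x‖ₑ ^ 2 ≤
      ∫⁻ z in cube R, ENNReal.ofReal (kern hR n (contr n • x - z)) * ‖g z‖ₑ ^ 2 := by
    intro x
    set k : E3 → ℝ := fun z => kern hR n (contr n • x - z) with hk
    have hkc : Continuous k := (contDiff_kern_sub hR n _).continuous
    have hk0 : ∀ z, 0 ≤ k z := fun z => kern_nonneg hR n _
    calc ‖smoothing hR n g x‖ₑ ^ 2 ≤ (∫⁻ z in cube R, ‖k z * g z‖ₑ) ^ 2 := by
          gcongr; exact enorm_integral_le_lintegral_enorm _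
      _ = (∫⁻ z in cube R, ENNReal.ofReal (√(k z)) * (ENNReal.ofReal (√(k z)) * ‖g z‖ₑ)) ^ 2 := by
          congr 2; funext z
          rw [← mul_assoc, ← ENNReal.ofReal_mul (Real.sqrt_nonneg _), Real.mul_self_sqrt (hk0 z),
            enorm_mul, Real.enorm_of_nonneg (hk0 z)]
      _ ≤ (∫⁻ z in cube R, ENNReal.ofReal (√(k z)) ^ 2) *
          ∫⁻ z in cube R, (ENNReal.ofReal (√(k z)) * ‖g z‖ₑ) ^ 2 := by
          have hm : AEMeasurable (fun z => ENNReal.ofReal (√(k z))) (cubeMeasure R) :=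
            (ENNReal.continuous_ofReal.comp (hkc.sqrt)).measurable.aemeasurable
          exact sq_lintegral_mul_le hm (hm.mul hg.1.enorm)
      _ = (∫⁻ z in cube R, ENNReal.ofReal (k z)) *
          ∫⁻ z in cube R, ENNReal.ofReal (k z) * ‖g z‖ₑ ^ 2 := by
          have : ∀ z, ENNReal.ofReal (√(k z)) ^ 2 = ENNReal.ofReal (k z) := fun z => by
            rw [← ENNReal.ofReal_pow (Real.sqrt_nonneg _), Real.sq_sqrt (hk0 z)]
          simp only [mul_pow, this]
      _ ≤ 1 * ∫⁻ z in cube R, ENNReal.ofReal (k z) * ‖g z‖ₑ ^ 2 := by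
          gcongr
          exact (setLIntegral_le_lintegral _ _).trans (lintegral_kern_le hR n _).le
      _ = _ := one_mul _
  have hsq : eLpNorm (smoothing hR n g) 2 (cubeMeasure R) ^ 2
      ≤ (3 * eLpNorm g 2 (cubeMeasure R)) ^ 2 := by
    rw [mul_pow, eLpNorm_two_sq, eLpNorm_two_sq]
    have hkc : Continuous (fun p : E3 × E3 => kern hR n (contr n • p.1 - p.2)) := by
      have := (isTest_kern hR n).1.continuous
      fun_prop
    calc ∫⁻ x in cube R, ‖smoothing hR n g x‖ₑ ^ 2
        ≤ ∫⁻ x in cube R, ∫⁻ z in cube R,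
            ENNReal.ofReal (kern hR n (contr n • x - z)) * ‖g z‖ₑ ^ 2 := lintegral_mono hpt
      _ = ∫⁻ z in cube R, ∫⁻ x in cube R,
            ENNReal.ofReal (kern hR n (contr n • x - z)) * ‖g z‖ₑ ^ 2 := by
          refine lintegral_lintegral_swap ?_
          refine AEMeasurable.mul
            (ENNReal.continuous_ofReal.comp hkc).measurable.aemeasurable ?_
          exact (hg.1.comp_snd).enorm.pow_const 2
      _ ≤ ∫⁻ z in cube R, 8 * ‖g z‖ₑ ^ 2 := by
          refine lintegral_mono fun z => ?_
          rw [lintegral_mul_const]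
          · gcongr
            exact (setLIntegral_le_lintegral _ _).trans (lintegral_kern_contr_le hR n z)
          · exact (ENNReal.continuous_ofReal.comp
              (hkc.comp (Continuous.prodMk_left z))).measurable
      _ = 8 * ∫⁻ z in cube R, ‖g z‖ₑ ^ 2 := lintegral_const_mul' _ _ (by simp)
      _ ≤ 3 ^ 2 * ∫⁻ z in cube R, ‖g z‖ₑ ^ 2 := by gcongr; norm_num
  exact (ENNReal.pow_le_pow_left_iff two_ne_zero).1 hsq

/-! ### Convergence of the smoothing -/

theorem norm_le_of_mem_cube {R : ℝ} {x : E3} (hx : x ∈ cube R) : ‖x‖ ≤ 2 * R := by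
  have hR : 0 ≤ R := (abs_nonneg _).trans (hx 0).le
  rw [EuclideanSpace.norm_eq, Real.sqrt_le_left (by linarith), Fin.sum_univ_three]
  have h : ∀ i, ‖x i‖ ^ 2 ≤ R ^ 2 := fun i => by
    rw [Real.norm_eq_abs]
    exact pow_le_pow_left₀ (abs_nonneg _) (hx i).le 2
  nlinarith [h 0, h 1, h 2]

/-- The kernel samples points within `R/(n+2)` of `c_n x`, which is itself within `2R/(n+2)` of `x`,
so uniform continuity at scale `3R/(n+2)` suffices. -/
theorem eventually_smoothing_sub_le {R : ℝ} (hR : 0 < R) {k : E3 → ℝ} (hk : Continuous k)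
    (hs : HasCompactSupport k) {ε : ℝ} (hε : 0 < ε) :
    ∀ᶠ n in atTop, ∀ x ∈ cube R, |smoothing hR n k x - k x| ≤ ε := by
  obtain ⟨δ, hδ, hu⟩ := Metric.uniformContinuous_iff.1
    (hs.uniformContinuous_of_continuous hk) ε hε
  have ht := (tendsto_one_div_add_two.const_mul (3 * R)).eventually
    (gt_mem_nhds (show 3 * R * 0 < δ by simpa using hδ))
  filter_upwards [ht] with n hn x hx
  have h := dist_convolution_le (μ := (volume : Measure E3)) (f := kern hR n)
    (g := (cube R).indicator k) (x₀ := contr n • x) (z₀ := k x) (R := R / (n + 2)) hε.le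
    (ContDiffBump.support_normed_eq _).subset (kern_nonneg hR n) (ContDiffBump.integral_normed _)
    (locallyIntegrable_indicator (memLp_of_continuous hk)).aestronglyMeasurable ?_
  · rw [smoothing_eq_convolution, ← Real.dist_eq]
    exact h
  · intro z hz
    rw [Metric.mem_ball] at hz
    rw [indicator_of_mem (mem_cube_of_contr n hx hz.le)]
    refine (hu ?_).le
    have h1 : dist (contr n • x) x ≤ 1 / (n + 2) * (2 * R) := by
      rw [dist_eq_norm, show contr n • x - x = (-(1 / ((n : ℝ) + 2))) • x by
        rw [contr, sub_smul, one_smul, neg_smul]; abel, norm_smul, norm_neg,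
        Real.norm_of_nonneg (by positivity)]
      gcongr
      exact norm_le_of_mem_cube hx
    calc dist z x ≤ dist z (contr n • x) + dist (contr n • x) x := dist_triangle _ _ _
      _ ≤ R / (n + 2) + 1 / (n + 2) * (2 * R) := add_le_add hz.le h1
      _ = 3 * R * (1 / (n + 2)) := by ring
      _ < δ := hn

/-- Density of compactly supported continuous functions together with the uniform operator bound
`3`. With approximation error `ε/5`, the three terms of the triangle inequality contribute three,
one and one fifths. -/
theorem tendsto_smoothing {R : ℝ} (hR : 0 < R) {g : E3 → ℝ} (hg : MemLp g 2 (cubeMeasure R)) :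
    Tendsto (fun n => eLpNorm (smoothing hR n g - g) 2 (cubeMeasure R)) atTop (𝓝 0) := by
  rw [ENNReal.tendsto_nhds_zero]
  intro ε hε
  rcases eq_or_ne ε ⊤ with rfl | htop
  · exact Eventually.of_forall fun _ => le_top
  have hε5 : ε / 5 ≠ 0 := (ENNReal.div_pos hε.ne' (by simp)).ne'
  obtain ⟨k, hks, hkg, hkc, hkm⟩ := hg.exists_hasCompactSupport_eLpNorm_sub_le (by simp) hε5
  set m : ENNReal := cubeMeasure R univ ^ ((2 : ENNReal).toReal)⁻¹ with hm
  have hmtop : m ≠ ⊤ := (ENNReal.rpow_lt_top_of_nonneg (by simp) (measure_ne_top _ _)).ne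
  obtain ⟨η, hη, hηm⟩ : ∃ η : ℝ, 0 < η ∧ m * ENNReal.ofReal η ≤ ε / 5 := by
    have hlim : Tendsto (fun η : ℝ => m * ENNReal.ofReal η) (𝓝[>] 0) (𝓝 (m * ENNReal.ofReal 0)) :=
      ENNReal.Tendsto.const_mul
        ((ENNReal.continuous_ofReal.tendsto 0).mono_left nhdsWithin_le_nhds) (Or.inr hmtop)
    simp only [ENNReal.ofReal_zero, mul_zero] at hlim
    have h1 := (ENNReal.tendsto_nhds_zero.1 hlim) (ε / 5) (pos_iff_ne_zero.2 hε5)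
    obtain ⟨η, h2, h3⟩ := (h1.and self_mem_nhdsWithin).exists
    exact ⟨η, h3, h2⟩
  filter_upwards [eventually_smoothing_sub_le hR hkc hks hη] with n hn
  have hgk := hg.sub hkm
  have e : smoothing hR n g - g = (smoothing hR n (g - k) + (smoothing hR n k - k)) - (g - k) := by
    funext x
    simp only [Pi.sub_apply, Pi.add_apply, smoothing_sub hR n hg hkm]
    ring
  have m1 := (isTest_smoothing hR n hgk).1.continuous.aestronglyMeasurable (μ := cubeMeasure R)
  have m2 := ((isTest_smoothing hR n hkm).1.continuous.sub hkc).aestronglyMeasurable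
    (μ := cubeMeasure R)
  have b2 : eLpNorm (smoothing hR n k - k) 2 (cubeMeasure R) ≤ ε / 5 := by
    refine (eLpNorm_le_of_ae_bound (C := η) ?_).trans hηm
    filter_upwards [ae_mem_cube R] with x hx
    exact hn x hx
  calc eLpNorm (smoothing hR n g - g) 2 (cubeMeasure R)
      ≤ eLpNorm (smoothing hR n (g - k)) 2 (cubeMeasure R)
        + eLpNorm (smoothing hR n k - k) 2 (cubeMeasure R) + eLpNorm (g - k) 2 (cubeMeasure R) := by
        rw [e]
        exact (eLpNorm_sub_le (m1.add m2) hgk.1 (by norm_num)).trans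
          (add_le_add_left (eLpNorm_add_le m1 m2 (by norm_num)) _)
    _ ≤ 3 * (ε / 5) + ε / 5 + ε / 5 := by
        gcongr
        exact (eLpNorm_smoothing_le hR n hgk).trans (by gcongr)
    _ = 5 * (ε / 5) := by ring
    _ ≤ ε := ENNReal.mul_div_le

/-! ### Integration by parts in the Sobolev spaces of the cube -/

theorem integral_mul_eq_inner {α : Type*} [MeasurableSpace α] {μ : Measure α} {f g : α → ℝ}
    (hf : MemLp f 2 μ) (hg : MemLp g 2 μ) :
    ∫ x, f x * g x ∂μ = inner ℝ (hf.toLp f) (hg.toLp g) := by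
  rw [L2.inner_def]
  refine integral_congr_ae ?_
  filter_upwards [hf.coeFn_toLp, hg.coeFn_toLp] with x h1 h2
  rw [h1, h2]
  simp [mul_comm]

theorem integrable_mul_L2 {α : Type*} [MeasurableSpace α] {μ : Measure α} {f g : α → ℝ}
    (hf : MemLp f 2 μ) (hg : MemLp g 2 μ) : Integrable (fun x => f x * g x) μ :=
  MemLp.integrable_mul hf hg

theorem tendsto_integral_mul {α : Type*} [MeasurableSpace α] {μ : Measure α} {f g : α → ℝ}
    {G : ℕ → α → ℝ} (hf : MemLp f 2 μ) (hg : MemLp g 2 μ) (hG : ∀ n, MemLp (G n) 2 μ)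
    (h : Tendsto (fun n => eLpNorm (G n - g) 2 μ) atTop (𝓝 0)) :
    Tendsto (fun n => ∫ x, f x * G n x ∂μ) atTop (𝓝 (∫ x, f x * g x ∂μ)) := by
  simp only [integral_mul_eq_inner hf hg, integral_mul_eq_inner hf (hG _)]
  refine Tendsto.inner tendsto_const_nhds ?_
  rwa [Lp.tendsto_Lp_iff_tendsto_eLpNorm'' _ hG _ hg]

theorem IsTest.memLp {R : ℝ} {p : ENNReal} {φ : E3 → ℝ} (h : IsTest φ) :
    MemLp φ p (cubeMeasure R) := memLp_of_continuous h.1.continuous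

/-- Integration by parts: no boundary terms appear when one of the factors vanishes on the faces
orthogonal to the axis. -/
theorem ZeroPD.integral_mul {R : ℝ} (hR : 0 < R) {i : Fin 3} {f f' g g' : E3 → ℝ}
    (h : ZeroPD R i f f') (h' : WeakPD R i g g') (hf : MemLp f 2 (cubeMeasure R))
    (hf' : MemLp f' 2 (cubeMeasure R)) (hg : MemLp g 2 (cubeMeasure R))
    (hg' : MemLp g' 2 (cubeMeasure R)) :
    ∫ x in cube R, f x * g' x = - ∫ x in cube R, f' x * g x := by
  -- The smoothing of `g` is a test function on the whole space, not supported in the cube. It is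
  -- admissible for `f` because `f` satisfies the formula with no support condition; inside the cube
  -- its derivative is `c_n` times the smoothing of `g'`.
  have hn : ∀ n, (∫ x in cube R, f' x * smoothing hR n g x)
      + contr n * ∫ x in cube R, f x * smoothing hR n g' x = 0 := by
    intro n
    have ht := isTest_smoothing hR n hg
    have ht' := isTest_smoothing hR n hg'
    rw [← h _ ht (subset_univ _), ← integral_const_mul, ← integral_add
      (integrable_mul_L2 hf' ht.memLp) ((integrable_mul_L2 hf ht'.memLp).const_mul _)]
    refine integral_congr_ae ?_
    filter_upwards [ae_mem_cube R] with x hx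
    rw [pd_smoothing hR n hg hg' h' hx]
    ring
  have l1 := tendsto_integral_mul hf' hg (fun n => (isTest_smoothing hR n hg).memLp)
    (tendsto_smoothing hR hg)
  have l2 := tendsto_integral_mul hf hg' (fun n => (isTest_smoothing hR n hg').memLp)
    (tendsto_smoothing hR hg')
  have l3 := l1.add (tendsto_contr.mul l2)
  simp only [hn, one_mul] at l3
  have := tendsto_nhds_unique l3 tendsto_const_nhds
  linarith

/-! ### Functions of the height -/

theorem pd_comp_coord {F : ℝ → ℝ} (hF : Differentiable ℝ F) (i j : Fin 3) (x : E3) :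
    pd i (fun x => F (x j)) x = if j = i then deriv F (x j) else 0 := by
  have h1 : HasFDerivAt (fun x : E3 => x j) (EuclideanSpace.proj j : E3 →L[ℝ] ℝ) x :=
    (EuclideanSpace.proj j : E3 →L[ℝ] ℝ).hasFDerivAt
  have h2 := ((hF (x j)).hasDerivAt.comp_hasFDerivAt x h1).fderiv
  simp only [Function.comp_def] at h2
  unfold pd
  rw [h2]
  by_cases h : j = i <;> simp [h]

/-- The derivative `2 λ (z - r)` of the exponent `λ (z - r)²`. -/
def slope (lam r : ℝ) (x : E3) : ℝ := 2 * lam * (x 2 - r)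

theorem contDiff_slope (lam r : ℝ) : ContDiff ℝ ∞ (slope lam r) := by
  unfold slope
  fun_prop

theorem pd_slope (lam r : ℝ) (i : Fin 3) (x : E3) :
    pd i (slope lam r) x = if 2 = i then 2 * lam else 0 := by
  have := pd_comp_coord (F := fun t => 2 * lam * (t - r)) (by fun_prop) i 2 x
  rw [show slope lam r = fun x => (fun t => 2 * lam * (t - r)) (x 2) from rfl, this]
  congr 1
  simp

/-- A smooth cutoff, decreasing in `z`, which vanishes near the face `z = R`. -/
def topCutoff (R : ℝ) (n : ℕ) (x : E3) : ℝ := Real.smoothTransition ((n + 1) * (R - x 2) - 1)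

theorem contDiff_topCutoff (R : ℝ) (n : ℕ) : ContDiff ℝ ∞ (topCutoff R n) := by
  unfold topCutoff
  refine Real.smoothTransition.contDiff.comp ?_
  fun_prop

theorem pd_topCutoff_nonpos (R : ℝ) (n : ℕ) (x : E3) : pd 2 (topCutoff R n) x ≤ 0 := by
  have hd : Differentiable ℝ fun t : ℝ => Real.smoothTransition ((n + 1) * (R - t) - 1) :=
    (Real.smoothTransition.contDiff (n := 1)).differentiable (by simp) |>.comp (by fun_prop)
  have := pd_comp_coord hd 2 2 x
  rw [show topCutoff R n = fun x => (fun t : ℝ =>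
    Real.smoothTransition ((n + 1) * (R - t) - 1)) (x 2) from rfl, this, if_pos rfl]
  refine Antitone.deriv_nonpos fun s t hst => Real.smoothTransition.monotone ?_
  have : (0 : ℝ) ≤ n + 1 := by positivity
  nlinarith

theorem tsupport_topCutoff_subset (R : ℝ) (n : ℕ) : tsupport (topCutoff R n) ⊆ {x | x 2 < R} := by
  have hcl : IsClosed {x : E3 | (0 : ℝ) ≤ (n + 1) * (R - x 2) - 1} :=
    isClosed_le continuous_const (by fun_prop)
  intro x hx
  have h : (0 : ℝ) ≤ (n + 1) * (R - x 2) - 1 := by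
    refine closure_minimal (fun y hy => ?_) hcl hx
    by_contra h
    exact hy (Real.smoothTransition.zero_of_nonpos (not_le.1 h).le)
  by_contra h'
  have h1 : R - x 2 ≤ 0 := by simpa using h'
  have : (0 : ℝ) ≤ n + 1 := by positivity
  nlinarith

theorem eventually_topCutoff_eq_one {R : ℝ} {x : E3} (hx : x 2 < R) :
    ∀ᶠ n in atTop, topCutoff R n x = 1 := by
  have ht : Tendsto (fun n : ℕ => ((n : ℝ) + 1) * (R - x 2)) atTop atTop :=
    (tendsto_atTop_add_const_right _ _ tendsto_natCast_atTop_atTop).atTop_mul_const (sub_pos.2 hx)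
  filter_upwards [ht.eventually_ge_atTop 2] with n hn
  exact Real.smoothTransition.one_of_one_le (by linarith)

/-! ### The identities behind the Carleman estimate -/

/-- A function with second weak derivatives in the cube, vanishing on the boundary of the cube and
with vanishing normal derivative on the bottom face. -/
structure CarlemanData (R : ℝ) (v : E3 → ℝ) (v1 : Fin 3 → E3 → ℝ) (v2 : Fin 3 → Fin 3 → E3 → ℝ) :
    Prop where
  memLp : MemLp v 2 (cubeMeasure R)
  memLp1 : ∀ i, MemLp (v1 i) 2 (cubeMeasure R)
  memLp2 : ∀ i j, MemLp (v2 i j) 2 (cubeMeasure R)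
  symm : ∀ i j, v2 i j = v2 j i
  zero : ∀ i, ZeroPD R i v (v1 i)
  weak : ∀ i j, WeakPD R j (v1 i) (v2 i j)
  bottom : IBPOn R {x | x 2 < R} 2 (v1 2) (v2 2 2)
  third : ∀ i j, i ≠ j → j ≠ 2 → ∃ q, MemLp q 2 (cubeMeasure R) ∧ WeakPD R j (v2 i j) q

section Carleman

variable {R : ℝ} {v : E3 → ℝ} {v1 : Fin 3 → E3 → ℝ} {v2 : Fin 3 → Fin 3 → E3 → ℝ}

theorem CarlemanData.weak0 (h : CarlemanData R v v1 v2) (i : Fin 3) : WeakPD R i v (v1 i) :=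
  (h.zero i).mono (subset_univ _)

/-- A tangential derivative of a function vanishing on a face vanishes there too. -/
theorem CarlemanData.zero1 (hR : 0 < R) (h : CarlemanData R v v1 v2) {i j : Fin 3} (hij : i ≠ j) :
    ZeroPD R i (v1 j) (v2 i j) :=
  (h.zero i).transfer hR hij (h.weak0 j) (h.weak i j) h.memLp (h.memLp1 i) (h.memLp1 j)
    (h.memLp2 i j)

theorem CarlemanData.integral_pure (hR : 0 < R) (h : CarlemanData R v v1 v2) (i : Fin 3) :
    ∫ x in cube R, v x * v2 i i x = - ∫ x in cube R, v1 i x * v1 i x :=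
  (h.zero i).integral_mul hR (h.weak i i) h.memLp (h.memLp1 i) (h.memLp1 i) (h.memLp2 i i)

/-- Two integrations by parts through the third derivative `q = ∂_j v_ij = ∂_i v_jj`, and this is
why three derivatives are required. The first uses that `v_jj` vanishes on the faces `x_i = ±R`, the
second that `v_i` vanishes on `x_j = ±R`. -/
theorem CarlemanData.integral_mixed_of_ne_two (hR : 0 < R) (h : CarlemanData R v v1 v2)
    {i j : Fin 3} (hij : i ≠ j) (hj : j ≠ 2) :
    ∫ x in cube R, v2 j j x * v2 i i x = ∫ x in cube R, v2 i j x * v2 i j x := by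
  obtain ⟨q, hq, hw⟩ := h.third i j hij hj
  have h1 : ZeroPD R i (v2 j j) q := (h.zero1 hR hij).transfer hR hij (h.weak j j) hw
    (h.memLp1 j) (h.memLp2 i j) (h.memLp2 j j) hq
  have h2 : ZeroPD R j (v1 i) (v2 i j) := h.symm i j ▸ h.zero1 hR hij.symm
  rw [h1.integral_mul hR (h.weak i i) (h.memLp2 j j) hq (h.memLp1 i) (h.memLp2 i i)]
  have h3 := h2.integral_mul hR hw (h.memLp1 i) (h.memLp2 i j) (h.memLp2 i j) hq
  simp only [mul_comm (q _)]
  rw [h3, neg_neg]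

theorem CarlemanData.integral_mixed (hR : 0 < R) (h : CarlemanData R v v1 v2) {i j : Fin 3}
    (hij : i ≠ j) :
    ∫ x in cube R, v2 j j x * v2 i i x = ∫ x in cube R, v2 i j x * v2 i j x := by
  by_cases hj : j = 2
  · have hi : i ≠ 2 := fun hi => hij (hi.trans hj.symm)
    rw [h.symm i j, ← h.integral_mixed_of_ne_two hR hij.symm hi]
    simp only [mul_comm]
  · exact h.integral_mixed_of_ne_two hR hij hj

/-- The weak derivative of `slope * f`. -/
theorem WeakPD.slope_mul {f f' : E3 → ℝ} (h : WeakPD R 2 f f') (lam r : ℝ) :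
    WeakPD R 2 (fun x => slope lam r x * f x)
      (fun x => slope lam r x * f' x + 2 * lam * f x) := by
  have := h.mul_smooth (contDiff_slope lam r)
  simpa only [pd_slope, if_true] using this

theorem memLp_slope_mul {f : E3 → ℝ} (hf : MemLp f 2 (cubeMeasure R)) (lam r : ℝ) :
    MemLp (fun x => slope lam r x * f x) 2 (cubeMeasure R) :=
  MemLp.smooth_mul (contDiff_slope lam r).continuous hf

/-- This is `∫ s ∂_z(f²)/2 = -∫ s' f²/2` with `s' = 2λ`. It is the source of every gain of `λ` in
the identities below. -/
theorem ZeroPD.integral_slope_mul (hR : 0 < R) {f f' : E3 → ℝ} (h : ZeroPD R 2 f f')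
    (hf : MemLp f 2 (cubeMeasure R)) (hf' : MemLp f' 2 (cubeMeasure R)) (lam r : ℝ) :
    ∫ x in cube R, slope lam r x * f x * f' x = -(lam * ∫ x in cube R, f x * f x) := by
  have h0 : WeakPD R 2 f f' := h.mono (subset_univ _)
  have h1 := h.integral_mul hR (h0.slope_mul lam r) hf hf' (memLp_slope_mul hf lam r)
    ((memLp_slope_mul hf' lam r).add (hf.const_mul _))
  have i1 := integrable_mul_L2 (memLp_slope_mul hf lam r) hf'
  have i2 := integrable_mul_L2 hf hf
  have e1 : ∫ x in cube R, f x * (slope lam r x * f' x + 2 * lam * f x)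
      = (∫ x in cube R, slope lam r x * f x * f' x) + 2 * lam * ∫ x in cube R, f x * f x := by
    rw [← integral_const_mul, ← integral_add i1 (i2.const_mul _)]
    congr 1; funext x; ring
  have e2 : ∫ x in cube R, f' x * (slope lam r x * f x)
      = ∫ x in cube R, slope lam r x * f x * f' x := by
    congr 1; funext x; ring
  rw [e1, e2] at h1
  linarith

/-- Integrate by parts along `x_i`, where `v_z` vanishes on the faces and the slope is constant,
then along `z`, where `v_i` vanishes on both faces. -/
theorem CarlemanData.integral_tangential (hR : 0 < R) (h : CarlemanData R v v1 v2) {i : Fin 3}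
    (hi : i ≠ 2) (lam r : ℝ) :
    ∫ x in cube R, slope lam r x * v1 2 x * v2 i i x = lam * ∫ x in cube R, v1 i x * v1 i x := by
  have h1 : ZeroPD R i (v1 2) (v2 i 2) := h.zero1 hR hi
  have h2 : ZeroPD R 2 (v1 i) (v2 i 2) := h.symm i 2 ▸ h.zero1 hR hi.symm
  have h3 := h2.integral_slope_mul hR (h.memLp1 i) (h.memLp2 i 2) lam r
  have h5 := h1.mul_smooth (contDiff_slope lam r)
  simp only [pd_slope, hi.symm, if_false, zero_mul, add_zero] at h5
  have h6 := ZeroPD.integral_mul hR h5 (h.weak i i) (memLp_slope_mul (h.memLp1 2) lam r)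
    (memLp_slope_mul (h.memLp2 i 2) lam r) (h.memLp1 i) (h.memLp2 i i)
  rw [h6]
  have e : ∫ x in cube R, slope lam r x * v2 i 2 x * v1 i x
      = ∫ x in cube R, slope lam r x * v1 i x * v2 i 2 x := by
    congr 1; funext x; ring
  rw [e, h3, neg_neg]

/-- Nothing is known about `v_z` on the top face, so only an inequality is available. The boundary
term there is `s v_z²/2` up to a positive face integral, and it is nonpositive since `s < 0` for `z
≤ R < r`. Cutoffs decreasing in `z` stand in for the trace: the term containing their derivative has
the sign of `(-)(-) v_z² ≥ 0`. -/
theorem CarlemanData.integral_normal_le (hR : 0 < R) (h : CarlemanData R v v1 v2) {lam r : ℝ}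
    (hlam : 0 < lam) (hr : R < r) :
    ∫ x in cube R, slope lam r x * v1 2 x * v2 2 2 x ≤ -(lam * ∫ x in cube R, v1 2 x * v1 2 x) := by
  have m1 := h.memLp1 2
  have m2 := h.memLp2 2 2
  have hp := contDiff_slope lam r
  have i1 := integrable_mul_L2 (memLp_slope_mul m1 lam r) m2
  have i2 := integrable_mul_L2 m1 m1
  set F : E3 → ℝ := fun x => 2 * (slope lam r x * v1 2 x * v2 2 2 x)
    + 2 * lam * (v1 2 x * v1 2 x) with hF
  have iF : Integrable F (cubeMeasure R) := (i1.const_mul 2).add (i2.const_mul (2 * lam))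
  have hn : ∀ n, ∫ x in cube R, topCutoff R n x * F x ≤ 0 := by
    intro n
    have hk := contDiff_topCutoff R n
    have hz : ZeroPD R 2 (fun x => topCutoff R n x * v1 2 x)
        (fun x => topCutoff R n x * v2 2 2 x + pd 2 (topCutoff R n) x * v1 2 x) :=
      h.bottom.mul_smooth_of_subset hk
        (inter_subset_left.trans (tsupport_topCutoff_subset R n))
    have mz := MemLp.smooth_mul hk.continuous m1
    have mz' := (MemLp.smooth_mul hk.continuous m2).add
      (MemLp.smooth_mul (contDiff_pd hk 2).continuous m1)
    have mg := memLp_slope_mul m1 lam r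
    have mg' := (memLp_slope_mul m2 lam r).add (m1.const_mul (2 * lam))
    have e := hz.integral_mul hR ((h.weak 2 2).slope_mul lam r) mz mz' mg mg'
    have e' : ∫ x in cube R,
        (topCutoff R n x * v1 2 x * (slope lam r x * v2 2 2 x + 2 * lam * v1 2 x)
        + (topCutoff R n x * v2 2 2 x + pd 2 (topCutoff R n) x * v1 2 x)
          * (slope lam r x * v1 2 x)) = 0 := by
      refine (integral_add (integrable_mul_L2 mz mg') (integrable_mul_L2 mz' mg)).trans ?_
      simp only [Pi.add_apply]
      linarith
    rw [← e']
    refine integral_mono_ae ?_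
      ((integrable_mul_L2 mz mg').add (integrable_mul_L2 mz' mg)) ?_
    · refine iF.bdd_mul (c := 1) hk.continuous.aestronglyMeasurable (ae_of_all _ fun x => ?_)
      rw [topCutoff, Real.norm_of_nonneg (Real.smoothTransition.nonneg _)]
      exact Real.smoothTransition.le_one _
    · filter_upwards [ae_mem_cube R] with x hx
      have hs : slope lam r x ≤ 0 := by
        have := (abs_lt.1 (hx 2)).2
        unfold slope
        nlinarith
      have := mul_nonneg (mul_nonneg_of_nonpos_of_nonpos (pd_topCutoff_nonpos R n x) hs)
        (mul_self_nonneg (v1 2 x))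
      rw [hF]
      dsimp only
      linarith
  have hlim : Tendsto (fun n => ∫ x in cube R, topCutoff R n x * F x) atTop
      (𝓝 (∫ x in cube R, F x)) := by
    refine tendsto_integral_of_dominated_convergence (fun x => ‖F x‖) (fun n => ?_) iF.norm
      (fun n => ?_) ?_
    · exact (contDiff_topCutoff R n).continuous.aestronglyMeasurable.mul iF.1
    · refine ae_of_all _ fun x => ?_
      rw [norm_mul, topCutoff, Real.norm_of_nonneg (Real.smoothTransition.nonneg _)]
      exact mul_le_of_le_one_left (norm_nonneg _) (Real.smoothTransition.le_one _)
    · filter_upwards [ae_mem_cube R] with x hx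
      refine Tendsto.congr' ?_ tendsto_const_nhds
      filter_upwards [eventually_topCutoff_eq_one (abs_lt.1 (hx 2)).2] with n hn
      rw [hn, one_mul]
  have hle := le_of_tendsto' hlim hn
  rw [hF, integral_add (i1.const_mul 2) (i2.const_mul (2 * lam)), integral_const_mul,
    integral_const_mul] at hle
  linarith

/-! ### The Carleman estimate -/

/-- The conjugated Laplacian `e^{φ} Δ (e^{-φ} v)`, `φ = λ (z - r)²`. -/
def conjLap (lam r : ℝ) (v : E3 → ℝ) (v1 : Fin 3 → E3 → ℝ) (v2 : Fin 3 → Fin 3 → E3 → ℝ)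
    (x : E3) : ℝ :=
  ∑ i, v2 i i x - 2 * slope lam r x * v1 2 x + (slope lam r x ^ 2 - 2 * lam) * v x

/-- The self-adjoint part of `conjLap`. -/
def symmPart (lam r : ℝ) (v : E3 → ℝ) (v2 : Fin 3 → Fin 3 → E3 → ℝ) (x : E3) : ℝ :=
  ∑ i, v2 i i x + slope lam r x ^ 2 * v x

theorem CarlemanData.memLp_lap (h : CarlemanData R v v1 v2) :
    MemLp (fun x => ∑ i, v2 i i x) 2 (cubeMeasure R) :=
  memLp_finsetSum _ fun i _ => h.memLp2 i i

theorem memLp_slope_sq_mul {f : E3 → ℝ} (hf : MemLp f 2 (cubeMeasure R)) (lam r : ℝ) :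
    MemLp (fun x => slope lam r x ^ 2 * f x) 2 (cubeMeasure R) :=
  MemLp.smooth_mul ((contDiff_slope lam r).continuous.pow 2) hf

theorem CarlemanData.memLp_symmPart (h : CarlemanData R v v1 v2) (lam r : ℝ) :
    MemLp (symmPart lam r v v2) 2 (cubeMeasure R) :=
  h.memLp_lap.add (memLp_slope_sq_mul h.memLp lam r)

theorem CarlemanData.memLp_conjLap (h : CarlemanData R v v1 v2) (lam r : ℝ) :
    MemLp (conjLap lam r v v1 v2) 2 (cubeMeasure R) := by
  have hp := (contDiff_slope lam r).continuous
  exact (h.memLp_lap.sub (MemLp.smooth_mul (hp.const_mul 2 |>.congr fun _ => rfl)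
    (h.memLp1 2))).add (MemLp.smooth_mul ((hp.pow 2).sub continuous_const) h.memLp)

/-- The preceding one-dimensional identity applied to `s v`, whose `z`-derivative is `s v_z + 2λ v`.
-/
theorem CarlemanData.integral_cubic (hR : 0 < R) (h : CarlemanData R v v1 v2) (lam r : ℝ) :
    ∫ x in cube R, slope lam r x * (slope lam r x * v x)
        * (slope lam r x * v1 2 x + 2 * lam * v x)
      = -(lam * ∫ x in cube R, (slope lam r x * v x) * (slope lam r x * v x)) := by
  have h1 := (h.zero 2).mul_smooth (contDiff_slope lam r)
  simp only [pd_slope, if_true] at h1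
  exact ZeroPD.integral_slope_mul hR h1 (memLp_slope_mul h.memLp lam r)
    ((memLp_slope_mul (h.memLp1 2) lam r).add (h.memLp.const_mul _)) lam r

/-- Write the conjugated operator as `𝒜 + ℬ` with `𝒜 = Δv + s²v` symmetric and `ℬ = -2s v_z - 2λv`
antisymmetric. The cross term `2𝒜ℬ` integrates to at least `8λ∫v_z² + 8λ∫(sv)²`: the tangential
gradient terms produced by `s v_z Δv` and by `λ v Δv` cancel, whereas the normal ones add. -/
theorem CarlemanData.le_integral_conjLap (hR : 0 < R) (h : CarlemanData R v v1 v2) {lam r : ℝ}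
    (hlam : 0 < lam) (hr : R < r) :
    (∫ x in cube R, symmPart lam r v v2 x ^ 2)
      + 8 * lam * (∫ x in cube R, v1 2 x * v1 2 x)
      + 8 * lam * (∫ x in cube R, (slope lam r x * v x) * (slope lam r x * v x))
      ≤ ∫ x in cube R, conjLap lam r v v1 v2 x ^ 2 := by
  have mA := h.memLp_symmPart lam r
  have mP := h.memLp_conjLap lam r
  have hp := (contDiff_slope lam r).continuous
  have mz := memLp_slope_mul (h.memLp1 2) lam r
  have my := memLp_slope_mul h.memLp lam r
  have t : ∀ i, Integrable (fun x => slope lam r x * v1 2 x * v2 i i x) (cubeMeasure R) :=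
    fun i => integrable_mul_L2 mz (h.memLp2 i i)
  have u : ∀ i, Integrable (fun x => v x * v2 i i x) (cubeMeasure R) :=
    fun i => integrable_mul_L2 h.memLp (h.memLp2 i i)
  have c : Integrable (fun x => slope lam r x * (slope lam r x * v x)
        * (slope lam r x * v1 2 x + 2 * lam * v x)) (cubeMeasure R) :=
    integrable_mul_L2 (memLp_slope_mul my lam r) (mz.add (h.memLp.const_mul _))
  have y : Integrable (fun x => (slope lam r x * v x) * (slope lam r x * v x)) (cubeMeasure R) :=
    integrable_mul_L2 my my
  have a : Integrable (fun x => symmPart lam r v v2 x ^ 2) (cubeMeasure R) := mA.integrable_sq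
  have hle : ∫ x in cube R, (symmPart lam r v v2 x ^ 2 + -4 * (slope lam r x * v1 2 x * v2 0 0 x)
      + -4 * (slope lam r x * v1 2 x * v2 1 1 x) + -4 * (slope lam r x * v1 2 x * v2 2 2 x)
      + -(4 * lam) * (v x * v2 0 0 x) + -(4 * lam) * (v x * v2 1 1 x)
      + -(4 * lam) * (v x * v2 2 2 x)
      + -4 * (slope lam r x * (slope lam r x * v x) * (slope lam r x * v1 2 x + 2 * lam * v x))
      + 4 * lam * ((slope lam r x * v x) * (slope lam r x * v x)))
      ≤ ∫ x in cube R, conjLap lam r v v1 v2 x ^ 2 := by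
    refine integral_mono ((((((((a.add ((t 0).const_mul _)).add ((t 1).const_mul _)).add
      ((t 2).const_mul _)).add ((u 0).const_mul _)).add ((u 1).const_mul _)).add
      ((u 2).const_mul _)).add (c.const_mul _)).add (y.const_mul _)) mP.integrable_sq fun x => ?_
    simp only [symmPart, conjLap, Fin.sum_univ_three]
    -- The square of the antisymmetric part is discarded. The cubic term is written with `s v_z + 2λ
    -- v`, which overcounts by `-4λ(sv)²`; the last summand restores it.
    nlinarith [sq_nonneg (2 * slope lam r x * v1 2 x + 2 * lam * v x)]
  rw [integral_add (by fun_prop) (by fun_prop), integral_add (by fun_prop) (by fun_prop),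
    integral_add (by fun_prop) (by fun_prop), integral_add (by fun_prop) (by fun_prop),
    integral_add (by fun_prop) (by fun_prop), integral_add (by fun_prop) (by fun_prop),
    integral_add (by fun_prop) (by fun_prop), integral_add (by fun_prop) (by fun_prop)] at hle
  simp only [integral_const_mul] at hle
  rw [h.integral_cubic hR lam r, h.integral_pure hR 0, h.integral_pure hR 1, h.integral_pure hR 2,
    h.integral_tangential hR (show (0 : Fin 3) ≠ 2 by decide) lam r,
    h.integral_tangential hR (show (1 : Fin 3) ≠ 2 by decide) lam r] at hle
  have hn := h.integral_normal_le hR hlam hr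
  linarith

/-- The cross terms give no control of the tangential gradient. It is recovered by pairing the
symmetric part with `v` itself. -/
theorem CarlemanData.integral_grad_sq (hR : 0 < R) (h : CarlemanData R v v1 v2) (lam r : ℝ) :
    ∑ i, ∫ x in cube R, v1 i x * v1 i x
      = (∫ x in cube R, (slope lam r x * v x) * (slope lam r x * v x))
        - ∫ x in cube R, symmPart lam r v v2 x * v x := by
  have my := memLp_slope_mul h.memLp lam r
  have u : ∀ i, Integrable (fun x => v x * v2 i i x) (cubeMeasure R) :=
    fun i => integrable_mul_L2 h.memLp (h.memLp2 i i)
  have y : Integrable (fun x => (slope lam r x * v x) * (slope lam r x * v x)) (cubeMeasure R) :=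
    integrable_mul_L2 my my
  have e : ∫ x in cube R, symmPart lam r v v2 x * v x
      = ∫ x in cube R, (v x * v2 0 0 x + v x * v2 1 1 x + v x * v2 2 2 x
        + (slope lam r x * v x) * (slope lam r x * v x)) := by
    congr 1; funext x; simp only [symmPart, Fin.sum_univ_three]; ring
  have hu0 := u 0
  have hu1 := u 1
  have hu2 := u 2
  rw [e, integral_add (by fun_prop) y, integral_add (by fun_prop) hu2, integral_add hu0 hu1,
    h.integral_pure hR 0, h.integral_pure hR 1, h.integral_pure hR 2, Fin.sum_univ_three]
  ring

/-- Expanding `(Δv)²` gives the products `v_ii v_jj`, each of which integrates to `v_ij²`. The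
Laplacian thus controls the full Hessian. -/
theorem CarlemanData.integral_hess_sq (hR : 0 < R) (h : CarlemanData R v v1 v2) :
    ∑ i, ∑ j, ∫ x in cube R, v2 i j x * v2 i j x = ∫ x in cube R, (∑ i, v2 i i x) ^ 2 := by
  have hi : ∀ i j, Integrable (fun x => v2 j j x * v2 i i x) (cubeMeasure R) :=
    fun i j => integrable_mul_L2 (h.memLp2 j j) (h.memLp2 i i)
  have e : ∀ i j, ∫ x in cube R, v2 i j x * v2 i j x = ∫ x in cube R, v2 j j x * v2 i i x := by
    intro i j
    by_cases hij : i = j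
    · subst hij; rfl
    · exact (h.integral_mixed hR hij).symm
  rw [Finset.sum_congr rfl fun i _ => Finset.sum_congr rfl fun j _ => e i j,
    Finset.sum_congr rfl fun i _ => (integral_finsetSum _ fun j _ => hi i j).symm,
    ← integral_finsetSum _ fun i _ => integrable_finsetSum _ fun j _ => hi i j]
  congr 1
  funext x
  rw [sq, Finset.sum_mul_sum, Finset.sum_comm]

/-- The Carleman estimate in terms of the conjugated function `v`. -/
theorem CarlemanData.estimate (hR : 0 < R) (h : CarlemanData R v v1 v2) {lam r : ℝ}
    (hlam : 1 ≤ lam) (hr : R < r) :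
    8 * lam * (∫ x in cube R, (slope lam r x * v x) * (slope lam r x * v x))
        ≤ ∫ x in cube R, conjLap lam r v v1 v2 x ^ 2 ∧
    32 * (r - R) ^ 2 * lam ^ 3 * (∫ x in cube R, v x * v x)
        ≤ ∫ x in cube R, conjLap lam r v v1 v2 x ^ 2 ∧
    lam * ∑ i, ∫ x in cube R, v1 i x * v1 i x
        ≤ (1 + 1 / (r - R) ^ 2) * ∫ x in cube R, conjLap lam r v v1 v2 x ^ 2 ∧
    ∑ i, ∑ j, ∫ x in cube R, v2 i j x * v2 i j x
        ≤ (2 + (r + R) ^ 2) * lam * ∫ x in cube R, conjLap lam r v v1 v2 x ^ 2 := by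
  have hl : 0 < lam := by linarith
  have hc : 0 < r - R := by linarith
  have my := memLp_slope_mul h.memLp lam r
  have mA := h.memLp_symmPart lam r
  have key := h.le_integral_conjLap hR hl hr
  have e2 := h.integral_grad_sq hR lam r
  have e3 := h.integral_hess_sq hR
  have iv : Integrable (fun x => v x * v x) (cubeMeasure R) := integrable_mul_L2 h.memLp h.memLp
  have iy : Integrable (fun x => (slope lam r x * v x) * (slope lam r x * v x)) (cubeMeasure R) :=
    integrable_mul_L2 my my
  have iA : Integrable (fun x => symmPart lam r v v2 x ^ 2) (cubeMeasure R) := mA.integrable_sq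
  set S := ∫ x in cube R, conjLap lam r v v1 v2 x ^ 2 with hS
  set Y := ∫ x in cube R, (slope lam r x * v x) * (slope lam r x * v x) with hY
  set A := ∫ x in cube R, symmPart lam r v v2 x ^ 2 with hA
  set V := ∫ x in cube R, v x * v x with hV
  have hA0 : 0 ≤ A := integral_nonneg fun x => sq_nonneg _
  have hY0 : 0 ≤ Y := integral_nonneg fun x => mul_self_nonneg _
  have hV0 : 0 ≤ V := integral_nonneg fun x => mul_self_nonneg _
  have hz0 : 0 ≤ ∫ x in cube R, v1 2 x * v1 2 x := integral_nonneg fun x => mul_self_nonneg _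
  have hz1 : 0 ≤ 8 * lam * ∫ x in cube R, v1 2 x * v1 2 x := by positivity
  have hYS : 8 * lam * Y ≤ S := by linarith
  have hAS : A ≤ S := by
    have : 0 ≤ 8 * lam * Y := by positivity
    linarith
  have hS0 : 0 ≤ S := hA0.trans hAS
  have slope_lower : ∀ x ∈ cube R, 4 * (r - R) ^ 2 * lam ^ 2 ≤ slope lam r x ^ 2 := by
    intro x hx
    have h1 := (abs_lt.1 (hx 2)).2
    have h2 : (r - R) ^ 2 ≤ (r - x 2) ^ 2 := by gcongr
    have : slope lam r x ^ 2 = 4 * (r - x 2) ^ 2 * lam ^ 2 := by unfold slope; ring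
    rw [this]; gcongr
  have slope_upper : ∀ x ∈ cube R, slope lam r x ^ 2 ≤ 4 * (r + R) ^ 2 * lam ^ 2 := by
    intro x hx
    have h1 := (abs_lt.1 (hx 2))
    have h2 : (r - x 2) ^ 2 ≤ (r + R) ^ 2 := by
      apply pow_le_pow_left₀ <;> linarith
    have : slope lam r x ^ 2 = 4 * (r - x 2) ^ 2 * lam ^ 2 := by unfold slope; ring
    rw [this]; gcongr
  have hVY : 4 * (r - R) ^ 2 * lam ^ 2 * V ≤ Y := by
    rw [hV, ← integral_const_mul]
    refine integral_mono_ae (iv.const_mul _) iy ?_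
    filter_upwards [ae_mem_cube R] with x hx
    have := mul_le_mul_of_nonneg_right (slope_lower x hx) (mul_self_nonneg (v x))
    nlinarith
  have hVS : 32 * (r - R) ^ 2 * lam ^ 3 * V ≤ S := by
    have := mul_le_mul_of_nonneg_left hVY (show 0 ≤ 8 * lam by positivity)
    nlinarith
  refine ⟨hYS, hVS, ?_, ?_⟩
  -- Young's inequality is balanced so that, after multiplication by `λ`, the terms are `A` and
  -- `λ²V`, both bounded by `S`.
  · have hAv : -∫ x in cube R, symmPart lam r v v2 x * v x ≤ 1 / 2 * (1 / lam * A + lam * V) := by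
      rw [← integral_neg, hA, hV, ← integral_const_mul, ← integral_const_mul,
        ← integral_add (iA.const_mul _) (iv.const_mul _), ← integral_const_mul]
      refine integral_mono (integrable_mul_L2 mA h.memLp).neg
        (((iA.const_mul _).add (iv.const_mul _)).const_mul _) fun x => ?_
      have h1 : 0 ≤ 1 / lam * (symmPart lam r v v2 x + lam * v x) ^ 2 := by positivity
      have h2 : 1 / lam * (symmPart lam r v v2 x + lam * v x) ^ 2
          = 1 / lam * symmPart lam r v v2 x ^ 2 + 2 * (symmPart lam r v v2 x * v x)
            + lam * (v x * v x) := by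
        field_simp
        ring
      dsimp only
      linarith
    have h1 : lam * ∑ i, ∫ x in cube R, v1 i x * v1 i x
        ≤ lam * Y + 1 / 2 * (A + lam ^ 2 * V) := by
      rw [e2]
      calc lam * (Y - ∫ x in cube R, symmPart lam r v v2 x * v x)
          ≤ lam * (Y + 1 / 2 * (1 / lam * A + lam * V)) := by gcongr; linarith
        _ = _ := by field_simp
    have h2 : lam ^ 2 * V ≤ 1 / (r - R) ^ 2 * S := by
      rw [one_div, inv_mul_eq_div, le_div_iff₀ (by positivity)]
      have : lam ^ 2 * V * (r - R) ^ 2 * 1 ≤ lam ^ 2 * V * (r - R) ^ 2 * lam := by gcongr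
      have h4 : 0 ≤ (r - R) ^ 2 * lam ^ 3 * V := by positivity
      nlinarith
    have h3 : 0 ≤ 1 / (r - R) ^ 2 * S := by positivity
    linarith
  · rw [e3]
    have h1 : ∫ x in cube R, (∑ i, v2 i i x) ^ 2
        ≤ 2 * A + 2 * (4 * (r + R) ^ 2 * lam ^ 2) * Y := by
      rw [hA, hY, ← integral_const_mul, ← integral_const_mul,
        ← integral_add (iA.const_mul _) (iy.const_mul _)]
      refine integral_mono_ae h.memLp_lap.integrable_sq
        ((iA.const_mul _).add (iy.const_mul _)) ?_
      filter_upwards [ae_mem_cube R] with x hx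
      have h2 := mul_le_mul_of_nonneg_right (slope_upper x hx) (mul_self_nonneg (slope lam r x * v x))
      -- Solving for `Δv` leaves `s·(sv)` with `s² ≤ 4(r+R)²λ²`, while `∫(sv)²` gains only `1/λ`.
      -- This is why the Hessian bound carries a factor `λ`.
      have h3 : ∑ i, v2 i i x = symmPart lam r v v2 x - slope lam r x * (slope lam r x * v x) := by
        unfold symmPart; ring
      rw [h3]
      nlinarith [sq_nonneg (symmPart lam r v v2 x + slope lam r x * (slope lam r x * v x))]
    have h2 : 2 * (4 * (r + R) ^ 2 * lam ^ 2) * Y ≤ (r + R) ^ 2 * lam * S := by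
      have := mul_le_mul_of_nonneg_left hYS (show 0 ≤ (r + R) ^ 2 * lam by positivity)
      nlinarith
    have h3 : 2 * A ≤ 2 * lam * S := by nlinarith
    linarith

end Carleman

/-! ### The embedding of `H¹` of the cube into `L⁶` -/

/-- Average `|F s| ≤ |F t| + ∫|F'|` over `t`. The zero-order term replaces the compact support
usually assumed on a line. -/
theorem abs_le_integral_line {R : ℝ} (hR : 0 < R) {F F' : ℝ → ℝ} (hF : ∀ t, HasDerivAt F (F' t) t)
    (hF' : Continuous F') {s : ℝ} (hs : s ∈ Ioo (-R) R) :
    |F s| ≤ ∫ t in Ioo (-R) R, (|F t| / (2 * R) + |F' t|) := by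
  have hFc : Continuous F := continuous_iff_continuousAt.2 fun t => (hF t).continuousAt
  have hint : ∀ {g : ℝ → ℝ}, Continuous g → IntegrableOn g (Ioo (-R) R) := fun hg =>
    (hg.integrableOn_Icc).mono_set Ioo_subset_Icc_self
  set D := ∫ t in Ioo (-R) R, |F' t| with hD
  have hpt : ∀ t ∈ Ioo (-R) R, |F s| ≤ |F t| + D := by
    intro t ht
    have h1 : ∫ y in t..s, F' y = F s - F t :=
      intervalIntegral.integral_eq_sub_of_hasDerivAt (fun y _ => hF y)
        (hF'.intervalIntegrable _ _)
    have h2 : |∫ y in t..s, F' y| ≤ D := by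
      have h3 := intervalIntegral.norm_integral_le_integral_norm_uIoc (f := F') (a := t) (b := s)
        (μ := volume)
      refine h3.trans ?_
      refine setIntegral_mono_set (hint hF'.abs) (ae_of_all _ fun y => abs_nonneg _) ?_
      refine LE.le.eventuallyLE fun y hy => ?_
      rw [mem_uIoc] at hy
      rcases hy with hy | hy
      · exact ⟨ht.1.trans hy.1, hy.2.trans_lt hs.2⟩
      · exact ⟨hs.1.trans hy.1, hy.2.trans_lt ht.2⟩
    have : F s = F t + ∫ y in t..s, F' y := by rw [h1]; ring
    rw [this]
    exact (abs_add_le _ _).trans (by gcongr)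
  have hvol : volume.real (Ioo (-R) R) = 2 * R := by
    rw [Real.volume_real_Ioo_of_le (by linarith)]; ring
  have h1 : 2 * R * |F s| ≤ (∫ t in Ioo (-R) R, |F t|) + 2 * R * D := by
    have := setIntegral_mono_on (μ := volume) (s := Ioo (-R) R) (f := fun _ => |F s|)
      (g := fun t => |F t| + D) (hint continuous_const) (hint (by fun_prop)) measurableSet_Ioo hpt
    rw [integral_add (hint hFc.abs) (hint continuous_const), setIntegral_const, setIntegral_const,
      hvol, smul_eq_mul, smul_eq_mul] at this
    exact this
  rw [integral_add (hint (hFc.abs.div_const _)) (hint hF'.abs), integral_div, ← hD]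
  have h2 : (∫ t in Ioo (-R) R, |F t|) / (2 * R) + D
      = ((∫ t in Ioo (-R) R, |F t|) + 2 * R * D) / (2 * R) := by field_simp
  rw [h2, le_div_iff₀ (by positivity)]
  linarith

/-- The cube in coordinates. -/
abbrev cubePi (R : ℝ) : Measure (Fin 3 → ℝ) :=
  Measure.pi fun _ => (volume : Measure ℝ).restrict (Ioo (-R) R)

theorem lintegral_cube_eq {R : ℝ} (f : E3 → ENNReal) :
    ∫⁻ x in cube R, f x = ∫⁻ y, f (WithLp.toLp 2 y) ∂cubePi R := by
  have h := (PiLp.volume_preserving_toLp (Fin 3))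
  have he : MeasurableEmbedding (@WithLp.toLp 2 (Fin 3 → ℝ)) :=
    (MeasurableEquiv.toLp 2 (Fin 3 → ℝ)).measurableEmbedding
  rw [← h.setLIntegral_comp_preimage_emb he, cubePi, ← Measure.restrict_pi_pi, volume_pi]
  congr 2
  ext y
  simp [cube, abs_lt]

theorem hasDerivAt_update_toLp {w : E3 → ℝ} (hw : Differentiable ℝ w) (y : Fin 3 → ℝ) (i : Fin 3)
    (t : ℝ) : HasDerivAt (fun t => w (WithLp.toLp 2 (Function.update y i t)))
      (pd i w (WithLp.toLp 2 (Function.update y i t))) t := by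
  have h1 := hasDerivAt_update y i t
  have h2 : HasFDerivAt (WithLp.toLp 2 : (Fin 3 → ℝ) → E3)
      ((EuclideanSpace.equiv (Fin 3) ℝ).symm : (Fin 3 → ℝ) →L[ℝ] E3) (Function.update y i t) :=
    ((EuclideanSpace.equiv (Fin 3) ℝ).symm : (Fin 3 → ℝ) →L[ℝ] E3).hasFDerivAt
  have h3 := h2.comp_hasDerivAt t h1
  exact (hw _).hasFDerivAt.comp_hasDerivAt t h3

/-- The Gagliardo–Nirenberg inequality `W^{1,1} ⊂ L^{3/2}` in the cube. -/
theorem lintegral_rpow_three_halves_le {R : ℝ} (hR : 0 < R) {w : E3 → ℝ} (hw : ContDiff ℝ 1 w) :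
    ∫⁻ x in cube R, ‖w x‖ₑ ^ (3 / 2 : ℝ) ≤
      (∫⁻ x in cube R, ENNReal.ofReal (|w x| / (2 * R) + ∑ i, |pd i w x|)) ^ (3 / 2 : ℝ) := by
  have hpd : ∀ i, Continuous (pd i w) := fun i =>
    (hw.continuous_fderiv (by simp)).clm_apply continuous_const
  have hwc := hw.continuous
  have hwd : Differentiable ℝ w := hw.differentiable (by simp)
  set H : (Fin 3 → ℝ) → ENNReal := fun y =>
    ENNReal.ofReal (|w (WithLp.toLp 2 y)| / (2 * R) + ∑ i, |pd i w (WithLp.toLp 2 y)|) with hH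
  have hHm : Measurable H := by
    refine (ENNReal.continuous_ofReal.comp ?_).measurable
    fun_prop
  have hp : Real.HolderConjugate (Fintype.card (Fin 3)) (3 / 2 : ℝ) := by
    rw [Real.holderConjugate_iff]; norm_num
  rw [lintegral_cube_eq, lintegral_cube_eq]
  -- It suffices to bound `|w|^(3/2)` by the product, over the three axes, of square roots of line
  -- integrals. Each root dominates `|w|^(1/2)` by the one-dimensional estimate.
  refine le_trans ?_ (lintegral_prod_lintegral_pow_le
    (fun _ : Fin 3 => (volume : Measure ℝ).restrict (Ioo (-R) R)) hp hHm)
  have hae : ∀ᵐ y ∂cubePi R, ∀ i, y i ∈ Ioo (-R) R := by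
    rw [cubePi, ← Measure.restrict_pi_pi]
    filter_upwards [ae_restrict_mem (MeasurableSet.univ_pi fun _ => measurableSet_Ioo)] with y hy i
    exact hy i (mem_univ i)
  refine lintegral_mono_ae ?_
  filter_upwards [hae] with y hy
  have hi : ∀ i, ‖w (WithLp.toLp 2 y)‖ₑ ≤
      ∫⁻ t in Ioo (-R) R, H (Function.update y i t) := by
    intro i
    have h1 := abs_le_integral_line hR (hasDerivAt_update_toLp hwd y i)
      ((hpd i).comp (by fun_prop)) (hy i)
    simp only [Function.update_eq_self] at h1
    rw [Real.enorm_eq_ofReal_abs]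
    have hc : Continuous fun t => |w (WithLp.toLp 2 (Function.update y i t))| / (2 * R)
        + |pd i w (WithLp.toLp 2 (Function.update y i t))| := by
      have := hpd i
      fun_prop
    refine (ENNReal.ofReal_le_ofReal h1).trans ?_
    rw [ofReal_integral_eq_lintegral_ofReal
      ((hc.integrableOn_Icc).mono_set Ioo_subset_Icc_self) (ae_of_all _ fun t => by positivity)]
    refine lintegral_mono fun t => ENNReal.ofReal_le_ofReal ?_
    gcongr
    exact Finset.single_le_sum (f := fun j =>
      |pd j w (WithLp.toLp 2 (Function.update y i t))|) (fun j _ => abs_nonneg _)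
      (Finset.mem_univ i)
  calc ‖w (WithLp.toLp 2 y)‖ₑ ^ (3 / 2 : ℝ)
      = ∏ _i : Fin 3, ‖w (WithLp.toLp 2 y)‖ₑ ^ (1 / 2 : ℝ) := by
        rw [Finset.prod_const, Finset.card_univ, Fintype.card_fin, ← ENNReal.rpow_natCast,
          ← ENNReal.rpow_mul]
        norm_num
    _ ≤ _ := by
        have e : (1 : ℝ) / ((Fintype.card (Fin 3) : ℝ) - 1) = 1 / 2 := by norm_num
        rw [e]
        gcongr with i
        exact hi i

/-- The constant of the embedding `H¹ ⊂ L⁶`. -/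
def embConst (R : ℝ) : ENNReal := ENNReal.ofReal (4 * (1 / (2 * R)) ^ 2 + 64)

/-- Apply the `W^{1,1}` inequality to `u⁴`. With `X = ∫|u|⁶` and `Y` the `H¹`-type integral, it
reads `X ≤ (∫|u|³G)^(3/2)`, and Cauchy–Schwarz turns this into `X⁴ ≤ X³Y³`. -/
theorem lintegral_pow_six_le_of_isTest {R : ℝ} (hR : 0 < R) {u : E3 → ℝ} (hu : IsTest u) :
    ∫⁻ x in cube R, ‖u x‖ₑ ^ 6 ≤
      (embConst R * ∫⁻ x in cube R, (‖u x‖ₑ ^ 2 + ∑ i, ‖pd i u x‖ₑ ^ 2)) ^ 3 := by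
  have hpc : ∀ i, Continuous (pd i u) := fun i => (hu.pd i).1.continuous
  have huc := hu.1.continuous
  have h1 := lintegral_rpow_three_halves_le hR (w := fun x => u x ^ 4)
    ((hu.1.of_le (by simp)).pow 4)
  set G : E3 → ℝ := fun x => |u x| / (2 * R) + 4 * ∑ i, |pd i u x| with hG
  have hGc : Continuous G := by fun_prop
  have hG0 : ∀ x, 0 ≤ G x := fun x => by positivity
  have hpd4 : ∀ i x, pd i (fun x => u x ^ 4) x = 4 * u x ^ 3 * pd i u x := by
    intro i x
    unfold pd
    have := ((hu.differentiable x).hasFDerivAt.pow 4).fderiv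
    rw [this]
    simp
  set X := ∫⁻ x in cube R, ‖u x‖ₑ ^ 6 with hX
  have e1 : ∫⁻ x in cube R, ‖u x ^ 4‖ₑ ^ (3 / 2 : ℝ) = X := by
    rw [hX]; congr 1; funext x
    rw [enorm_pow, ← ENNReal.rpow_natCast, ← ENNReal.rpow_natCast, ← ENNReal.rpow_mul]
    norm_num
  have e2 : ∫⁻ x in cube R, ENNReal.ofReal (|u x ^ 4| / (2 * R) + ∑ i, |pd i (fun x => u x ^ 4) x|)
      = ∫⁻ x in cube R, ‖u x‖ₑ ^ 3 * ENNReal.ofReal (G x) := by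
    congr 1; funext x
    rw [← enorm_pow, Real.enorm_eq_ofReal_abs, ← ENNReal.ofReal_mul (abs_nonneg _)]
    congr 1
    simp only [hpd4, hG, abs_mul, abs_pow, ← Finset.mul_sum]
    norm_num
    ring
  rw [e1, e2] at h1
  have h2 := sq_lintegral_mul_le (μ := cubeMeasure R) (f := fun x => ‖u x‖ₑ ^ 3)
    (g := fun x => ENNReal.ofReal (G x)) (by fun_prop)
    (ENNReal.continuous_ofReal.comp hGc).measurable.aemeasurable
  have e3 : ∫⁻ x in cube R, (‖u x‖ₑ ^ 3) ^ 2 = X := by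
    rw [hX]; congr 1; funext x; rw [← pow_mul]
  rw [e3] at h2
  set Y := ∫⁻ x in cube R, ENNReal.ofReal (G x) ^ 2 with hY
  have h3 : X ^ 4 ≤ X ^ 3 * Y ^ 3 := by
    calc X ^ 4 = (X ^ 2) ^ 2 := by ring
      _ ≤ (((∫⁻ x in cube R, ‖u x‖ₑ ^ 3 * ENNReal.ofReal (G x)) ^ (3 / 2 : ℝ)) ^ 2) ^ 2 := by
          gcongr
      _ = ((∫⁻ x in cube R, ‖u x‖ₑ ^ 3 * ENNReal.ofReal (G x)) ^ 2) ^ 3 := by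
          rw [← ENNReal.rpow_natCast, ← ENNReal.rpow_natCast, ← ENNReal.rpow_natCast,
            ← ENNReal.rpow_natCast, ← ENNReal.rpow_mul, ← ENNReal.rpow_mul, ← ENNReal.rpow_mul]
          norm_num
      _ ≤ (X * Y) ^ 3 := by gcongr
      _ = _ := mul_pow _ _ _
  -- Cancelling `X³` needs `X` finite; this is why the estimate is first proved for test functions.
  have hXtop : X ≠ ⊤ := by
    have h4 := (hu.memLp (R := R) (p := 6)).eLpNorm_lt_top
    have h5 := eLpNorm_nnreal_pow_eq_lintegral (μ := cubeMeasure R) (f := u) (p := 6) (by norm_num)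
    have h6 : X = eLpNorm u 6 (cubeMeasure R) ^ 6 := by
      rw [hX]; simpa using h5.symm
    rw [h6]
    exact ENNReal.pow_ne_top h4.ne
  have h4 : X ≤ Y ^ 3 := by
    rcases eq_or_ne X 0 with h0 | h0
    · rw [h0]; exact zero_le
    · rw [show X ^ 4 = X ^ 3 * X by ring] at h3
      exact (ENNReal.mul_le_mul_iff_right (pow_ne_zero 3 h0) (ENNReal.pow_ne_top hXtop)).1 h3
  refine h4.trans ?_
  gcongr
  rw [hY, ← lintegral_const_mul' _ _ (by simp [embConst])]
  refine lintegral_mono fun x => ?_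
  simp only [Real.enorm_eq_ofReal_abs, embConst]
  simp only [← ENNReal.ofReal_pow (abs_nonneg _), ← ENNReal.ofReal_pow (hG0 _)]
  rw [← ENNReal.ofReal_sum_of_nonneg (fun i _ => by positivity),
    ← ENNReal.ofReal_add (by positivity) (by positivity), ← ENNReal.ofReal_mul (by positivity)]
  refine ENNReal.ofReal_le_ofReal ?_
  simp only [hG, Fin.sum_univ_three, sq_abs]
  have hc : 0 ≤ (1 / (2 * R)) ^ 2 := sq_nonneg _
  have hb : (|u x| / (2 * R)) ^ 2 = (1 / (2 * R)) ^ 2 * u x ^ 2 := by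
    rw [div_eq_mul_one_div, mul_pow, sq_abs]; ring
  have hall : (|u x| / (2 * R) + 4 * (|pd 0 u x| + |pd 1 u x| + |pd 2 u x|)) ^ 2
      ≤ 4 * ((|u x| / (2 * R)) ^ 2 + 16 * (pd 0 u x ^ 2 + pd 1 u x ^ 2 + pd 2 u x ^ 2)) := by
    rw [← sq_abs (pd 0 u x), ← sq_abs (pd 1 u x), ← sq_abs (pd 2 u x)]
    set a := |u x| / (2 * R)
    set b := |pd 0 u x|
    set c := |pd 1 u x|
    set d := |pd 2 u x|
    nlinarith [sq_nonneg (a - 4 * b), sq_nonneg (a - 4 * c), sq_nonneg (a - 4 * d),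
      sq_nonneg (b - c), sq_nonneg (b - d), sq_nonneg (c - d)]
  refine hall.trans ?_
  rw [hb]
  have p1 : 0 ≤ (1 / (2 * R)) ^ 2 * (pd 0 u x ^ 2 + pd 1 u x ^ 2 + pd 2 u x ^ 2) := by positivity
  have p2 : 0 ≤ u x ^ 2 := sq_nonneg _
  nlinarith

/-! ### Passing from test functions to weakly differentiable functions. -/

/-- A subsequence of the smoothings converges almost everywhere. -/
theorem exists_subseq_smoothing {R : ℝ} (hR : 0 < R) {g : E3 → ℝ}
    (hg : MemLp g 2 (cubeMeasure R)) :
    ∃ ns : ℕ → ℕ, StrictMono ns ∧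
      ∀ᵐ x ∂cubeMeasure R, Tendsto (fun n => smoothing hR (ns n) g x) atTop (𝓝 (g x)) :=
  (tendstoInMeasure_of_tendsto_eLpNorm (by simp)
    (fun n => (isTest_smoothing hR n hg).1.continuous.aestronglyMeasurable) hg.1
    (tendsto_smoothing hR hg)).exists_seq_tendsto_ae

theorem lintegral_smoothing_sq_le {R : ℝ} (hR : 0 < R) (n : ℕ) {g : E3 → ℝ}
    (hg : MemLp g 2 (cubeMeasure R)) :
    ∫⁻ x in cube R, ‖smoothing hR n g x‖ₑ ^ 2 ≤ 9 * ∫⁻ x in cube R, ‖g x‖ₑ ^ 2 := by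
  rw [← eLpNorm_two_sq, ← eLpNorm_two_sq]
  calc _ ≤ (3 * eLpNorm g 2 (cubeMeasure R)) ^ 2 := by
        gcongr; exact eLpNorm_smoothing_le hR n hg
    _ = _ := by rw [mul_pow]; norm_num

theorem lintegral_pd_smoothing_sq_le {R : ℝ} (hR : 0 < R) (n : ℕ) {i : Fin 3} {g g' : E3 → ℝ}
    (hg : MemLp g 2 (cubeMeasure R)) (hg' : MemLp g' 2 (cubeMeasure R)) (h : WeakPD R i g g') :
    ∫⁻ x in cube R, ‖pd i (smoothing hR n g) x‖ₑ ^ 2 ≤ 9 * ∫⁻ x in cube R, ‖g' x‖ₑ ^ 2 := by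
  refine le_trans (lintegral_mono_ae ?_) (lintegral_smoothing_sq_le hR n hg')
  filter_upwards [ae_mem_cube R] with x hx
  rw [pd_smoothing hR n hg hg' h hx, enorm_mul, Real.enorm_of_nonneg (contr_pos n).le]
  gcongr
  exact mul_le_of_le_one_left' (by simpa using contr_le_one n)

/-- Fatou's lemma along an almost everywhere convergent subsequence of smoothings. The factors `9 =
3²` come from the `L²` bound of the smoothing operator. -/
theorem lintegral_pow_six_le {R : ℝ} (hR : 0 < R) {u : E3 → ℝ} {u1 : Fin 3 → E3 → ℝ}
    (hu : MemLp u 2 (cubeMeasure R)) (hu1 : ∀ i, MemLp (u1 i) 2 (cubeMeasure R))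
    (h : ∀ i, WeakPD R i u (u1 i)) :
    ∫⁻ x in cube R, ‖u x‖ₑ ^ 6 ≤ (embConst R *
      (9 * (∫⁻ x in cube R, ‖u x‖ₑ ^ 2) + ∑ i, 9 * ∫⁻ x in cube R, ‖u1 i x‖ₑ ^ 2)) ^ 3 := by
  obtain ⟨ns, -, hns⟩ := exists_subseq_smoothing hR hu
  have ht : ∀ n, IsTest (smoothing hR n u) := fun n => isTest_smoothing hR n hu
  have hb : ∀ n, ∫⁻ x in cube R, ‖smoothing hR (ns n) u x‖ₑ ^ 6 ≤ (embConst R *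
      (9 * (∫⁻ x in cube R, ‖u x‖ₑ ^ 2) + ∑ i, 9 * ∫⁻ x in cube R, ‖u1 i x‖ₑ ^ 2)) ^ 3 := by
    intro n
    refine (lintegral_pow_six_le_of_isTest hR (ht _)).trans ?_
    have hm : ∀ i, Measurable fun x => ‖pd i (smoothing hR (ns n) u) x‖ₑ ^ 2 := fun i =>
      ((ht (ns n)).pd i).1.continuous.enorm.measurable.pow_const 2
    rw [lintegral_add_right _ (Finset.measurable_fun_sum _ fun i _ => hm i),
      lintegral_finsetSum _ fun i _ => hm i]
    gcongr with i
    · exact lintegral_smoothing_sq_le hR _ hu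
    · exact lintegral_pd_smoothing_sq_le hR _ hu (hu1 i) (h i)
  calc ∫⁻ x in cube R, ‖u x‖ₑ ^ 6
      ≤ ∫⁻ x in cube R, liminf (fun n => ‖smoothing hR (ns n) u x‖ₑ ^ 6) atTop := by
        refine lintegral_mono_ae ?_
        filter_upwards [hns] with x hx
        refine le_of_eq (Tendsto.liminf_eq ?_).symm
        exact ((ENNReal.continuous_pow 6).tendsto _).comp (continuous_enorm.tendsto _ |>.comp hx)
    _ ≤ liminf (fun n => ∫⁻ x in cube R, ‖smoothing hR (ns n) u x‖ₑ ^ 6) atTop :=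
        lintegral_liminf_le fun n => (ht (ns n)).1.continuous.enorm.measurable.pow_const 6
    _ ≤ _ := liminf_le_of_le (by isBoundedDefault) fun b hb' => by
        obtain ⟨n, hn⟩ := hb'.exists
        exact hn.trans (hb n)

/-! ### The embedding of `H²` of the cube into `L^∞` -/

theorem hasDerivAt_along {w : E3 → ℝ} (hw : Differentiable ℝ w) (x y : E3) (t : ℝ) :
    HasDerivAt (fun t : ℝ => w (x + t • (y - x))) (∑ i, (y i - x i) * pd i w (x + t • (y - x)))
      t := by
  have h1 : HasDerivAt (fun t : ℝ => x + t • (y - x)) (y - x) t := by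
    simpa using ((hasDerivAt_id t).smul_const (y - x)).const_add x
  have h2 := (hw (x + t • (y - x))).hasFDerivAt.comp_hasDerivAt t h1
  have h3 : y - x = ∑ i, (y i - x i) • EuclideanSpace.single i (1 : ℝ) := by
    ext j
    simp [Finset.sum_apply, Pi.single_apply]
  have h4 : fderiv ℝ w (x + t • (y - x)) (y - x)
      = ∑ i, (y i - x i) * pd i w (x + t • (y - x)) := by
    rw [show fderiv ℝ w (x + t • (y - x)) (y - x) = _ from congrArg _ h3, map_sum]
    simp [pd]
  rw [← h4]
  exact h2

/-- The expansion is centred at `y`, the variable to be averaged, by integrating `(t p' - p)' = t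
p''`. The point of this form is the weight `t`, which vanishes where the contraction towards `x`
degenerates. -/
theorem taylor_along {u : E3 → ℝ} (hu : ContDiff ℝ ∞ u) (x y : E3) :
    u x = u y - (∑ i, (y i - x i) * pd i u y) + ∫ t in (0 : ℝ)..1,
      t * ∑ i, ∑ j, (y i - x i) * (y j - x j) * pd j (pd i u) (x + t • (y - x)) := by
  have hd : ∀ {w : E3 → ℝ}, ContDiff ℝ ∞ w → Differentiable ℝ w :=
    fun h => h.differentiable (by simp)
  set p : ℝ → ℝ := fun t => u (x + t • (y - x))
  set p1 : ℝ → ℝ := fun t => ∑ i, (y i - x i) * pd i u (x + t • (y - x))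
  set p2 : ℝ → ℝ := fun t => ∑ i, ∑ j, (y i - x i) * (y j - x j) *
    pd j (pd i u) (x + t • (y - x)) with hp2
  have d0 : ∀ t, HasDerivAt p (p1 t) t := fun t => hasDerivAt_along (hd hu) x y t
  have d1 : ∀ t, HasDerivAt p1 (p2 t) t := by
    intro t
    have := HasDerivAt.fun_sum (u := Finset.univ) fun i _ =>
      (hasDerivAt_along (hd (contDiff_pd hu i)) x y t).const_mul (y i - x i)
    have e : p2 t = ∑ i, (y i - x i) * ∑ j, (y j - x j) * pd j (pd i u) (x + t • (y - x)) := by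
      simp only [hp2, Finset.mul_sum, mul_assoc]
    rw [e]
    exact this
  have dq : ∀ t, HasDerivAt (fun t => t * p1 t - p t) (t * p2 t) t := by
    intro t
    have := ((hasDerivAt_id t).mul (d1 t)).sub (d0 t)
    have e : t * p2 t = 1 * p1 t + id t * p2 t - p1 t := by simp
    rw [e]
    exact this
  have hc : Continuous fun t => t * p2 t := by
    refine continuous_id.mul (continuous_finsetSum _ fun i _ => continuous_finsetSum _ fun j _ => ?_)
    have := (contDiff_pd (contDiff_pd hu i) j).continuous
    fun_prop
  have h := intervalIntegral.integral_eq_sub_of_hasDerivAt (fun t _ => dq t)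
    (hc.intervalIntegrable 0 1)
  have e0 : p 0 = u x := by simp [p]
  have e1 : p 1 = u y := by simp [p]
  have e2 : p1 1 = ∑ i, (y i - x i) * pd i u y := by simp [p1]
  rw [h, e0, e1, e2]
  ring

theorem abs_sub_le_of_mem_cube {R : ℝ} {x y : E3} (hx : x ∈ cube R) (hy : y ∈ cube R) (i : Fin 3) :
    |y i - x i| ≤ 2 * R :=
  (abs_sub _ _).trans (by linarith [hx i, hy i])

theorem enorm_le_taylor {R : ℝ} {u : E3 → ℝ} (hu : ContDiff ℝ ∞ u) {x y : E3} (hx : x ∈ cube R)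
    (hy : y ∈ cube R) :
    ‖u x‖ₑ ≤ ‖u y‖ₑ + (∑ i, ENNReal.ofReal (2 * R) * ‖pd i u y‖ₑ)
      + ∑ i, ∑ j, ENNReal.ofReal (4 * R ^ 2) * ∫⁻ t in Ioo (0 : ℝ) 1,
        ENNReal.ofReal t * ‖pd j (pd i u) (x + t • (y - x))‖ₑ := by
  have hR : 0 ≤ R := (abs_nonneg _).trans (hx 0).le
  have hm : ∀ i j, Measurable fun t : ℝ =>
      ENNReal.ofReal t * ‖pd j (pd i u) (x + t • (y - x))‖ₑ := fun i j => by
    have := (contDiff_pd (contDiff_pd hu i) j).continuous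
    exact Measurable.mul (f := fun t => ENNReal.ofReal t) (by fun_prop)
      (Continuous.measurable (by fun_prop))
  have he : ∀ i, ‖y i - x i‖ₑ ≤ ENNReal.ofReal (2 * R) := fun i => by
    rw [Real.enorm_eq_ofReal_abs]
    exact ENNReal.ofReal_le_ofReal (abs_sub_le_of_mem_cube hx hy i)
  rw [taylor_along hu x y]
  refine (enorm_add_le _ _).trans (add_le_add ((enorm_sub_le).trans (add_le_add le_rfl ?_)) ?_)
  · refine (enorm_sum_le _ _).trans (Finset.sum_le_sum fun i _ => ?_)
    rw [enorm_mul]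
    gcongr
    exact he i
  · rw [intervalIntegral.integral_of_le zero_le_one, integral_Ioc_eq_integral_Ioo]
    refine (enorm_integral_le_lintegral_enorm _).trans ?_
    simp only [← lintegral_const_mul' _ _ ENNReal.ofReal_ne_top]
    rw [Finset.sum_congr rfl fun i _ => (lintegral_finsetSum Finset.univ fun j _ =>
      (hm i j).const_mul _).symm, ← lintegral_finsetSum Finset.univ fun i _ =>
      Finset.measurable_fun_sum _ fun j _ => (hm i j).const_mul _]
    refine setLIntegral_mono' measurableSet_Ioo fun t ht => ?_
    rw [enorm_mul, Real.enorm_of_nonneg ht.1.le]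
    refine (mul_le_mul_right (enorm_sum_le _ _) _).trans ?_
    rw [Finset.mul_sum]
    refine Finset.sum_le_sum fun i _ => ?_
    refine (mul_le_mul_right (enorm_sum_le _ _) _).trans ?_
    rw [Finset.mul_sum]
    refine Finset.sum_le_sum fun j _ => ?_
    rw [enorm_mul, enorm_mul]
    calc ENNReal.ofReal t * (‖y i - x i‖ₑ * ‖y j - x j‖ₑ * ‖pd j (pd i u) (x + t • (y - x))‖ₑ)
        ≤ ENNReal.ofReal t * (ENNReal.ofReal (2 * R) * ENNReal.ofReal (2 * R)
          * ‖pd j (pd i u) (x + t • (y - x))‖ₑ) := by gcongr <;> exact he _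
      _ = _ := by
        rw [← ENNReal.ofReal_mul (by positivity), show 2 * R * (2 * R) = 4 * R ^ 2 by ring]
        ring

theorem lintegral_comp_contract_le {R : ℝ} {G : E3 → ENNReal} (hG : Measurable G) {x : E3}
    (hx : x ∈ cube R) {t : ℝ} (ht : t ∈ Ioo (0 : ℝ) 1) :
    ∫⁻ y in cube R, G (x + t • (y - x)) ≤ ENNReal.ofReal ((t ^ 3)⁻¹) * ∫⁻ y in cube R, G y := by
  have hGi : Measurable ((cube R).indicator G) := hG.indicator (measurableSet_cube R)
  have hmem : ∀ y ∈ cube R, x + t • (y - x) ∈ cube R := by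
    intro y hy i
    have h1 : (x + t • (y - x)) i = (1 - t) * x i + t * y i := by
      simp only [PiLp.add_apply, PiLp.smul_apply, PiLp.sub_apply, smul_eq_mul]; ring
    rw [h1]
    calc |(1 - t) * x i + t * y i| ≤ (1 - t) * |x i| + t * |y i| := by
          refine (abs_add_le _ _).trans (le_of_eq ?_)
          rw [abs_mul, abs_mul, abs_of_pos ht.1, abs_of_pos (sub_pos.2 ht.2)]
      _ < (1 - t) * R + t * R :=
          add_lt_add (mul_lt_mul_of_pos_left (hx i) (sub_pos.2 ht.2))
            (mul_lt_mul_of_pos_left (hy i) ht.1)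
      _ = R := by ring
  calc ∫⁻ y in cube R, G (x + t • (y - x))
      = ∫⁻ y in cube R, (cube R).indicator G (x + t • (y - x)) :=
        setLIntegral_congr_fun (measurableSet_cube R) fun y hy => by
          simp only [indicator_of_mem (hmem y hy)]
    _ ≤ ∫⁻ y, (cube R).indicator G (x + t • (y - x)) := setLIntegral_le_lintegral _ _
    _ = ∫⁻ y, (cube R).indicator G (x + t • y) :=
        lintegral_sub_right_eq_self (fun y => (cube R).indicator G (x + t • y)) x
    _ = ∫⁻ y, (cube R).indicator G (x + y) ∂(Measure.map (t • ·) volume) := by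
        rw [lintegral_map (f := fun y => (cube R).indicator G (x + y)) (hGi.comp (by fun_prop))
          (by fun_prop)]
    _ = ENNReal.ofReal ((t ^ 3)⁻¹) * ∫⁻ y, (cube R).indicator G (x + y) := by
        rw [Measure.map_addHaar_smul _ ht.1.ne', lintegral_smul_measure, smul_eq_mul]
        simp only [finrank_euclideanSpace, Fintype.card_fin]
        rw [abs_of_pos (by have := ht.1; positivity)]
    _ = _ := by rw [lintegral_add_left_eq_self, lintegral_indicator (measurableSet_cube R)]

theorem lintegral_enorm_le_eLpNorm {R : ℝ} {g : E3 → ℝ} (hg : AEMeasurable g (cubeMeasure R)) :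
    ∫⁻ x in cube R, ‖g x‖ₑ ≤ volume (cube R) ^ (1 / 2 : ℝ) * eLpNorm g 2 (cubeMeasure R) := by
  have h := sq_lintegral_mul_le (μ := cubeMeasure R) (f := fun _ => 1) (g := fun x => ‖g x‖ₑ)
    aemeasurable_const hg.enorm
  rw [← eLpNorm_two_sq] at h
  simp only [one_mul, one_pow, lintegral_const, Measure.restrict_apply_univ] at h
  refine (ENNReal.pow_le_pow_left_iff two_ne_zero).1 (h.trans (le_of_eq ?_))
  rw [mul_pow, ← ENNReal.rpow_natCast (_ ^ _), ← ENNReal.rpow_mul]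
  norm_num

/-- Cauchy–Schwarz on the cube turns the Jacobian `t⁻³` of the contraction towards `x` into
`t^(-3/2)`. Together with the Taylor weight `t` this is `t^(-1/2)`, integrable at `0`. -/
theorem lintegral_enorm_comp_contract_le {R : ℝ} {g : E3 → ℝ} (hg : Continuous g) {x : E3}
    (hx : x ∈ cube R) {t : ℝ} (ht : t ∈ Ioo (0 : ℝ) 1) :
    ∫⁻ y in cube R, ‖g (x + t • (y - x))‖ₑ ≤
      ENNReal.ofReal (t ^ (-3 / 2 : ℝ)) *
        (volume (cube R) ^ (1 / 2 : ℝ) * eLpNorm g 2 (cubeMeasure R)) := by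
  have hc : Continuous fun y => g (x + t • (y - x)) := by fun_prop
  refine (lintegral_enorm_le_eLpNorm hc.measurable.aemeasurable).trans ?_
  rw [mul_left_comm]
  gcongr
  refine (ENNReal.pow_le_pow_left_iff two_ne_zero).1 ?_
  rw [mul_pow, eLpNorm_two_sq, eLpNorm_two_sq,
    ← ENNReal.ofReal_pow (Real.rpow_nonneg ht.1.le _), ← Real.rpow_natCast, ← Real.rpow_mul ht.1.le,
    show (-3 / 2 : ℝ) * (2 : ℕ) = -(3 : ℕ) by norm_num, Real.rpow_neg ht.1.le, Real.rpow_natCast]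
  exact lintegral_comp_contract_le (G := fun y => ‖g y‖ₑ ^ 2)
    (hg.enorm.measurable.pow_const 2) hx ht

theorem lintegral_weight_lt_top :
    ∫⁻ t in Ioo (0 : ℝ) 1, ENNReal.ofReal t * ENNReal.ofReal (t ^ (-3 / 2 : ℝ)) < ⊤ := by
  have h : IntegrableOn (fun t : ℝ => t ^ (-1 / 2 : ℝ)) (Ioo 0 1) :=
    (intervalIntegral.integrableOn_Ioo_rpow_iff one_pos).2 (by norm_num)
  have h2 := h.lintegral_lt_top
  refine lt_of_le_of_lt (le_of_eq ?_) h2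
  refine setLIntegral_congr_fun measurableSet_Ioo fun t ht => ?_
  rw [← ENNReal.ofReal_mul ht.1.le]
  congr 1
  nth_rewrite 1 [← Real.rpow_one t]
  rw [← Real.rpow_add ht.1]
  norm_num

/-- The sum of the `L²` norms of a function and its derivatives of order at most two. -/
def normTwo (R : ℝ) (u : E3 → ℝ) (u1 : Fin 3 → E3 → ℝ) (u2 : Fin 3 → Fin 3 → E3 → ℝ) : ENNReal :=
  eLpNorm u 2 (cubeMeasure R) + (∑ i, eLpNorm (u1 i) 2 (cubeMeasure R))
    + ∑ i, ∑ j, eLpNorm (u2 i j) 2 (cubeMeasure R)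

/-- Average the Taylor formula over `y` in the cube. Terms evaluated at `y` are bounded by
Cauchy–Schwarz, the second-order term by the contraction estimate. -/
theorem exists_enorm_le_normTwo {R : ℝ} (hR : 0 < R) : ∃ C : ENNReal, C ≠ ⊤ ∧ ∀ u : E3 → ℝ,
    IsTest u → ∀ x ∈ cube R,
      ‖u x‖ₑ ≤ C * normTwo R u (fun i => pd i u) (fun i j => pd j (pd i u)) := by
  set W := volume (cube R) ^ (1 / 2 : ℝ) with hW
  set K := ∫⁻ t in Ioo (0 : ℝ) 1, ENNReal.ofReal t * ENNReal.ofReal (t ^ (-3 / 2 : ℝ)) with hK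
  set D : ENNReal := 1 + ENNReal.ofReal (2 * R) + ENNReal.ofReal (4 * R ^ 2) * K with hD
  have hV0 : volume (cube R) ≠ 0 := by
    refine ((isOpen_cube R).measure_pos volume ⟨0, fun i => ?_⟩).ne'
    simpa using hR
  have hVt : volume (cube R) ≠ ⊤ := (volume_cube_lt_top R).ne
  have hWt : W ≠ ⊤ := (ENNReal.rpow_lt_top_of_nonneg (by norm_num) hVt).ne
  have hDt : D ≠ ⊤ := by
    have := lintegral_weight_lt_top.ne
    simp only [hD, ENNReal.add_ne_top]
    exact ⟨⟨ENNReal.one_ne_top, ENNReal.ofReal_ne_top⟩, ENNReal.mul_ne_top ENNReal.ofReal_ne_top this⟩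
  refine ⟨(volume (cube R))⁻¹ * (W * D),
    ENNReal.mul_ne_top (ENNReal.inv_ne_top.2 hV0) (ENNReal.mul_ne_top hWt hDt), fun u hu x hx => ?_⟩
  have c0 := hu.1.continuous
  have c1 : ∀ i, Continuous (pd i u) := fun i => (hu.pd i).1.continuous
  have c2 : ∀ i j, Continuous (pd j (pd i u)) := fun i j => ((hu.pd i).pd j).1.continuous
  have m2 : ∀ i j, Measurable fun p : E3 × ℝ =>
      ENNReal.ofReal p.2 * ‖pd j (pd i u) (x + p.2 • (p.1 - x))‖ₑ := fun i j => by
    have := c2 i j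
    exact Measurable.mul (f := fun p : E3 × ℝ => ENNReal.ofReal p.2) (by fun_prop)
      (Continuous.measurable (by fun_prop))
  have hsecond : ∀ i j, ∫⁻ y in cube R, ∫⁻ t in Ioo (0 : ℝ) 1,
      ENNReal.ofReal t * ‖pd j (pd i u) (x + t • (y - x))‖ₑ
        ≤ K * (W * eLpNorm (pd j (pd i u)) 2 (cubeMeasure R)) := by
    intro i j
    rw [lintegral_lintegral_swap (m2 i j).aemeasurable, hK,
      ← lintegral_mul_const _ (by fun_prop)]
    refine setLIntegral_mono' measurableSet_Ioo fun t ht => ?_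
    rw [lintegral_const_mul' _ _ ENNReal.ofReal_ne_top, mul_assoc]
    gcongr
    exact lintegral_enorm_comp_contract_le (c2 i j) hx ht
  have hmain : volume (cube R) * ‖u x‖ₑ
      ≤ W * eLpNorm u 2 (cubeMeasure R)
        + (∑ i, ENNReal.ofReal (2 * R) * (W * eLpNorm (pd i u) 2 (cubeMeasure R)))
        + ∑ i, ∑ j, ENNReal.ofReal (4 * R ^ 2)
          * (K * (W * eLpNorm (pd j (pd i u)) 2 (cubeMeasure R))) := by
    have h1 : ∫⁻ _ in cube R, ‖u x‖ₑ ≤ ∫⁻ y in cube R, (‖u y‖ₑ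
        + (∑ i, ENNReal.ofReal (2 * R) * ‖pd i u y‖ₑ)
        + ∑ i, ∑ j, ENNReal.ofReal (4 * R ^ 2) * ∫⁻ t in Ioo (0 : ℝ) 1,
          ENNReal.ofReal t * ‖pd j (pd i u) (x + t • (y - x))‖ₑ) :=
      setLIntegral_mono' (measurableSet_cube R) fun y hy => enorm_le_taylor hu.1 hx hy
    rw [lintegral_const, Measure.restrict_apply_univ, mul_comm] at h1
    have ma : ∀ i, Measurable fun y => ENNReal.ofReal (2 * R) * ‖pd i u y‖ₑ := fun i =>
      ((c1 i).enorm.measurable).const_mul _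
    have mb : ∀ i j, Measurable fun y => ENNReal.ofReal (4 * R ^ 2) * ∫⁻ t in Ioo (0 : ℝ) 1,
          ENNReal.ofReal t * ‖pd j (pd i u) (x + t • (y - x))‖ₑ := fun i j =>
      ((m2 i j).lintegral_prod_right').const_mul _
    rw [lintegral_add_right _ (Finset.measurable_fun_sum _ fun i _ =>
        Finset.measurable_fun_sum _ fun j _ => mb i j),
      lintegral_add_left c0.enorm.measurable,
      lintegral_finsetSum _ fun i _ => ma i,
      lintegral_finsetSum _ fun i _ => Finset.measurable_fun_sum _ fun j _ => mb i j] at h1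
    refine h1.trans ?_
    gcongr with i _ i _
    · exact lintegral_enorm_le_eLpNorm c0.measurable.aemeasurable
    · rw [lintegral_const_mul' _ _ ENNReal.ofReal_ne_top]
      gcongr
      exact lintegral_enorm_le_eLpNorm (c1 i).measurable.aemeasurable
    · rw [lintegral_finsetSum _ fun j _ => mb i j]
      gcongr with j
      rw [lintegral_const_mul' _ _ ENNReal.ofReal_ne_top]
      gcongr
      exact hsecond i j
  have hbig : volume (cube R) * ‖u x‖ₑ
      ≤ W * D * normTwo R u (fun i => pd i u) (fun i j => pd j (pd i u)) := by
    refine hmain.trans ?_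
    have hD1 : 1 ≤ D := by rw [hD, add_assoc]; exact le_self_add
    have hD2 : ENNReal.ofReal (2 * R) ≤ D := by
      rw [hD, add_assoc]; exact le_add_left le_self_add
    have hD3 : ENNReal.ofReal (4 * R ^ 2) * K ≤ D := by rw [hD]; exact le_add_self
    rw [normTwo, mul_add, mul_add, Finset.mul_sum, Finset.mul_sum]
    simp only [Finset.mul_sum]
    refine add_le_add (add_le_add ?_ (Finset.sum_le_sum fun i _ => ?_))
      (Finset.sum_le_sum fun i _ => Finset.sum_le_sum fun j _ => ?_)
    · rw [mul_assoc]
      gcongr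
      exact le_mul_of_one_le_left' hD1
    · rw [mul_left_comm, mul_assoc]
      gcongr
    · rw [mul_assoc W D, ← mul_assoc, mul_left_comm]
      gcongr
  calc ‖u x‖ₑ = (volume (cube R))⁻¹ * (volume (cube R) * ‖u x‖ₑ) := by
        rw [← mul_assoc, ENNReal.inv_mul_cancel hV0 hVt, one_mul]
    _ ≤ (volume (cube R))⁻¹ *
        (W * D * normTwo R u (fun i => pd i u) (fun i j => pd j (pd i u))) := by gcongr
    _ = _ := by ring

theorem pd_congr_cube {R : ℝ} {f g : E3 → ℝ} (h : EqOn f g (cube R)) (i : Fin 3) {x : E3}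
    (hx : x ∈ cube R) : pd i f x = pd i g x := by
  unfold pd
  rw [(h.eventuallyEq_of_mem ((isOpen_cube R).mem_nhds hx)).fderiv_eq]

theorem exists_ae_enorm_le_normTwo {R : ℝ} (hR : 0 < R) : ∃ C : ENNReal, C ≠ ⊤ ∧
    ∀ (u : E3 → ℝ) (u1 : Fin 3 → E3 → ℝ) (u2 : Fin 3 → Fin 3 → E3 → ℝ),
      MemLp u 2 (cubeMeasure R) → (∀ i, MemLp (u1 i) 2 (cubeMeasure R)) →
      (∀ i j, MemLp (u2 i j) 2 (cubeMeasure R)) → (∀ i, WeakPD R i u (u1 i)) →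
      (∀ i j, WeakPD R j (u1 i) (u2 i j)) →
      ∀ᵐ x ∂cubeMeasure R, ‖u x‖ₑ ≤ C * normTwo R u u1 u2 := by
  obtain ⟨C, hC, h⟩ := exists_enorm_le_normTwo hR
  refine ⟨C * 3, ENNReal.mul_ne_top hC (by simp), fun u u1 u2 m m1 m2 w1 w2 => ?_⟩
  obtain ⟨ns, -, hns⟩ := exists_subseq_smoothing hR m
  have hcle : ∀ n, ‖contr n‖ₑ ≤ 1 := fun n => by
    rw [Real.enorm_of_nonneg (contr_pos n).le]
    simpa using contr_le_one n
  have b1 : ∀ n i, eLpNorm (pd i (smoothing hR n u)) 2 (cubeMeasure R)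
      ≤ 3 * eLpNorm (u1 i) 2 (cubeMeasure R) := by
    intro n i
    refine le_trans (eLpNorm_mono_enorm_ae ?_) (eLpNorm_smoothing_le hR n (m1 i))
    filter_upwards [ae_mem_cube R] with x hx
    rw [pd_smoothing hR n m (m1 i) (w1 i) hx, enorm_mul]
    exact mul_le_of_le_one_left' (hcle n)
  have b2 : ∀ n i j, eLpNorm (pd j (pd i (smoothing hR n u))) 2 (cubeMeasure R)
      ≤ 3 * eLpNorm (u2 i j) 2 (cubeMeasure R) := by
    intro n i j
    refine le_trans (eLpNorm_mono_enorm_ae ?_) (eLpNorm_smoothing_le hR n (m2 i j))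
    filter_upwards [ae_mem_cube R] with x hx
    have h1 : EqOn (pd i (smoothing hR n u)) (fun y => contr n * smoothing hR n (u1 i) y)
        (cube R) := fun y hy => pd_smoothing hR n m (m1 i) (w1 i) hy
    have h2 : pd j (fun y => contr n * smoothing hR n (u1 i) y) x
        = contr n * pd j (smoothing hR n (u1 i)) x := by
      unfold pd
      rw [fderiv_const_mul ((isTest_smoothing hR n (m1 i)).differentiable x)]
      simp
    rw [pd_congr_cube h1 j hx, h2, pd_smoothing hR n (m1 i) (m2 i j) (w2 i j) hx, enorm_mul,
      enorm_mul]
    exact (mul_le_of_le_one_left' (hcle n)).trans (mul_le_of_le_one_left' (hcle n))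
  filter_upwards [hns, ae_mem_cube R] with x hx hxc
  refine le_of_tendsto ((continuous_enorm.tendsto _).comp hx) (Eventually.of_forall fun n => ?_)
  refine (h _ (isTest_smoothing hR (ns n) m) x hxc).trans ?_
  rw [mul_assoc]
  gcongr
  unfold normTwo
  rw [mul_add, mul_add, Finset.mul_sum, Finset.mul_sum]
  simp only [Finset.mul_sum]
  gcongr with i _ i _ j
  · exact eLpNorm_smoothing_le hR _ m
  · exact b1 _ i
  · exact b2 _ i j

/-! ### A trilinear estimate -/

/-- The square of the `H¹` norm of a function `u` with gradient `u1`. -/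
def normOneSq (R : ℝ) (u : E3 → ℝ) (u1 : Fin 3 → E3 → ℝ) : ℝ :=
  (∫ x in cube R, u x * u x) + ∑ i, ∫ x in cube R, u1 i x * u1 i x

theorem normOneSq_nonneg (R : ℝ) (u : E3 → ℝ) (u1 : Fin 3 → E3 → ℝ) : 0 ≤ normOneSq R u u1 :=
  add_nonneg (integral_nonneg fun _ => mul_self_nonneg _)
    (Finset.sum_nonneg fun _ _ => integral_nonneg fun _ => mul_self_nonneg _)

theorem ofReal_integral_mul_self {R : ℝ} {f : E3 → ℝ} (hf : MemLp f 2 (cubeMeasure R)) :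
    ENNReal.ofReal (∫ x in cube R, f x * f x) = ∫⁻ x in cube R, ‖f x‖ₑ ^ 2 := by
  rw [ofReal_integral_eq_lintegral_ofReal (integrable_mul_L2 hf hf)
    (ae_of_all _ fun x => mul_self_nonneg _)]
  congr 1
  funext x
  rw [Real.enorm_eq_ofReal_abs, ← ENNReal.ofReal_pow (abs_nonneg _), sq_abs, sq]

theorem lintegral_pow_six_le_normOneSq {R : ℝ} (hR : 0 < R) {u : E3 → ℝ} {u1 : Fin 3 → E3 → ℝ}
    (hu : MemLp u 2 (cubeMeasure R)) (hu1 : ∀ i, MemLp (u1 i) 2 (cubeMeasure R))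
    (h : ∀ i, WeakPD R i u (u1 i)) :
    ∫⁻ x in cube R, ‖u x‖ₑ ^ 6 ≤
      (embConst R * 9 * ENNReal.ofReal (normOneSq R u u1)) ^ 3 := by
  refine (lintegral_pow_six_le hR hu hu1 h).trans (le_of_eq ?_)
  rw [normOneSq, ENNReal.ofReal_add (integral_nonneg fun _ => mul_self_nonneg _)
    (Finset.sum_nonneg fun _ _ => integral_nonneg fun _ => mul_self_nonneg _),
    ENNReal.ofReal_sum_of_nonneg fun _ _ => integral_nonneg fun _ => mul_self_nonneg _,
    ofReal_integral_mul_self hu]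
  simp only [ofReal_integral_mul_self (hu1 _)]
  rw [← Finset.mul_sum, ← mul_add, mul_assoc]

/-- Split `g²u²` as `(g²u)·u` by Cauchy–Schwarz, then apply Hölder with exponents `3/2` and `3` to
`g⁴·u²`, so that only sixth powers remain. One factor of `u` stays in `L²`; this is what later
allows the powers of `λ` to cancel. -/
theorem lintegral_sq_mul_sq_le {α : Type*} [MeasurableSpace α] {μ : Measure α} {g u : α → ENNReal}
    (hg : AEMeasurable g μ) (hu : AEMeasurable u μ) {a b : ENNReal}
    (ha : ∫⁻ x, g x ^ 6 ∂μ ≤ a ^ 3) (hb : ∫⁻ x, u x ^ 6 ∂μ ≤ b ^ 3) :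
    (∫⁻ x, g x ^ 2 * u x ^ 2 ∂μ) ^ 2 ≤ a ^ 2 * b * ∫⁻ x, u x ^ 2 ∂μ := by
  have h1 := sq_lintegral_mul_le (f := fun x => g x ^ 2 * u x) ((hg.pow_const 2).mul hu) hu
  have h2 : ∫⁻ x, (g x ^ 2 * u x) ^ 2 ∂μ ≤ a ^ 2 * b := by
    have hpq : Real.HolderConjugate (3 / 2 : ℝ) 3 := by
      rw [Real.holderConjugate_iff]; norm_num
    have h3 := ENNReal.lintegral_mul_le_Lp_mul_Lq μ hpq (hg.pow_const 4) (hu.pow_const 2)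
    have e1 : ∀ x, (g x ^ 4) ^ (3 / 2 : ℝ) = g x ^ 6 := fun x => by
      rw [← ENNReal.rpow_natCast, ← ENNReal.rpow_natCast, ← ENNReal.rpow_mul]; norm_num
    have e2 : ∀ x, (u x ^ 2) ^ (3 : ℝ) = u x ^ 6 := fun x => by
      rw [← ENNReal.rpow_natCast, ← ENNReal.rpow_natCast, ← ENNReal.rpow_mul]; norm_num
    simp only [e1, e2] at h3
    have e3 : ∫⁻ x, (g x ^ 2 * u x) ^ 2 ∂μ
        = ∫⁻ x, ((fun x => g x ^ 4) * fun x => u x ^ 2) x ∂μ := by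
      congr 1; funext x; simp only [Pi.mul_apply]; ring
    rw [e3]
    refine h3.trans (mul_le_mul' ?_ ?_)
    · calc (∫⁻ x, g x ^ 6 ∂μ) ^ (1 / (3 / 2) : ℝ) ≤ (a ^ 3) ^ (1 / (3 / 2) : ℝ) := by gcongr
        _ = a ^ 2 := by
          rw [← ENNReal.rpow_natCast, ← ENNReal.rpow_natCast, ← ENNReal.rpow_mul]; norm_num
    · calc (∫⁻ x, u x ^ 6 ∂μ) ^ (1 / 3 : ℝ) ≤ (b ^ 3) ^ (1 / 3 : ℝ) := by gcongr
        _ = b := by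
          rw [← ENNReal.rpow_natCast, ← ENNReal.rpow_mul]; norm_num
  have e : ∫⁻ x, g x ^ 2 * u x ^ 2 ∂μ = ∫⁻ x, g x ^ 2 * u x * u x ∂μ := by
    congr 1; funext x; ring
  rw [e]
  exact h1.trans (by gcongr)

theorem exists_integral_sq_mul_sq_le {R : ℝ} (hR : 0 < R) : ∃ K : ℝ, 0 ≤ K ∧
    ∀ (g : E3 → ℝ) (g1 : Fin 3 → E3 → ℝ) (u : E3 → ℝ) (u1 : Fin 3 → E3 → ℝ),
      MemLp g 2 (cubeMeasure R) → (∀ i, MemLp (g1 i) 2 (cubeMeasure R)) →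
      (∀ i, WeakPD R i g (g1 i)) →
      MemLp u 2 (cubeMeasure R) → (∀ i, MemLp (u1 i) 2 (cubeMeasure R)) →
      (∀ i, WeakPD R i u (u1 i)) →
      Integrable (fun x => g x ^ 2 * u x ^ 2) (cubeMeasure R) ∧
      (∫ x in cube R, g x ^ 2 * u x ^ 2) ^ 2 ≤
        K * normOneSq R g g1 ^ 2 * normOneSq R u u1 * ∫ x in cube R, u x * u x := by
  set E := embConst R * 9 with hE
  have hEt : E ≠ ⊤ := ENNReal.mul_ne_top ENNReal.ofReal_ne_top (by simp)
  refine ⟨E.toReal ^ 3, by positivity, fun g g1 u u1 mg mg1 wg mu mu1 wu => ?_⟩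
  have h := lintegral_sq_mul_sq_le mg.1.enorm mu.1.enorm
    (lintegral_pow_six_le_normOneSq hR mg mg1 wg) (lintegral_pow_six_le_normOneSq hR mu mu1 wu)
  rw [← ofReal_integral_mul_self mu, ← hE] at h
  have hg0 := normOneSq_nonneg R g g1
  have hu0 := normOneSq_nonneg R u u1
  have hI0 : 0 ≤ ∫ x in cube R, u x * u x := integral_nonneg fun _ => mul_self_nonneg _
  have e : (E * ENNReal.ofReal (normOneSq R g g1)) ^ 2 * (E * ENNReal.ofReal (normOneSq R u u1)) *
      ENNReal.ofReal (∫ x in cube R, u x * u x) = ENNReal.ofReal (E.toReal ^ 3 *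
        normOneSq R g g1 ^ 2 * normOneSq R u u1 * ∫ x in cube R, u x * u x) := by
    rw [ENNReal.ofReal_mul (by positivity), ENNReal.ofReal_mul (by positivity),
      ENNReal.ofReal_mul (by positivity), ENNReal.ofReal_pow (by positivity),
      ENNReal.ofReal_pow (by positivity), ENNReal.ofReal_toReal hEt]
    ring
  rw [e] at h
  have e2 : ∀ x, ‖g x‖ₑ ^ 2 * ‖u x‖ₑ ^ 2 = ‖g x ^ 2 * u x ^ 2‖ₑ := fun x => by
    rw [enorm_mul, enorm_pow, enorm_pow]
  simp only [e2] at h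
  have hint : Integrable (fun x => g x ^ 2 * u x ^ 2) (cubeMeasure R) := by
    refine ⟨(mg.1.pow 2).mul (mu.1.pow 2), ?_⟩
    rw [hasFiniteIntegral_iff_enorm]
    -- Integrability is a by-product: an infinite integral would contradict the finite bound already
    -- obtained for its square.
    by_contra hc
    rw [not_lt, top_le_iff] at hc
    rw [hc] at h
    simp at h
  refine ⟨hint, ?_⟩
  have hn : ∀ x, 0 ≤ g x ^ 2 * u x ^ 2 := fun x => by positivity
  have e3 : ∫⁻ x in cube R, ‖g x ^ 2 * u x ^ 2‖ₑ
      = ENNReal.ofReal (∫ x in cube R, g x ^ 2 * u x ^ 2) := by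
    rw [ofReal_integral_eq_lintegral_ofReal hint (ae_of_all _ hn)]
    congr 1; funext x; rw [Real.enorm_of_nonneg (hn x)]
  rw [e3, ← ENNReal.ofReal_pow (integral_nonneg hn)] at h
  exact (ENNReal.ofReal_le_ofReal_iff (by positivity)).1 h

/-! ### Multi-indices -/

/-- The multi-index of `∂_i ∂_j`. -/
def idxPair (i j : Fin 3) : MIdx :=
  ⟨fun l => (if l = i then 1 else 0) + if l = j then 1 else 0, by revert i j; decide⟩

/-- The multi-index of `∂_i ∂_j ∂_k`. -/
def idxTriple (i j k : Fin 3) : MIdx :=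
  ⟨fun l => (if l = i then 1 else 0) + (if l = j then 1 else 0) + if l = k then 1 else 0, by
    revert i j k; decide⟩

theorem idxPair_self (i : Fin 3) : idxPair i i = idx2 i := by revert i; decide

theorem idxPair_comm (i j : Fin 3) : idxPair i j = idxPair j i := by
  revert i j; decide

/-- `∂^{β'} = ∂_i ∂^β`. -/
def MIdx.IsSucc (i : Fin 3) (β β' : MIdx) : Prop :=
  ∀ j, (β'.1 j : ℕ) = β.1 j + if j = i then 1 else 0

instance (i : Fin 3) (β β' : MIdx) : Decidable (MIdx.IsSucc i β β') := by
  unfold MIdx.IsSucc; infer_instance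

theorem isSucc_one (i : Fin 3) : MIdx.IsSucc i idx0 (idx1 i) := by revert i; decide

theorem isSucc_pair (i j : Fin 3) : MIdx.IsSucc j (idx1 i) (idxPair i j) := by revert i j; decide

theorem isSucc_triple (i j k : Fin 3) : MIdx.IsSucc k (idxPair i j) (idxTriple i j k) := by
  revert i j k; decide

theorem MIdx.order_le_two {β : MIdx} (h : β.order ≤ 2) :
    β = idx0 ∨ (∃ i, β = idx1 i) ∨ ∃ i j, β = idxPair i j := by
  revert β; decide

theorem MIdx.IsSucc.order {i : Fin 3} {β β' : MIdx} (h : MIdx.IsSucc i β β') :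
    β'.order = β.order + 1 := by
  simp [MIdx.order, h _, Finset.sum_add_distrib]

theorem iterate_pd_comm {φ : E3 → ℝ} (h : IsTest φ) (i j : Fin 3) (n : ℕ) :
    (pd j)^[n] (pd i φ) = pd i ((pd j)^[n] φ) := by
  induction n with
  | zero => rfl
  | succ n ih =>
    rw [Function.iterate_succ_apply', ih, pd_comm (h.iterate j n).1, Function.iterate_succ_apply']

theorem MIdx.IsSucc.mpd {i : Fin 3} {β β' : MIdx} (h : MIdx.IsSucc i β β') {φ : E3 → ℝ}
    (hφ : IsTest φ) : mpd β (pd i φ) = Convexification.mpd β' φ := by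
  unfold Convexification.mpd
  rw [h 0, h 1, h 2]
  have h2 := hφ.iterate 2 (β.1 2 : ℕ)
  have h1 := h2.iterate 1 (β.1 1 : ℕ)
  fin_cases i
  · simp only [Fin.isValue, Fin.zero_eta, if_true, Fin.reduceEq, if_false, add_zero,
      Function.iterate_succ_apply']
    rw [iterate_pd_comm hφ, iterate_pd_comm h2, iterate_pd_comm h1]
  · simp only [Fin.isValue, Fin.mk_one, if_true, Fin.reduceEq, if_false, add_zero,
      Function.iterate_succ_apply']
    rw [iterate_pd_comm hφ, iterate_pd_comm h2]
  · simp only [Fin.isValue, Fin.reduceFinMk, if_true, Fin.reduceEq, if_false, add_zero,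
      Function.iterate_succ_apply]

/-! ### Real parts of functions in `H³` -/

/-- A real linear functional applied to a weak derivative; used for real and imaginary parts. -/
def part {R : ℝ} (T : ℂ →L[ℝ] ℝ) (u : H3 R) (β : MIdx) (x : E3) : ℝ := T (wd u β x)

variable {R : ℝ}

theorem memLp_part (T : ℂ →L[ℝ] ℝ) (u : H3 R) (β : MIdx) :
    MemLp (part T u β) 2 (cubeMeasure R) :=
  T.comp_memLp' (Lp.memLp (wd u β))

theorem integrable_test_smul {φ : E3 → ℝ} (hφ : Continuous φ) (f : L2 R) :
    Integrable (fun x => φ x • f x) (cubeMeasure R) := by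
  refine MemLp.integrable (q := 2) (by norm_num) ?_
  exact (Lp.memLp f).smul (memLp_of_continuous (p := ⊤) hφ)

theorem integral_part (T : ℂ →L[ℝ] ℝ) {φ : E3 → ℝ} (hφ : Continuous φ) (f : L2 R) :
    ∫ x in cube R, φ x * T (f x) = T (∫ x in cube R, φ x • f x) := by
  rw [← T.integral_comp_comm (integrable_test_smul hφ f)]
  simp only [map_smul, smul_eq_mul]

theorem ibpOn_part (T : ℂ →L[ℝ] ℝ) {A : Set E3} {i : Fin 3} {u : H3 R} {β β' : MIdx}
    (h : ∀ φ : E3 → ℝ, IsTest φ → tsupport φ ⊆ A → (∫ x in cube R, φ x • wd u β' x)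
      + (∫ x in cube R, pd i φ x • wd u β x) = 0) :
    IBPOn R A i (part T u β) (part T u β') := by
  intro φ hφ hs
  rw [integral_add (integrable_mul_of_test hφ.1.continuous (memLp_part T u β'))
    (integrable_mul_of_test (hφ.pd i).1.continuous (memLp_part T u β))]
  unfold part
  rw [integral_part T hφ.1.continuous, integral_part T (hφ.pd i).1.continuous, ← map_add,
    h φ hφ hs, map_zero]

/-- The space relates each derivative only to `u` itself. Testing `∂^β u` with `∂_iφ` and `∂^β' u`
with `φ` gives the same integral of `u`, with signs differing by one factor `-1`. -/
theorem weakPD_part (T : ℂ →L[ℝ] ℝ) (u : H3 R) {i : Fin 3} {β β' : MIdx}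
    (h : MIdx.IsSucc i β β') : WeakPD R i (part T u β) (part T u β') := by
  refine ibpOn_part T fun φ hφ hs => ?_
  have h1 := u.2 β' φ hφ hs
  have h2 := u.2 β (pd i φ) (hφ.pd i) ((tsupport_pd_subset i φ).trans hs)
  unfold wd
  rw [h1, h2, h.mpd hφ, h.order, pow_succ]
  simp

theorem eLpNorm_part_le {T : ℂ →L[ℝ] ℝ} (hT : ‖T‖ ≤ 1) (u : H3 R) (β : MIdx) :
    eLpNorm (part T u β) 2 (cubeMeasure R) ≤ ‖u‖ₑ := by
  have h1 : eLpNorm (part T u β) 2 (cubeMeasure R) ≤ ‖wd u β‖ₑ := by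
    rw [Lp.enorm_def]
    refine eLpNorm_mono fun x => (T.le_opNorm _).trans ?_
    exact mul_le_of_le_one_left (norm_nonneg _) hT
  refine h1.trans ?_
  rw [enorm_le_iff_norm_le]
  exact PiLp.norm_apply_le (u.1) β

theorem norm_reCLM_le : ‖Complex.reCLM‖ ≤ 1 := Complex.reCLM_norm.le

theorem norm_imCLM_le : ‖Complex.imCLM‖ ≤ 1 := Complex.imCLM_norm.le

/-- The first derivatives of functions in `H³` are bounded. -/
theorem exists_ae_norm_grad_le (hR : 0 < R) : ∃ C : ℝ, 0 ≤ C ∧ ∀ (u : H3 R) (i : Fin 3),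
    ∀ᵐ x ∂cubeMeasure R, ‖wd u (idx1 i) x‖ ≤ C * ‖u‖ := by
  obtain ⟨C, hC, h⟩ := exists_ae_enorm_le_normTwo hR
  have key : ∀ (T : ℂ →L[ℝ] ℝ), ‖T‖ ≤ 1 → ∀ (u : H3 R) (i : Fin 3),
      ∀ᵐ x ∂cubeMeasure R, ‖part T u (idx1 i) x‖ ≤ C.toReal * 13 * ‖u‖ := by
    intro T hT u i
    have h1 := h (part T u (idx1 i)) (fun j => part T u (idxPair i j))
      (fun j k => part T u (idxTriple i j k)) (memLp_part _ _ _) (fun _ => memLp_part _ _ _)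
      (fun _ _ => memLp_part _ _ _) (fun j => weakPD_part T u (isSucc_pair i j))
      (fun j k => weakPD_part T u (isSucc_triple i j k))
    have h2 : normTwo R (part T u (idx1 i)) (fun j => part T u (idxPair i j))
        (fun j k => part T u (idxTriple i j k)) ≤ 13 * ‖u‖ₑ := by
      unfold normTwo
      calc _ ≤ ‖u‖ₑ + (∑ _j : Fin 3, ‖u‖ₑ) + ∑ _j : Fin 3, ∑ _k : Fin 3, ‖u‖ₑ := by
            gcongr <;> exact eLpNorm_part_le hT u _
        -- The `13` counts derivatives: one of order zero, three of order one, nine of order two.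
        _ = _ := by simp; ring
    filter_upwards [h1] with x hx
    have h3 := hx.trans (mul_le_mul_right h2 C)
    have h4 := ENNReal.toReal_mono (ENNReal.mul_ne_top hC (ENNReal.mul_ne_top (by simp) (by simp))) h3
    simpa [mul_assoc] using h4
  refine ⟨C.toReal * 13 + C.toReal * 13, by positivity, fun u i => ?_⟩
  filter_upwards [key _ norm_reCLM_le u i, key _ norm_imCLM_le u i] with x h1 h2
  refine (Complex.norm_le_abs_re_add_abs_im _).trans ?_
  rw [add_mul]
  exact add_le_add h1 h2

/-! ### The weighted function -/

/-- The normalized square root `exp(λ (z - r)² - λ (R + r)²)` of the Carleman weight. -/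
def wgt (R r lam : ℝ) (x : E3) : ℝ := Real.exp (lam * (x 2 - r) ^ 2 - lam * (R + r) ^ 2)

theorem contDiff_wgt (R r lam : ℝ) : ContDiff ℝ ∞ (wgt R r lam) := by
  unfold wgt
  fun_prop

theorem wgt_ge {r lam : ℝ} (hlam : 0 ≤ lam) (x : E3) :
    Real.exp (-lam * (R + r) ^ 2) ≤ wgt R r lam x := by
  unfold wgt
  refine Real.exp_le_exp.2 ?_
  have : 0 ≤ lam * (x 2 - r) ^ 2 := by positivity
  linarith

theorem pd_wgt (R r lam : ℝ) (i : Fin 3) :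
    pd i (wgt R r lam) = fun x => if 2 = i then slope lam r x * wgt R r lam x else 0 := by
  funext x
  set F : ℝ → ℝ := fun t => Real.exp (lam * (t - r) ^ 2 - lam * (R + r) ^ 2) with hF
  have hd : ∀ t, HasDerivAt F (2 * lam * (t - r) * F t) t := by
    intro t
    have h1 := (((((hasDerivAt_id t).sub_const r).pow 2).const_mul lam).sub_const
      (lam * (R + r) ^ 2)).exp
    have e : 2 * lam * (t - r) * F t = Real.exp (lam * (id t - r) ^ 2 - lam * (R + r) ^ 2)
        * (lam * ((2 : ℕ) * (id t - r) ^ (2 - 1) * 1)) := by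
      simp [hF]; ring
    rw [e]
    exact h1
  have h := pd_comp_coord (F := F) (fun t => (hd t).differentiableAt) i 2 x
  rw [(hd _).deriv] at h
  exact h

theorem pd_pd_wgt (R r lam : ℝ) (i j : Fin 3) (x : E3) :
    pd j (pd i (wgt R r lam)) x =
      if 2 = i then if 2 = j then (slope lam r x ^ 2 + 2 * lam) * wgt R r lam x else 0 else 0 := by
  by_cases hi : 2 = i
  · have e : pd i (wgt R r lam) = fun x => slope lam r x * wgt R r lam x := by
      rw [pd_wgt]; simp only [if_pos hi]
    rw [e, pd_mul ((contDiff_slope lam r).differentiable (by simp))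
      ((contDiff_wgt R r lam).differentiable (by simp)), pd_slope, pd_wgt]
    by_cases hj : 2 = j
    · simp only [if_pos hi, if_pos hj]; ring
    · simp only [if_pos hi, if_neg hj]; ring
  · have e : pd i (wgt R r lam) = fun _ => 0 := by
      rw [pd_wgt]; simp only [hi, if_false]
    rw [e, if_neg hi]
    simp [pd]

theorem abs_slope_le {r lam : ℝ} (hr : R < r) (hlam : 0 ≤ lam) {x : E3} (hx : x ∈ cube R) :
    |slope lam r x| ≤ lam * (2 * (r + R)) := by
  have h := abs_lt.1 (hx 2)
  unfold slope
  rw [abs_mul, abs_of_nonneg (by positivity), abs_of_nonpos (by linarith)]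
  nlinarith

/-- The first derivatives of the weighted function. -/
def wgtOne (r lam : ℝ) (T : ℂ →L[ℝ] ℝ) (u : H3 R) (i : Fin 3) (x : E3) : ℝ :=
  wgt R r lam x * part T u (idx1 i) x + pd i (wgt R r lam) x * part T u idx0 x

/-- The second derivatives of the weighted function. -/
def wgtTwo (r lam : ℝ) (T : ℂ →L[ℝ] ℝ) (u : H3 R) (i j : Fin 3) (x : E3) : ℝ :=
  (wgt R r lam x * part T u (idxPair i j) x + pd j (wgt R r lam) x * part T u (idx1 i) x)
    + (pd i (wgt R r lam) x * part T u (idx1 j) x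
      + pd j (pd i (wgt R r lam)) x * part T u idx0 x)

theorem memLp_wgt_mul {f : E3 → ℝ} (r lam : ℝ) (hf : MemLp f 2 (cubeMeasure R)) :
    MemLp (fun x => wgt R r lam x * f x) 2 (cubeMeasure R) :=
  MemLp.smooth_mul (contDiff_wgt R r lam).continuous hf

theorem zeroPD_part {u : H3 R} (hu : ZeroOnBoundary u) (T : ℂ →L[ℝ] ℝ) (i : Fin 3) :
    ZeroPD R i (part T u idx0) (part T u (idx1 i)) :=
  ibpOn_part T fun φ hφ _ => hu i φ hφ

/-- The trace condition admits test functions avoiding the closed set `∂Ω ∖ Γ`. Cutoffs in `x` and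
`y` keep the support off the lateral faces, and a frontier point with `|x|, |y| < R` and `z < R`
lies on `Γ`. -/
theorem bottom_part (hR : 0 < R) {u : H3 R} (hu : ZeroNormalOnBottom u) (T : ℂ →L[ℝ] ℝ) :
    IBPOn R {x | x 2 < R} 2 (part T u (idx1 2)) (part T u (idxPair 2 2)) := by
  have h : IBPOn R (frontier (cube R) \ bottomFace R)ᶜ 2 (part T u (idx1 2))
      (part T u (idx2 2)) :=
    ibpOn_part T fun φ hφ hs => hu φ hφ (disjoint_left.2 fun x hx hx' => hs hx hx')
  rw [idxPair_self]
  refine h.of_cutoff hR (Finset.univ.erase 2) (by simp) ?_ (memLp_part _ _ _) (memLp_part _ _ _)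
  rintro x ⟨h1, h2⟩ ⟨h3, h4⟩
  have h0 : |x 0| < R := h1 0 (by decide)
  have h1 : |x 1| < R := h1 1 (by decide)
  obtain ⟨h5, i, hi⟩ := frontier_cube_subset R h3
  have hi2 : i = 2 := by
    fin_cases i
    · exact absurd hi h0.ne
    · exact absurd hi h1.ne
    · rfl
  subst hi2
  refine h4 ⟨h0, h1, ?_⟩
  rcases abs_choice (x 2) with h | h
  · rw [h] at hi
    exact absurd hi (ne_of_lt h2)
  · rw [h] at hi
    linarith

/-- Multiplication by the smooth weight preserves the weak derivatives and both boundary conditions.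
For `v_z` on the bottom, the extra term `w_z u` is harmless because `u` vanishes on the boundary. -/
theorem carlemanData_wgt (hR : 0 < R) (r lam : ℝ) {u : H3 R} (hu : ZeroOnBoundary u)
    (hb : ZeroNormalOnBottom u) (T : ℂ →L[ℝ] ℝ) :
    CarlemanData R (fun x => wgt R r lam x * part T u idx0 x) (wgtOne r lam T u)
      (wgtTwo r lam T u) := by
  have hw := contDiff_wgt R r lam
  have hw1 := fun i => contDiff_pd hw i
  have hw2 := fun i j => contDiff_pd (hw1 i) j
  have m0 := memLp_part T u idx0
  have m1 := fun i => memLp_part T u (idx1 i)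
  have m2 := fun i j => memLp_part T u (idxPair i j)
  have m3 := fun i j k => memLp_part T u (idxTriple i j k)
  have sm : ∀ {ψ f : E3 → ℝ}, ContDiff ℝ ∞ ψ → MemLp f 2 (cubeMeasure R) →
      MemLp (fun x => ψ x * f x) 2 (cubeMeasure R) := fun h hf => MemLp.smooth_mul h.continuous hf
  have d0 := fun i => weakPD_part T u (isSucc_one i)
  have d1 := fun i j => weakPD_part T u (isSucc_pair i j)
  have d2 := fun i j k => weakPD_part T u (isSucc_triple i j k)
  refine ⟨sm hw m0, fun i => (sm hw (m1 i)).add (sm (hw1 i) m0), fun i j =>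
    ((sm hw (m2 i j)).add (sm (hw1 j) (m1 i))).add ((sm (hw1 i) (m1 j)).add (sm (hw2 i j) m0)),
    fun i j => ?_, fun i => (zeroPD_part hu T i).mul_smooth hw, fun i j => ?_, ?_,
    fun i j _ _ => ⟨_, ?_, (((d2 i j j).mul_smooth hw).add ((d1 i j).mul_smooth (hw1 j)) ?_ ?_ ?_
      ?_).add (((d1 j j).mul_smooth (hw1 i)).add ((d0 j).mul_smooth (hw2 i j)) ?_ ?_ ?_ ?_)
      ?_ ?_ ?_ ?_⟩⟩
  · funext x
    unfold wgtTwo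
    rw [idxPair_comm i j, pd_comm hw i j]
    ring
  · exact IBPOn.add ((d1 i j).mul_smooth hw) ((d0 j).mul_smooth (hw1 i)) (sm hw (m1 i))
      ((sm hw (m2 i j)).add (sm (hw1 j) (m1 i))) (sm (hw1 i) m0)
      ((sm (hw1 i) (m1 j)).add (sm (hw2 i j) m0))
  · exact IBPOn.add ((bottom_part hR hb T).mul_smooth hw)
      (((zeroPD_part hu T 2).mono (subset_univ _)).mul_smooth (hw1 2)) (sm hw (m1 2))
      ((sm hw (m2 2 2)).add (sm (hw1 2) (m1 2))) (sm (hw1 2) m0)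
      ((sm (hw1 2) (m1 2)).add (sm (hw2 2 2) m0))
  · exact ((((sm hw (m3 i j j)).add (sm (hw1 j) (m2 i j))).add
      ((sm (hw1 j) (m2 i j)).add (sm (hw2 j j) (m1 i)))).add
      (((sm (hw1 i) (m2 j j)).add (sm (hw2 i j) (m1 j))).add
      ((sm (hw2 i j) (m1 j)).add (sm (contDiff_pd (hw2 i j) j) m0))))
  · exact sm hw (m2 i j)
  · exact (sm hw (m3 i j j)).add (sm (hw1 j) (m2 i j))
  · exact sm (hw1 j) (m1 i)
  · exact (sm (hw1 j) (m2 i j)).add (sm (hw2 j j) (m1 i))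
  · exact sm (hw1 i) (m1 j)
  · exact (sm (hw1 i) (m2 j j)).add (sm (hw2 i j) (m1 j))
  · exact sm (hw2 i j) m0
  · exact (sm (hw2 i j) (m1 j)).add (sm (contDiff_pd (hw2 i j) j) m0)
  · exact (sm hw (m2 i j)).add (sm (hw1 j) (m1 i))
  · exact ((sm hw (m3 i j j)).add (sm (hw1 j) (m2 i j))).add
      ((sm (hw1 j) (m2 i j)).add (sm (hw2 j j) (m1 i)))
  · exact (sm (hw1 i) (m1 j)).add (sm (hw2 i j) m0)
  · exact (((sm (hw1 i) (m2 j j)).add (sm (hw2 i j) (m1 j))).add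
      ((sm (hw2 i j) (m1 j)).add (sm (contDiff_pd (hw2 i j) j) m0)))

theorem conjLap_wgt (r lam : ℝ) (T : ℂ →L[ℝ] ℝ) (u : H3 R) (x : E3) :
    conjLap lam r (fun x => wgt R r lam x * part T u idx0 x) (wgtOne r lam T u)
      (wgtTwo r lam T u) x = wgt R r lam x * ∑ i, part T u (idx2 i) x := by
  simp only [conjLap, wgtOne, wgtTwo, pd_pd_wgt]
  simp only [pd_wgt, Fin.sum_univ_three, Fin.isValue,
    Fin.reduceEq, if_true, if_false, idxPair_self]
  ring

/-- The gradient of the weighted first derivative `W ∂_i u`. -/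
def wgtGrad (r lam : ℝ) (T : ℂ →L[ℝ] ℝ) (u : H3 R) (i j : Fin 3) (x : E3) : ℝ :=
  wgt R r lam x * part T u (idxPair i j) x + pd j (wgt R r lam) x * part T u (idx1 i) x

theorem memLp_wgtGrad (r lam : ℝ) (T : ℂ →L[ℝ] ℝ) (u : H3 R) (i j : Fin 3) :
    MemLp (wgtGrad r lam T u i j) 2 (cubeMeasure R) :=
  (memLp_wgt_mul r lam (memLp_part _ _ _)).add
    (MemLp.smooth_mul (contDiff_pd (contDiff_wgt R r lam) j).continuous (memLp_part _ _ _))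

theorem weakPD_wgtGrad (r lam : ℝ) (T : ℂ →L[ℝ] ℝ) (u : H3 R) (i j : Fin 3) :
    WeakPD R j (fun x => wgt R r lam x * part T u (idx1 i) x) (wgtGrad r lam T u i j) :=
  (weakPD_part T u (isSucc_pair i j)).mul_smooth (contDiff_wgt R r lam)

theorem integral_le_of_ae_le {f g : E3 → ℝ} (hf : Integrable f (cubeMeasure R))
    (hg : Integrable g (cubeMeasure R)) (h : ∀ x ∈ cube R, f x ≤ g x) :
    ∫ x in cube R, f x ≤ ∫ x in cube R, g x := by
  refine integral_mono_ae hf hg ?_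
  filter_upwards [ae_mem_cube R] with x hx using h x hx

theorem sub_mul_self_le (a b : ℝ) : (a - b) * (a - b) ≤ 2 * (a * a) + 2 * (b * b) := by
  linarith [mul_self_nonneg (a + b)]

theorem sub_sub_mul_self_le (a b c : ℝ) :
    (a - b - c) * (a - b - c) ≤ 3 * (a * a) + 3 * (b * b) + 3 * (c * c) := by
  linarith [mul_self_nonneg (a + b), mul_self_nonneg (a + c), mul_self_nonneg (b - c)]

theorem sq_add_mul_mul_self_le {s l v D : ℝ} (hs : s ^ 2 ≤ D) :
    ((s ^ 2 + 2 * l) * v) * ((s ^ 2 + 2 * l) * v)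
      ≤ 8 * (l ^ 2 * (v * v)) + 2 * (D * ((s * v) * (s * v))) := by
  have h1 : s ^ 2 * ((s * v) * (s * v)) ≤ D * ((s * v) * (s * v)) :=
    mul_le_mul_of_nonneg_right hs (mul_self_nonneg _)
  linarith [mul_self_nonneg (s ^ 2 * v - 2 * l * v)]

theorem mul_mul_self_le {s v D : ℝ} (hs : s ^ 2 ≤ D) : (s * v) * (s * v) ≤ D * (v * v) := by
  have h1 : s ^ 2 * (v * v) ≤ D * (v * v) := mul_le_mul_of_nonneg_right hs (mul_self_nonneg _)
  linarith

set_option maxHeartbeats 1000000 in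
/-- **Carleman estimate** for the Laplacian with the weight `exp(2 λ (z - r)²)`. -/
theorem exists_carleman {r : ℝ} (hR : 0 < R) (hr : R < r) : ∃ K : ℝ, 1 ≤ K ∧ ∀ lam : ℝ, 1 ≤ lam →
    ∀ u : H3 R, ZeroOnBoundary u → ZeroNormalOnBottom u → ∀ T : ℂ →L[ℝ] ℝ,
    let S := ∫ x in cube R, (wgt R r lam x * ∑ i, part T u (idx2 i) x) ^ 2
    0 ≤ S ∧
    (∫ x in cube R, (wgt R r lam x * part T u idx0 x) * (wgt R r lam x * part T u idx0 x))
      ≤ K * S ∧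
    (∀ i, lam * (∫ x in cube R, (wgt R r lam x * part T u (idx1 i) x) *
      (wgt R r lam x * part T u (idx1 i) x)) ≤ K * S) ∧
    (∀ i j, ∫ x in cube R, wgtGrad r lam T u i j x * wgtGrad r lam T u i j x ≤ K * lam * S) ∧
    ∀ i j, ∫ x in cube R, (wgt R r lam x * part T u (idxPair i j) x) *
      (wgt R r lam x * part T u (idxPair i j) x) ≤ K * lam * S := by
  have hc : 0 < r - R := by linarith
  set c := 1 / (r - R) ^ 2 with hcdef
  set D := (2 * (r + R)) ^ 2 with hD
  have hc0 : 0 < c := by positivity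
  have hD0 : 0 ≤ D := by positivity
  -- `K1`, `K2` and `K3` are the constants for `w ∂_i u`, for the gradient of `w ∂_i u` and for `w
  -- ∂_ij u`. Each is obtained from the preceding bounds by removing derivatives of the weight,
  -- where one derivative of `w` costs at most `λ√D`.
  set K1 := 2 * (1 + c) + 1 with hK1
  set K2 := 3 * (2 + (r + R) ^ 2) + 3 * D * K1 + 24 * c + 6 * D with hK2
  set K3 := 2 * K2 + 2 * D * K1 with hK3
  have hK1p : 0 < K1 := by positivity
  have hK2p : 0 < K2 := by positivity
  have hK3p : 0 < K3 := by positivity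
  refine ⟨1 + c + K1 + K2 + K3, by linarith, fun lam hlam u hu hb T => ?_⟩
  have hl : 0 < lam := by linarith
  have hd := carlemanData_wgt hR r lam hu hb T
  obtain ⟨b1, b2, b3, b4⟩ := hd.estimate hR hlam hr
  have eS : ∫ x in cube R, conjLap lam r (fun x => wgt R r lam x * part T u idx0 x)
      (wgtOne r lam T u) (wgtTwo r lam T u) x ^ 2
      = ∫ x in cube R, (wgt R r lam x * ∑ i, part T u (idx2 i) x) ^ 2 := by
    simp only [conjLap_wgt]
  rw [eS] at b1 b2 b3 b4
  set S := ∫ x in cube R, (wgt R r lam x * ∑ i, part T u (idx2 i) x) ^ 2 with hS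
  have hS0 : 0 ≤ S := integral_nonneg fun x => sq_nonneg _
  set v : E3 → ℝ := fun x => wgt R r lam x * part T u idx0 x with hv
  set g : Fin 3 → E3 → ℝ := fun i x => wgt R r lam x * part T u (idx1 i) x with hg
  have mg : ∀ i, MemLp (g i) 2 (cubeMeasure R) := fun i => memLp_wgt_mul r lam (memLp_part _ _ _)
  have my := memLp_slope_mul hd.memLp lam r
  have iv := integrable_mul_L2 hd.memLp hd.memLp
  have iy := integrable_mul_L2 my my
  have i1 := fun i => integrable_mul_L2 (hd.memLp1 i) (hd.memLp1 i)
  have i2 := fun i j => integrable_mul_L2 (hd.memLp2 i j) (hd.memLp2 i j)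
  have ig := fun i => integrable_mul_L2 (mg i) (mg i)
  set V := ∫ x in cube R, v x * v x with hV
  set Y := ∫ x in cube R, (slope lam r x * v x) * (slope lam r x * v x) with hY
  have hV0 : 0 ≤ V := integral_nonneg fun x => mul_self_nonneg _
  have hY0 : 0 ≤ Y := integral_nonneg fun x => mul_self_nonneg _
  have b3' : ∀ i, lam * ∫ x in cube R, wgtOne r lam T u i x * wgtOne r lam T u i x
      ≤ (1 + c) * S := fun i => by
    refine le_trans ?_ b3
    gcongr
    exact Finset.single_le_sum (f := fun i => ∫ x in cube R, wgtOne r lam T u i x *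
      wgtOne r lam T u i x) (fun _ _ => integral_nonneg fun _ => mul_self_nonneg _)
      (Finset.mem_univ i)
  have b4' : ∀ i j, ∫ x in cube R, wgtTwo r lam T u i j x * wgtTwo r lam T u i j x
      ≤ (2 + (r + R) ^ 2) * lam * S := fun i j => by
    refine le_trans ?_ b4
    refine le_trans ?_ (Finset.single_le_sum (f := fun i => ∑ j, ∫ x in cube R,
      wgtTwo r lam T u i j x * wgtTwo r lam T u i j x) (fun _ _ => Finset.sum_nonneg fun _ _ =>
      integral_nonneg fun _ => mul_self_nonneg _) (Finset.mem_univ i))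
    exact Finset.single_le_sum (f := fun j => ∫ x in cube R,
      wgtTwo r lam T u i j x * wgtTwo r lam T u i j x) (fun _ _ =>
      integral_nonneg fun _ => mul_self_nonneg _) (Finset.mem_univ j)
  have hVS3 : lam ^ 3 * V ≤ c * S := by
    rw [hcdef, one_div, inv_mul_eq_div, le_div_iff₀ (by positivity)]
    have : 0 ≤ (r - R) ^ 2 * lam ^ 3 * V := by positivity
    nlinarith
  have hVS2 : lam ^ 2 * V ≤ c * S := by
    refine le_trans ?_ hVS3
    have : lam ^ 2 ≤ lam ^ 3 := pow_le_pow_right₀ hlam (by norm_num)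
    gcongr
  have hVS : V ≤ c * S := by
    refine le_trans ?_ hVS2
    have : 1 ≤ lam ^ 2 := one_le_pow₀ hlam
    nlinarith
  have hslope : ∀ x ∈ cube R, slope lam r x ^ 2 ≤ lam ^ 2 * D := by
    intro x hx
    have := abs_slope_le hr hl.le hx
    rw [← sq_abs, hD, ← mul_pow]
    gcongr
  have hwpd : ∀ i x, pd i (wgt R r lam) x * part T u idx0 x
      = if 2 = i then slope lam r x * v x else 0 := by
    intro i x
    rw [pd_wgt]
    by_cases hi : 2 = i <;> simp [hi, hv, mul_assoc]
  have b5 : ∀ i, lam * ∫ x in cube R, g i x * g i x ≤ K1 * S := by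
    intro i
    have h1 : ∫ x in cube R, g i x * g i x ≤ ∫ x in cube R, (2 * (wgtOne r lam T u i x *
        wgtOne r lam T u i x) + 2 * ((slope lam r x * v x) * (slope lam r x * v x))) := by
      refine integral_le_of_ae_le (ig i) (((i1 i).const_mul 2).add (iy.const_mul 2))
        fun x hx => ?_
      have e : g i x = wgtOne r lam T u i x - if 2 = i then slope lam r x * v x else 0 := by
        rw [← hwpd, hg, wgtOne]; ring
      rw [e]
      split_ifs
      · exact sub_mul_self_le _ _
      · rw [sub_zero]
        linarith [mul_self_nonneg (wgtOne r lam T u i x), mul_self_nonneg (slope lam r x * v x)]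
    rw [integral_add ((i1 i).const_mul 2) (iy.const_mul 2), integral_const_mul,
      integral_const_mul] at h1
    have h2 := mul_le_mul_of_nonneg_left h1 hl.le
    have h3 := b3' i
    linarith
  have b6 : ∀ i j, ∫ x in cube R, wgtGrad r lam T u i j x * wgtGrad r lam T u i j x
      ≤ K2 * lam * S := by
    intro i j
    have m := memLp_wgtGrad r lam T u i j
    have h1 : ∫ x in cube R, wgtGrad r lam T u i j x * wgtGrad r lam T u i j x
        ≤ ∫ x in cube R, (3 * (wgtTwo r lam T u i j x * wgtTwo r lam T u i j x)
          + 3 * lam ^ 2 * D * (g j x * g j x) + 24 * lam ^ 2 * (v x * v x)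
          + 6 * lam ^ 2 * D * ((slope lam r x * v x) * (slope lam r x * v x))) := by
      refine integral_le_of_ae_le (integrable_mul_L2 m m) (((((i2 i j).const_mul _).add
        ((ig j).const_mul _)).add (iv.const_mul _)).add (iy.const_mul _)) fun x hx => ?_
      have hs := hslope x hx
      have p1 : 0 ≤ lam ^ 2 * D * (g j x * g j x) :=
        mul_nonneg (by positivity) (mul_self_nonneg _)
      have p2 : 0 ≤ lam ^ 2 * (v x * v x) := mul_nonneg (by positivity) (mul_self_nonneg _)
      have p3 : 0 ≤ lam ^ 2 * D * ((slope lam r x * v x) * (slope lam r x * v x)) :=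
        mul_nonneg (by positivity) (mul_self_nonneg _)
      have p4 := mul_self_nonneg (wgtTwo r lam T u i j x)
      by_cases hi : 2 = i
      -- From `∂_ij(wu) = ∂_j(w ∂_i u) + w_i ∂_j u + w_ij u`: the term `q` is the last one, present
      -- only when both indices are vertical, since then `w_zz = (s² + 2λ)w`.
      · obtain ⟨q, e, hq⟩ : ∃ q, wgtGrad r lam T u i j x
            = wgtTwo r lam T u i j x - slope lam r x * g j x - q ∧
            q * q ≤ 8 * (lam ^ 2 * (v x * v x))
              + 2 * (lam ^ 2 * D * ((slope lam r x * v x) * (slope lam r x * v x))) := by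
          by_cases hj : 2 = j
          · refine ⟨(slope lam r x ^ 2 + 2 * lam) * v x, ?_, sq_add_mul_mul_self_le hs⟩
            subst hi
            subst hj
            simp only [wgtGrad, wgtTwo, pd_pd_wgt, hg, hv]
            simp only [pd_wgt, if_true]
            ring
          · refine ⟨0, ?_, by linarith⟩
            subst hi
            simp only [wgtGrad, wgtTwo, pd_pd_wgt, hg]
            simp only [pd_wgt, hj, if_true, if_false]
            ring
        have h1 := sub_sub_mul_self_le (wgtTwo r lam T u i j x) (slope lam r x * g j x) q
        have h2 := mul_mul_self_le (v := g j x) hs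
        rw [e]
        linarith
      · have e : wgtGrad r lam T u i j x = wgtTwo r lam T u i j x := by
          simp only [wgtGrad, wgtTwo, pd_pd_wgt]
          simp only [pd_wgt, hi, if_false]
          ring
        rw [e]
        linarith
    have t1 := (i2 i j).const_mul 3
    have t2 := (ig j).const_mul (3 * lam ^ 2 * D)
    have t3 := iv.const_mul (24 * lam ^ 2)
    have t4 := iy.const_mul (6 * lam ^ 2 * D)
    have e4 := integral_add ((t1.add t2).add t3) t4
    have e3 := integral_add (t1.add t2) t3
    have e2 := integral_add t1 t2
    simp only [Pi.add_apply] at e2 e3 e4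
    rw [e4, e3, e2] at h1
    simp only [integral_const_mul] at h1
    have h2 := b4' i j
    have h3 := mul_le_mul_of_nonneg_left (b5 j) (show 0 ≤ 3 * lam * D by positivity)
    have h4 : 24 * (lam ^ 2 * V) ≤ 24 * (c * S) := by gcongr
    have h5 := mul_le_mul_of_nonneg_left b1 (show 0 ≤ lam * D by positivity)
    have h6 : c * S ≤ lam * (c * S) := le_mul_of_one_le_left (by positivity) hlam
    have h7 : 0 ≤ lam * D * S := by positivity
    rw [hK2]
    linarith
  have b7 : ∀ i j, ∫ x in cube R, (wgt R r lam x * part T u (idxPair i j) x) *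
      (wgt R r lam x * part T u (idxPair i j) x) ≤ K3 * lam * S := by
    intro i j
    have m := memLp_wgtGrad r lam T u i j
    have im := integrable_mul_L2 m m
    have mp := memLp_wgt_mul r lam (memLp_part T u (idxPair i j))
    have h1 : ∫ x in cube R, (wgt R r lam x * part T u (idxPair i j) x) *
        (wgt R r lam x * part T u (idxPair i j) x) ≤ ∫ x in cube R,
          (2 * (wgtGrad r lam T u i j x * wgtGrad r lam T u i j x)
            + 2 * lam ^ 2 * D * (g i x * g i x)) := by
      refine integral_le_of_ae_le (integrable_mul_L2 mp mp)
        ((im.const_mul _).add ((ig i).const_mul _)) fun x hx => ?_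
      have hs := hslope x hx
      have e : wgt R r lam x * part T u (idxPair i j) x
          = wgtGrad r lam T u i j x - if 2 = j then slope lam r x * g i x else 0 := by
        rw [wgtGrad, pd_wgt, hg]
        by_cases hj : 2 = j
        · simp only [hj, if_true]; ring
        · simp only [hj, if_false]; ring
      have h2 := mul_mul_self_le (v := g i x) hs
      have h3 := mul_self_nonneg (slope lam r x * g i x)
      have h4 := mul_self_nonneg (wgtGrad r lam T u i j x)
      rw [e]
      split_ifs
      · have h5 := sub_mul_self_le (wgtGrad r lam T u i j x) (slope lam r x * g i x)
        linarith
      · rw [sub_zero]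
        linarith
    rw [integral_add (im.const_mul _) ((ig i).const_mul _), integral_const_mul,
      integral_const_mul] at h1
    have h2 := b6 i j
    have h3 := mul_le_mul_of_nonneg_left (b5 i) (show 0 ≤ 2 * lam * D by positivity)
    rw [hK3]
    linarith
  have cS : 0 ≤ c * S := by positivity
  have k1S : 0 ≤ K1 * S := by positivity
  have k2S : 0 ≤ K2 * S := by positivity
  have k3S : 0 ≤ K3 * S := by positivity
  have lS : 0 ≤ lam * S := by positivity
  refine ⟨hS0, ?_, fun i => ?_, fun i j => ?_, fun i j => ?_⟩
  · linarith
  · have := b5 i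
    linarith
  · refine (b6 i j).trans ?_
    gcongr
    linarith
  · refine (b7 i j).trans ?_
    gcongr
    linarith

/-! ### The coefficients of the operator -/

theorem contDiff_Psi (a : ℝ) (n : ℕ) : ContDiff ℝ ∞ (Psi a n) := by
  induction n using Nat.strong_induction_on with
  | _ n ih =>
    rw [Psi]
    refine ContDiff.div_const (ContDiff.sub (by fun_prop) ?_) _
    exact ContDiff.sum fun j _ => contDiff_const.mul (ih j j.2)

theorem continuous_Psi (a : ℝ) (n : ℕ) : Continuous (Psi a n) := (contDiff_Psi a n).continuous

theorem continuous_deriv_Psi (a : ℝ) (n : ℕ) : Continuous (deriv (Psi a n)) :=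
  (contDiff_Psi a n).continuous_deriv (by simp)

theorem continuous_srcDist (d : ℝ) : Continuous fun p : E3 × ℝ => srcDist d p.1 p.2 := by
  unfold srcDist
  fun_prop

/-- The sources lie on `z = -d`, strictly below the closed cube, so the coefficients are continuous
up to its boundary. -/
theorem srcDist_pos {d : ℝ} (hd : R < d) {x : E3} (hx : ∀ i, |x i| ≤ R) (t : ℝ) :
    0 < srcDist d x t := by
  unfold srcDist
  have h1 := (abs_le.1 (hx 2)).1
  have h2 : 0 < x 2 + d := by linarith
  positivity

theorem continuous_srcVec (d : ℝ) (i : Fin 3) :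
    Continuous fun p : E3 × ℝ => srcVec d p.1 p.2 i := by
  fin_cases i <;> simp [srcVec] <;> fun_prop

theorem measurable_srcTilde (k d : ℝ) (i : Fin 3) :
    Measurable fun p : E3 × ℝ => srcTilde k d p.1 p.2 i := by
  have h1 := (continuous_srcDist d).measurable
  have h2 := (continuous_srcVec d i).measurable
  unfold srcTilde
  fun_prop

theorem continuousOn_srcTilde (k : ℝ) {d : ℝ} (hd : R < d) (s : Set ℝ) (i : Fin 3) :
    ContinuousOn (fun p : E3 × ℝ => srcTilde k d p.1 p.2 i) ({x | ∀ i, |x i| ≤ R} ×ˢ s) := by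
  have h1 := (Complex.continuous_ofReal.comp (continuous_srcDist d)).continuousOn
    (s := {x : E3 | ∀ i, |x i| ≤ R} ×ˢ s)
  have h2 := (Complex.continuous_ofReal.comp (continuous_srcVec d i)).continuousOn
    (s := {x : E3 | ∀ i, |x i| ≤ R} ×ˢ s)
  have h0 : ∀ p ∈ {x : E3 | ∀ i, |x i| ≤ R} ×ˢ s, (srcDist d p.1 p.2 : ℂ) ≠ 0 := fun p hp => by
    exact_mod_cast (srcDist_pos hd hp.1 p.2).ne'
  unfold srcTilde
  exact ((continuousOn_const.mul h2).div h1 h0).sub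
    (h2.div (h1.pow 2) fun p hp => pow_ne_zero _ (h0 p hp))

theorem exists_srcHat_eq (k d : ℝ) (i : Fin 3) : ∃ p q : E3 × ℝ → ℝ, Continuous p ∧
    Continuous q ∧ ∀ y : E3 × ℝ, srcHat k d y.1 y.2 i
      = Complex.I * k / srcDist d y.1 y.2 ^ 3 * (p y : ℂ) - 1 / srcDist d y.1 y.2 ^ 4 * (q y : ℂ) := by
  refine ⟨_, _, ?_, ?_, fun y => rfl⟩
  · fin_cases i <;> simp <;> fun_prop
  · fin_cases i <;> simp <;> fun_prop

theorem measurable_srcHat (k d : ℝ) (i : Fin 3) :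
    Measurable fun p : E3 × ℝ => srcHat k d p.1 p.2 i := by
  obtain ⟨p, q, hp, hq, h⟩ := exists_srcHat_eq k d i
  have h1 := (continuous_srcDist d).measurable
  have h2 := hp.measurable
  have h3 := hq.measurable
  simp only [h]
  fun_prop

theorem continuousOn_srcHat (k : ℝ) {d : ℝ} (hd : R < d) (s : Set ℝ) (i : Fin 3) :
    ContinuousOn (fun p : E3 × ℝ => srcHat k d p.1 p.2 i) ({x | ∀ i, |x i| ≤ R} ×ˢ s) := by
  obtain ⟨p, q, hp, hq, h⟩ := exists_srcHat_eq k d i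
  have h1 := (Complex.continuous_ofReal.comp (continuous_srcDist d)).continuousOn
    (s := {x : E3 | ∀ i, |x i| ≤ R} ×ˢ s)
  have h0 : ∀ p ∈ {x : E3 | ∀ i, |x i| ≤ R} ×ˢ s, (srcDist d p.1 p.2 : ℂ) ≠ 0 := fun p hp => by
    exact_mod_cast (srcDist_pos hd hp.1 p.2).ne'
  simp only [h]
  exact ((continuousOn_const.div (h1.pow 3) fun p hp => pow_ne_zero _ (h0 p hp)).mul
    (Complex.continuous_ofReal.comp hp).continuousOn).sub
    ((continuousOn_const.div (h1.pow 4) fun p hp => pow_ne_zero _ (h0 p hp)).mul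
    (Complex.continuous_ofReal.comp hq).continuousOn)

/-! ### Integration over the source positions. -/

/-- Functions of a point of the cube and of the source position that can be integrated over the
sources, with a measurable and bounded result. -/
structure IsSourceKernel (R a : ℝ) (F : E3 → ℝ → ℂ) : Prop where
  measurable : Measurable (Function.uncurry F)
  continuousOn : ContinuousOn (Function.uncurry F) ({x | ∀ i, |x i| ≤ R} ×ˢ Icc (-a) a)

theorem IsSourceKernel.mul {a : ℝ} {F : E3 → ℝ → ℂ} (h : IsSourceKernel R a F) {w : ℝ → ℝ}
    (hw : Continuous w) : IsSourceKernel R a fun x t => ((w t : ℝ) : ℂ) * F x t := by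
  have h1 : Continuous fun p : E3 × ℝ => ((w p.2 : ℝ) : ℂ) := by fun_prop
  exact ⟨h1.measurable.mul h.1, h1.continuousOn.mul h.2⟩

theorem isSourceKernel_srcTilde (k a : ℝ) {d : ℝ} (hd : R < d) (i : Fin 3) :
    IsSourceKernel R a fun x t => srcTilde k d x t i :=
  ⟨measurable_srcTilde k d i, continuousOn_srcTilde k hd _ i⟩

theorem isSourceKernel_srcHat (k a : ℝ) {d : ℝ} (hd : R < d) (i : Fin 3) :
    IsSourceKernel R a fun x t => srcHat k d x t i :=
  ⟨measurable_srcHat k d i, continuousOn_srcHat k hd _ i⟩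

theorem IsSourceKernel.intervalIntegrable {a : ℝ} (ha : 0 < a) {F : E3 → ℝ → ℂ}
    (h : IsSourceKernel R a F) {x : E3} (hx : x ∈ cube R) :
    IntervalIntegrable (F x) volume (-a) a := by
  refine ContinuousOn.intervalIntegrable_of_Icc (by linarith) ?_
  exact h.2.comp (f := fun t => (x, t)) (by fun_prop)
    fun t ht => ⟨cube_subset_closedCube R hx, ht⟩

/-- Measurable functions that are bounded on the cube. -/
def IsBddCoeff (R : ℝ) (b : E3 → ℂ) : Prop :=
  Measurable b ∧ ∃ K : ℝ, ∀ x ∈ cube R, ‖b x‖ ≤ K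

theorem IsBddCoeff.add {b c : E3 → ℂ} (hb : IsBddCoeff R b) (hc : IsBddCoeff R c) :
    IsBddCoeff R fun x => b x + c x := by
  obtain ⟨mb, K, hK⟩ := hb
  obtain ⟨mc, K', hK'⟩ := hc
  exact ⟨mb.add mc, K + K', fun x hx => (norm_add_le _ _).trans (add_le_add (hK x hx) (hK' x hx))⟩

theorem IsBddCoeff.const_mul {b : E3 → ℂ} (hb : IsBddCoeff R b) (c : ℂ) :
    IsBddCoeff R fun x => c * b x := by
  obtain ⟨mb, K, hK⟩ := hb
  refine ⟨mb.const_mul c, ‖c‖ * K, fun x hx => ?_⟩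
  rw [norm_mul]
  exact mul_le_mul_of_nonneg_left (hK x hx) (norm_nonneg _)

theorem isBddCoeff_sum {ι : Type*} (s : Finset ι) {b : ι → E3 → ℂ}
    (hb : ∀ i ∈ s, IsBddCoeff R (b i)) : IsBddCoeff R fun x => ∑ i ∈ s, b i x := by
  classical
  induction s using Finset.induction_on with
  | empty => exact ⟨by simp, 0, by simp⟩
  | insert i s hi ih =>
    simp only [Finset.sum_insert hi]
    exact (hb i (Finset.mem_insert_self _ _)).add
      (ih fun j hj => hb j (Finset.mem_insert_of_mem hj))

theorem IsSourceKernel.isBddCoeff {a : ℝ} (ha : 0 < a) {F : E3 → ℝ → ℂ}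
    (h : IsSourceKernel R a F) : IsBddCoeff R fun x => ∫ t in (-a)..a, F x t := by
  refine ⟨?_, ?_⟩
  · simp only [intervalIntegral.integral_of_le (show -a ≤ a by linarith)]
    exact (h.1.stronglyMeasurable.integral_prod_right' (ν := volume.restrict (Ioc (-a) a))).measurable
  · obtain ⟨K, hK⟩ := ((isCompact_closedCube R).prod isCompact_Icc).exists_bound_of_continuousOn h.2
    refine ⟨K * |a - -a|, fun x hx => intervalIntegral.norm_integral_le_of_norm_le_const
      fun t ht => hK (x, t) ⟨cube_subset_closedCube R hx, ?_⟩⟩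
    rw [uIoc_of_le (by linarith)] at ht
    exact Ioc_subset_Icc_self ht

/-! ### The operator in normal form. -/

/-- The operator `V ↦ ΔV + b · ∇V + c ∇V · ∇V`. -/
def quasi {N : ℕ} (b : Fin N → Fin N → Fin 3 → E3 → ℂ) (V : H3N R N) (x : E3) (m : Fin N) : ℂ :=
  lap (V m) x + ∑ n, ∑ i, b m n i x * grad (V n) x i

/-- The bilinear form `c ∇V · ∇V'`. -/
def gradForm {N : ℕ} (c : Fin N → Fin N → Fin N → ℝ) (V V' : H3N R N) (x : E3) (m : Fin N) : ℂ :=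
  ∑ n, ∑ l, ∑ i, (c m n l : ℂ) * (grad (V n) x i * grad (V' l) x i)

theorem sum_mul_sum_sum {ι κ τ : Type*} [Fintype ι] [Fintype κ] [Fintype τ] (s : ι → ℂ)
    (β : ι → κ → τ → ℂ) (P : κ → τ → ℂ) :
    ∑ m, s m * ∑ n, ∑ i, β m n i * P n i = ∑ n, ∑ i, (∑ m, s m * β m n i) * P n i := by
  simp only [Finset.mul_sum, Finset.sum_mul]
  rw [Finset.sum_comm]
  refine Finset.sum_congr rfl fun n _ => ?_
  rw [Finset.sum_comm]
  simp only [mul_assoc]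

theorem fvec_eq {a d k : ℝ} {N : ℕ} (ha : 0 < a) (hd : R < d) {x : E3} (hx : x ∈ cube R)
    (P : Fin N → Fin 3 → ℂ) (m : Fin N) : fvec a d k N x P m =
      (∑ n : Fin N, ∑ l : Fin N, ∑ i, ((2 * ∫ t in (-a)..a, Psi a m t * Psi a n t * deriv (Psi a l) t : ℝ) : ℂ) *
        (P n i * P l i)) +
      ∑ n : Fin N, ∑ i, (2 * (∫ t in (-a)..a, ((Psi a m t * deriv (Psi a n) t : ℝ) : ℂ) * srcTilde k d x t i)
        + 2 * ∫ t in (-a)..a, ((Psi a m t * Psi a n t : ℝ) : ℂ) * srcHat k d x t i) * P n i := by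
  have hw1 : ∀ n : Fin N, Continuous fun t => Psi a m t * deriv (Psi a n) t := fun n =>
    (continuous_Psi a m).mul (continuous_deriv_Psi a n)
  have hw2 : ∀ n : Fin N, Continuous fun t => Psi a m t * Psi a n t := fun n =>
    (continuous_Psi a m).mul (continuous_Psi a n)
  have e1 : ∀ n : Fin N, (∫ t in (-a)..a, ((Psi a m t * deriv (Psi a n) t : ℝ) : ℂ) *
      (P n ⬝ᵥ srcTilde k d x t)) = ∑ i, (∫ t in (-a)..a,
        ((Psi a m t * deriv (Psi a n) t : ℝ) : ℂ) * srcTilde k d x t i) * P n i := by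
    intro n
    simp only [dotProduct, Finset.mul_sum]
    rw [intervalIntegral.integral_finsetSum]
    · refine Finset.sum_congr rfl fun i _ => ?_
      rw [← intervalIntegral.integral_mul_const]
      congr 1; ext t; ring
    · intro i _
      have := (((isSourceKernel_srcTilde k a hd i).mul (hw1 n)).intervalIntegrable ha hx).mul_const
        (P n i)
      refine this.congr (fun t _ => ?_)
      ring
  have e2 : ∀ n : Fin N, (∫ t in (-a)..a, ((Psi a m t * Psi a n t : ℝ) : ℂ) *
      (srcHat k d x t ⬝ᵥ P n)) = ∑ i, (∫ t in (-a)..a,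
        ((Psi a m t * Psi a n t : ℝ) : ℂ) * srcHat k d x t i) * P n i := by
    intro n
    simp only [dotProduct, Finset.mul_sum]
    rw [intervalIntegral.integral_finsetSum]
    · refine Finset.sum_congr rfl fun i _ => ?_
      rw [← intervalIntegral.integral_mul_const]
      congr 1; ext t; ring
    · intro i _
      have := (((isSourceKernel_srcHat k a hd i).mul (hw2 n)).intervalIntegrable ha hx).mul_const
        (P n i)
      refine this.congr (fun t _ => ?_)
      ring
  simp only [fvec, e1, e2]
  simp only [dotProduct, add_assoc, add_mul, Finset.sum_add_distrib]
  simp only [Finset.mul_sum, Finset.sum_mul]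
  congr 1
  · refine Finset.sum_congr rfl fun n _ => Finset.sum_congr rfl fun l _ =>
      Finset.sum_congr rfl fun i _ => ?_
    push_cast
    ring
  · simp only [mul_assoc]

/-- The matrix `S_N⁻¹` is absorbed into the coefficients. Only two features of the sources matter
afterwards: the linear coefficients are bounded and the quadratic ones are constant. -/
theorem exists_coefficients {a d k : ℝ} {N : ℕ} (ha : 0 < a) (hd : R < d) :
    ∃ (b : Fin N → Fin N → Fin 3 → E3 → ℂ) (c : Fin N → Fin N → Fin N → ℝ),
      (∀ m n i, IsBddCoeff R (b m n i)) ∧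
      ∀ (V : H3N R N), ∀ x ∈ cube R, ∀ m,
        Lop a d k V x m = quasi b V x m + gradForm c V V x m := by
  refine ⟨fun m n i x => ∑ m', (((Smat a N)⁻¹ m m' : ℝ) : ℂ) *
      (2 * (∫ t in (-a)..a, ((Psi a m' t * deriv (Psi a n) t : ℝ) : ℂ) * srcTilde k d x t i)
        + 2 * ∫ t in (-a)..a, ((Psi a m' t * Psi a n t : ℝ) : ℂ) * srcHat k d x t i),
    fun m n l => ∑ m', (Smat a N)⁻¹ m m' *
      (2 * ∫ t in (-a)..a, Psi a m' t * Psi a n t * deriv (Psi a l) t), fun m n i => ?_,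
    fun V x hx m => ?_⟩
  · refine isBddCoeff_sum _ fun m' _ => IsBddCoeff.const_mul (IsBddCoeff.add ?_ ?_) _
    · exact (((isSourceKernel_srcTilde k a hd i).mul ((continuous_Psi a m').mul
        (continuous_deriv_Psi a n))).isBddCoeff ha).const_mul 2
    · exact (((isSourceKernel_srcHat k a hd i).mul ((continuous_Psi a m').mul
        (continuous_Psi a n))).isBddCoeff ha).const_mul 2
  · rw [Lop, quasi, add_assoc]
    congr 1
    simp only [Matrix.mulVec, dotProduct, Matrix.map_apply, fvec_eq ha hd hx, gradForm]
    rw [Finset.sum_congr rfl fun m' _ => mul_add _ _ _, Finset.sum_add_distrib, add_comm]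
    refine congrArg₂ _ (sum_mul_sum_sum _ _ _) ?_
    simp only [← Finset.mul_sum]
    rw [sum_mul_sum_sum (fun m' => (((Smat a N)⁻¹ m m' : ℝ) : ℂ))]
    push_cast
    rfl

/-! ### Quadratic maps and the gradient projection method in Hilbert spaces -/

section Hilbert

variable {E F : Type*} [NormedAddCommGroup E] [InnerProductSpace ℝ E]
  [NormedAddCommGroup F] [InnerProductSpace ℝ F]

open scoped RealInnerProductSpace

/-- The derivative of `V ↦ A V + B V V` at `V` in the direction `h`. -/
def quadDeriv (A : E →L[ℝ] F) (B : E →L[ℝ] E →L[ℝ] F) (V h : E) : F := A h + (B V h + B h V)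

theorem hasFDerivAt_quad (A : E →L[ℝ] F) (B : E →L[ℝ] E →L[ℝ] F) (V : E) :
    HasFDerivAt (fun V => ‖A V + B V V‖ ^ 2)
      (2 • (innerSL ℝ (A V + B V V)).comp (A + (B V + B.flip V))) V := by
  have h1 : HasFDerivAt (fun V => B V V) (B V + B.flip V) V := by
    have := B.hasFDerivAt_of_bilinear (hasFDerivAt_id V) (hasFDerivAt_id V)
    refine this.congr_fderiv ?_
    ext h
    simp
  exact (A.hasFDerivAt.add h1).norm_sq

/-- A quadratic map has an exact second-order expansion, so the first-order remainder of its squared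
norm is known in closed form. -/
theorem quad_add (A : E →L[ℝ] F) (B : E →L[ℝ] E →L[ℝ] F) (V h : E) :
    ‖A (V + h) + B (V + h) (V + h)‖ ^ 2 - ‖A V + B V V‖ ^ 2
      - 2 * ⟪A V + B V V, quadDeriv A B V h⟫
      = ‖quadDeriv A B V h + B h h‖ ^ 2 + 2 * ⟪A V + B V V, B h h⟫ := by
  have e : A (V + h) + B (V + h) (V + h) = (A V + B V V) + (quadDeriv A B V h + B h h) := by
    simp only [quadDeriv, map_add, add_apply]
    abel
  rw [e, norm_add_sq_real, inner_add_right]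
  ring

theorem norm_bilin_le (B : E →L[ℝ] E →L[ℝ] F) {V h : E} {ρ : ℝ} (hV : ‖V‖ ≤ ρ) :
    ‖B V h‖ ≤ ‖B‖ * ρ * ‖h‖ := by
  refine (B.le_opNorm₂ V h).trans ?_
  gcongr

theorem norm_quadDeriv_le (A : E →L[ℝ] F) (B : E →L[ℝ] E →L[ℝ] F) {V : E} {ρ : ℝ} (hV : ‖V‖ ≤ ρ)
    (h : E) : ‖quadDeriv A B V h‖ ≤ (‖A‖ + 2 * (‖B‖ * ρ)) * ‖h‖ := by
  have h1 := A.le_opNorm h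
  have h2 := norm_bilin_le B (h := h) hV
  have h3 := norm_bilin_le B.flip (h := h) hV
  rw [ContinuousLinearMap.opNorm_flip, ContinuousLinearMap.flip_apply] at h3
  calc _ ≤ ‖A h‖ + (‖B V h‖ + ‖B h V‖) :=
        (norm_add_le _ _).trans (add_le_add_right (norm_add_le _ _) _)
    _ ≤ _ := by linarith

theorem norm_quad_le (A : E →L[ℝ] F) (B : E →L[ℝ] E →L[ℝ] F) {V : E} {ρ : ℝ} (hV : ‖V‖ ≤ ρ) :
    ‖A V + B V V‖ ≤ (‖A‖ + ‖B‖ * ρ) * ρ := by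
  have h1 := A.le_opNorm V
  have h2 := norm_bilin_le B (h := V) hV
  have hρ : 0 ≤ ρ := (norm_nonneg V).trans hV
  calc _ ≤ ‖A V‖ + ‖B V V‖ := norm_add_le _ _
    _ ≤ (‖A‖ + ‖B‖ * ρ) * ‖V‖ := by linarith
    _ ≤ _ := by gcongr

/-- On bounded sets the remainder of the first order Taylor expansion of `‖A V + B V V‖²` is
at most quadratic, and the derivative is bounded. -/
theorem exists_quad_le (A : E →L[ℝ] F) (B : E →L[ℝ] E →L[ℝ] F) (ρ : ℝ) (hρ : 0 ≤ ρ) :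
    ∃ D : ℝ, 0 ≤ D ∧ (∀ V h : E, ‖V‖ ≤ ρ → 2 * ⟪A V + B V V, quadDeriv A B V h⟫ ≤ D * ‖h‖) ∧
      ∀ V h : E, ‖V‖ ≤ ρ → ‖h‖ ≤ ρ →
        ‖quadDeriv A B V h + B h h‖ ^ 2 + 2 * ⟪A V + B V V, B h h⟫ ≤ D * ‖h‖ ^ 2 := by
  set a := (‖A‖ + ‖B‖ * ρ) * ρ with ha
  set c := ‖A‖ + 2 * (‖B‖ * ρ) with hc
  have ha0 : 0 ≤ a := by positivity
  have hc0 : 0 ≤ c := by positivity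
  have hb : 0 ≤ ‖B‖ * ρ := by positivity
  refine ⟨2 * a * c + ((c + ‖B‖ * ρ) ^ 2 + 2 * a * ‖B‖), by positivity, fun V h hV => ?_,
    fun V h hV hh => ?_⟩
  · have h1 := norm_quad_le A B hV
    have h2 := norm_quadDeriv_le A B hV h
    have h3 : ⟪A V + B V V, quadDeriv A B V h⟫ ≤ a * (c * ‖h‖) :=
      (real_inner_le_norm _ _).trans (mul_le_mul h1 h2 (norm_nonneg _) ha0)
    have h4 : 0 ≤ ((c + ‖B‖ * ρ) ^ 2 + 2 * a * ‖B‖) * ‖h‖ := by positivity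
    linarith
  · have h1 := norm_quad_le A B hV
    have h2 := norm_quadDeriv_le A B hV h
    have h5 := B.le_opNorm₂ h h
    have h3 : ⟪A V + B V V, B h h⟫ ≤ a * (‖B‖ * ‖h‖ * ‖h‖) :=
      (real_inner_le_norm _ _).trans (mul_le_mul h1 h5 (norm_nonneg _) ha0)
    have h6 : ‖quadDeriv A B V h + B h h‖ ≤ (c + ‖B‖ * ρ) * ‖h‖ := by
      have := norm_bilin_le B (h := h) hh
      calc _ ≤ ‖quadDeriv A B V h‖ + ‖B h h‖ := norm_add_le _ _
        _ ≤ _ := by linarith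
    have h7 : ‖quadDeriv A B V h + B h h‖ ^ 2 ≤ ((c + ‖B‖ * ρ) * ‖h‖) ^ 2 := by gcongr
    have h8 : 0 ≤ 2 * a * c * ‖h‖ ^ 2 := by positivity
    linarith

theorem ballProj_inner_le {ρ : ℝ} (hρ : 0 ≤ ρ) (x : E) {y : E} (hy : ‖y‖ ≤ ρ) :
    ⟪x - ballProj ρ x, y - ballProj ρ x⟫ ≤ 0 := by
  obtain ⟨h1, h2⟩ := ballProj_spec hρ x
  refine (norm_eq_iInf_iff_real_inner_le_zero (convex_closedBall (0 : E) ρ) h1).1 ?_ y (by simpa)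
  have : Nonempty (Metric.closedBall (0 : E) ρ) := ⟨⟨_, h1⟩⟩
  refine le_antisymm (le_ciInf fun w => h2 w w.2) ?_
  exact ciInf_le (f := fun w : Metric.closedBall (0 : E) ρ => ‖x - w‖)
    ⟨0, by rintro _ ⟨w, rfl⟩; exact norm_nonneg _⟩ ⟨_, h1⟩

theorem norm_ballProj_le {ρ : ℝ} (hρ : 0 ≤ ρ) (x : E) : ‖ballProj ρ x‖ ≤ ρ := by
  simpa using (ballProj_spec hρ x).1

/-- Adding the variational inequalities for the two projected points gives firm nonexpansiveness,
`‖p - q‖² ≤ ⟪x - y, p - q⟫`. -/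
theorem norm_ballProj_sub_le {ρ : ℝ} (hρ : 0 ≤ ρ) (x y : E) :
    ‖ballProj ρ x - ballProj ρ y‖ ≤ ‖x - y‖ := by
  have h1 := ballProj_inner_le hρ x (norm_ballProj_le hρ y)
  have h2 := ballProj_inner_le hρ y (norm_ballProj_le hρ x)
  set p := ballProj ρ x
  set q := ballProj ρ y
  have h3 : ‖p - q‖ ^ 2 ≤ ⟪x - y, p - q⟫ := by
    rw [← real_inner_self_eq_norm_sq]
    have e1 : ⟪x - p, q - p⟫ = -⟪x, p - q⟫ + ⟪p, p - q⟫ := by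
      rw [← neg_sub p q, inner_neg_right, inner_sub_left]; ring
    have e2 : ⟪y - q, p - q⟫ = ⟪y, p - q⟫ - ⟪q, p - q⟫ := inner_sub_left _ _ _
    rw [inner_sub_left, inner_sub_left]
    linarith
  have h4 := real_inner_le_norm (x - y) (p - q)
  by_contra! h
  have h5 : 0 < ‖p - q‖ := (norm_nonneg _).trans_lt h
  have h6 := mul_lt_mul_of_pos_right h h5
  linarith [sq ‖p - q‖]

/-- A function `φ` with gradient `g` that is strongly convex on the ball of radius `ρ + 1`, with a
quadratic upper bound there. -/
structure GradData (φ : E → ℝ) (g : E → E) (ρ gam D : ℝ) : Prop where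
  lower : ∀ x y, ‖x‖ ≤ ρ → ‖y‖ ≤ ρ + 1 → gam * ‖y - x‖ ^ 2 ≤ φ y - φ x - ⟪g x, y - x⟫
  upper : ∀ x y, ‖x‖ ≤ ρ → ‖y‖ ≤ ρ + 1 → φ y - φ x - ⟪g x, y - x⟫ ≤ D * ‖y - x‖ ^ 2
  bound : ∀ x, ‖x‖ ≤ ρ → ‖g x‖ ≤ D

/-- Cocoercivity of the gradient of `φ - γ ‖·‖²`. -/
theorem GradData.cocoercive {φ : E → ℝ} {g : E → E} {ρ gam D τ : ℝ} (h : GradData φ g ρ gam D)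
    (hgam : 0 ≤ gam) (hτ : 0 < τ) (hτD : 2 * D * τ ≤ 1)
    (hτ1 : τ * (2 * D + 4 * gam * ρ) ≤ 1) {x y : E} (hx : ‖x‖ ≤ ρ) (hy : ‖y‖ ≤ ρ) :
    τ * ‖(g y - (2 * gam) • y) - (g x - (2 * gam) • x)‖ ^ 2 ≤
      ⟪(g y - (2 * gam) • y) - (g x - (2 * gam) • x), y - x⟫ := by
  -- Half of the Baillon–Haddad argument for `ψ = φ - γ‖·‖²`. Adding it to the version with `x` and
  -- `y` exchanged cancels the values of `ψ`.
  have key : ∀ x y : E, ‖x‖ ≤ ρ → ‖y‖ ≤ ρ → ∀ δ, δ = (g y - (2 * gam) • y) - (g x - (2 * gam) • x) →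
      (φ x - gam * ‖x‖ ^ 2) - (φ y - gam * ‖y‖ ^ 2) + ⟪g x - (2 * gam) • x, y - x⟫
        ≤ - (τ / 2) * ‖δ‖ ^ 2 := by
    intro x y hx hy δ hδ
    have hδn : ‖δ‖ ≤ 2 * D + 4 * gam * ρ := by
      rw [hδ]
      refine (norm_sub_le _ _).trans ?_
      have h1 := norm_sub_le (g y) ((2 * gam) • y)
      have h2 := norm_sub_le (g x) ((2 * gam) • x)
      rw [norm_smul, Real.norm_eq_abs, abs_of_nonneg (by linarith)] at h1 h2
      have h3 : 2 * gam * ‖y‖ ≤ 2 * gam * ρ := by gcongr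
      have h4 : 2 * gam * ‖x‖ ≤ 2 * gam * ρ := by gcongr
      linarith [h.bound x hx, h.bound y hy]
    -- A gradient step from `y` for `ψ` minus its linearization at `x`: the lower bound is used from
    -- `x`, the upper bound from `y`. The point may leave the ball of radius `ρ`, but `‖τδ‖ ≤ 1`;
    -- this is why the bounds are assumed up to radius `ρ + 1`.
    set z := y - τ • δ with hz
    have hzn : ‖z‖ ≤ ρ + 1 := by
      have h1 := norm_sub_le y (τ • δ)
      rw [norm_smul, Real.norm_eq_abs, abs_of_pos hτ] at h1
      have h2 : τ * ‖δ‖ ≤ τ * (2 * D + 4 * gam * ρ) := by gcongr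
      linarith
    have l := h.lower x z hx hzn
    have u := h.upper y z hy hzn
    have ezy : z - y = -(τ • δ) := by rw [hz]; abel
    have ezx : z - x = -(τ • δ) + (y - x) := by rw [hz]; abel
    have n1 : ‖z - y‖ ^ 2 = τ ^ 2 * ‖δ‖ ^ 2 := by
      rw [ezy, norm_neg, norm_smul, Real.norm_eq_abs, mul_pow, sq_abs]
    have n2 : ‖z - x‖ ^ 2 = ‖z‖ ^ 2 - 2 * ⟪x, z⟫ + ‖x‖ ^ 2 := by
      rw [norm_sub_sq_real, real_inner_comm]
    have n3 : ‖z - y‖ ^ 2 = ‖z‖ ^ 2 - 2 * ⟪y, z⟫ + ‖y‖ ^ 2 := by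
      rw [norm_sub_sq_real, real_inner_comm]
    have i1 : ⟪g y, z - y⟫ - ⟪g x, z - y⟫ - 2 * gam * (⟪y, z - y⟫ - ⟪x, z - y⟫)
        = - τ * ‖δ‖ ^ 2 := by
      have : ⟪δ, z - y⟫ = - τ * ‖δ‖ ^ 2 := by
        rw [ezy, inner_neg_right, inner_smul_right, real_inner_self_eq_norm_sq]; ring
      rw [← this, hδ]
      simp only [inner_sub_left, inner_smul_left]
      simp
      ring
    have i2 : ⟪g x, z - x⟫ = ⟪g x, z - y⟫ + ⟪g x, y - x⟫ := by
      rw [← inner_add_right]; congr 1; abel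
    have i3 : ⟪g x - (2 * gam) • x, y - x⟫ = ⟪g x, y - x⟫ - 2 * gam * (⟪x, y⟫ - ‖x‖ ^ 2) := by
      rw [inner_sub_left, inner_smul_left, inner_sub_right x, real_inner_self_eq_norm_sq]; simp
    have i4 : ⟪y, z - y⟫ = ⟪y, z⟫ - ‖y‖ ^ 2 := by
      rw [inner_sub_right, real_inner_self_eq_norm_sq]
    have i5 : ⟪x, z - y⟫ = ⟪x, z⟫ - ⟪x, y⟫ := inner_sub_right _ _ _
    have t : D * (τ ^ 2 * ‖δ‖ ^ 2) ≤ τ / 2 * ‖δ‖ ^ 2 := by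
      have h1 : 0 ≤ τ * ‖δ‖ ^ 2 := by positivity
      nlinarith
    have s : 0 ≤ gam * ‖z - y‖ ^ 2 := by positivity
    rw [n1] at u
    rw [n3] at s
    rw [n2] at l
    rw [i3]
    rw [i4, i5] at i1
    rw [i2] at l
    nlinarith
  have h1 := key x y hx hy _ rfl
  have h2 := key y x hy hx _ rfl
  set δ := (g y - (2 * gam) • y) - (g x - (2 * gam) • x) with hδ
  have h3 : (g x - (2 * gam) • x) - (g y - (2 * gam) • y) = -δ := by rw [hδ]; abel
  rw [h3, norm_neg] at h2
  have h4 : ⟪δ, y - x⟫ = -⟪g y - (2 * gam) • y, x - y⟫ - ⟪g x - (2 * gam) • x, y - x⟫ := by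
    rw [hδ, inner_sub_left, ← neg_sub x y, inner_neg_right, inner_neg_right]
  linarith

/-- With `δ` the increment of the gradient of `φ - γ‖·‖²`, the step difference is `(1 - 2ηγ)(y - x)
- ηδ`. In the expanded square, cocoercivity lets the cross term absorb `η²‖δ‖²`; `ηγ ≤ 1/4` makes
its coefficient at least `η`. No restriction of the form `η ≲ γ` is needed. -/
theorem GradData.norm_step_le {φ : E → ℝ} {g : E → E} {ρ gam D τ η : ℝ} (h : GradData φ g ρ gam D)
    (hgam : 0 ≤ gam) (hgam1 : gam ≤ 1) (hτ : 0 < τ) (hτD : 2 * D * τ ≤ 1)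
    (hτ1 : τ * (2 * D + 4 * gam * ρ) ≤ 1) (hη : 0 < η) (hητ : η ≤ τ) (hη1 : η ≤ 1 / 4)
    {x y : E} (hx : ‖x‖ ≤ ρ) (hy : ‖y‖ ≤ ρ) :
    ‖(y - η • g y) - (x - η • g x)‖ ≤ (1 - 2 * η * gam) * ‖y - x‖ := by
  have hc := h.cocoercive hgam hτ hτD hτ1 hx hy
  set δ := (g y - (2 * gam) • y) - (g x - (2 * gam) • x) with hδ
  have hg : 0 ≤ η * gam := by positivity
  have hg1 : η * gam ≤ 1 / 4 := by nlinarith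
  have e : (y - η • g y) - (x - η • g x) = (1 - 2 * η * gam) • (y - x) - η • δ := by
    rw [hδ]; module
  refine abs_le_of_sq_le_sq' ?_ (mul_nonneg (by linarith) (norm_nonneg _)) |>.2
  rw [e, norm_sub_sq_real, norm_smul, norm_smul, inner_smul_left, inner_smul_right, mul_pow,
    mul_pow, Real.norm_eq_abs, Real.norm_eq_abs, sq_abs, sq_abs, mul_pow, real_inner_comm]
  simp only [conj_trivial]
  have h1 : η * (τ * ‖δ‖ ^ 2) ≤ η * ⟪δ, y - x⟫ := by gcongr
  have h2 : η * (η * ‖δ‖ ^ 2) ≤ η * (τ * ‖δ‖ ^ 2) := by gcongr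
  have h0 : 0 ≤ η * ⟪δ, y - x⟫ := le_trans (by positivity) h1
  have h3 : η * ⟪δ, y - x⟫ ≤ 2 * (1 - 2 * η * gam) * (η * ⟪δ, y - x⟫) :=
    le_mul_of_one_le_left h0 (by linarith)
  linarith

/-- Convergence of the gradient projection method for strongly convex functions. -/
theorem GradData.exists_minimizer [CompleteSpace E] {φ : E → ℝ} {g : E → E} {ρ gam D τ η : ℝ}
    (h : GradData φ g ρ gam D) (hρ : 0 ≤ ρ)
    (hgam : 0 < gam) (hgam1 : gam ≤ 1) (hτ : 0 < τ) (hτD : 2 * D * τ ≤ 1)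
    (hτ1 : τ * (2 * D + 4 * gam * ρ) ≤ 1) (hη : 0 < η) (hητ : η ≤ τ) (hη1 : η ≤ 1 / 4) :
    ∃ w ∈ Metric.closedBall (0 : E) ρ,
      (∀ y ∈ Metric.closedBall (0 : E) ρ, y ≠ w → φ w < φ y) ∧
      ∀ s : ℕ → E, s 0 ∈ Metric.ball (0 : E) ρ →
        (∀ n, s (n + 1) = ballProj ρ (s n - η • g (s n))) →
        Tendsto s atTop (𝓝 w) ∧ ∀ n, ‖w - s n‖ ≤ (1 - 2 * η * gam) ^ n * ‖w - s 0‖ := by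
  set f : E → E := fun x => ballProj ρ (x - η • g x) with hf
  set θ := 1 - 2 * η * gam with hθ
  have hg0 : 0 < η * gam := by positivity
  have hg1 : η * gam ≤ 1 / 4 := by nlinarith
  have hθ0 : 0 ≤ θ := by linarith
  have hθ1 : θ < 1 := by linarith
  have hfn : ∀ x, ‖f x‖ ≤ ρ := fun x => norm_ballProj_le hρ _
  have hlip : ∀ x y, ‖x‖ ≤ ρ → ‖y‖ ≤ ρ → ‖f y - f x‖ ≤ θ * ‖y - x‖ := fun x y hx hy =>
    (norm_ballProj_sub_le hρ _ _).trans
      (h.norm_step_le hgam.le hgam1 hτ hτD hτ1 hη hητ hη1 hx hy)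
  have hmaps : MapsTo f (Metric.closedBall (0 : E) ρ) (Metric.closedBall (0 : E) ρ) :=
    fun x _ => by simpa using hfn x
  have hcon : ContractingWith ⟨θ, hθ0⟩ (hmaps.restrict f _ _) := by
    refine ⟨by exact_mod_cast hθ1, LipschitzWith.of_dist_le_mul fun x y => ?_⟩
    have hx : ‖(x : E)‖ ≤ ρ := mem_closedBall_zero_iff.1 x.2
    have hy : ‖(y : E)‖ ≤ ρ := mem_closedBall_zero_iff.1 y.2
    rw [Subtype.dist_eq, Subtype.dist_eq, dist_eq_norm, dist_eq_norm]
    exact hlip y x hy hx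
  obtain ⟨w, hw, hfw, -⟩ := hcon.exists_fixedPoint' Metric.isClosed_closedBall.isComplete hmaps
    (x := 0) (by simpa using hρ) (edist_ne_top _ _)
  have hwn : ‖w‖ ≤ ρ := by simpa using hw
  have hfw' : f w = w := hfw
  refine ⟨w, hw, fun y hy hne => ?_, fun s h0 hs => ?_⟩
  · have hyn : ‖y‖ ≤ ρ := by simpa using hy
    have h1 := ballProj_inner_le hρ (w - η • g w) hyn
    rw [show ballProj ρ (w - η • g w) = w from hfw', sub_sub_cancel_left, inner_neg_left,
      inner_smul_left] at h1
    simp only [conj_trivial] at h1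
    -- A fixed point of the projected step satisfies the first-order optimality condition, and
    -- strong convexity upgrades it to a strict minimum.
    have h2 : 0 ≤ ⟪g w, y - w⟫ := by
      by_contra! hneg
      have := mul_neg_of_pos_of_neg hη hneg
      linarith
    have h3 := h.lower w y hwn (by linarith)
    have h4 : 0 < gam * ‖y - w‖ ^ 2 := by
      have : 0 < ‖y - w‖ := norm_pos_iff.2 (sub_ne_zero.2 hne)
      positivity
    linarith
  · have hsn : ∀ n, ‖s n‖ ≤ ρ := by
      intro n
      cases n with
      | zero => simpa using (mem_ball_zero_iff.1 h0).le
      | succ n => rw [hs]; exact hfn _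
    have hest : ∀ n, ‖w - s n‖ ≤ θ ^ n * ‖w - s 0‖ := by
      intro n
      induction n with
      | zero => simp
      | succ n ih =>
        rw [hs]
        calc ‖w - f (s n)‖ = ‖f w - f (s n)‖ := by rw [hfw']
          _ ≤ θ * ‖w - s n‖ := hlip _ _ (hsn n) hwn
          _ ≤ θ * (θ ^ n * ‖w - s 0‖) := by gcongr
          _ = _ := by ring
    refine ⟨?_, hest⟩
    rw [tendsto_iff_norm_sub_tendsto_zero]
    have h1 : Tendsto (fun n => θ ^ n * ‖w - s 0‖) atTop (𝓝 (0 * ‖w - s 0‖)) :=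
      (tendsto_pow_atTop_nhds_zero_of_lt_one hθ0 hθ1).mul_const _
    rw [zero_mul] at h1
    refine squeeze_zero (fun n => norm_nonneg _) (fun n => ?_) h1
    rw [norm_sub_rev]
    exact hest n

end Hilbert

/-! ### The operator as a quadratic map into `L²` -/

/-- The derivative `∂^β V_n` as a continuous linear map. -/
def evalL (R : ℝ) {N : ℕ} (n : Fin N) (β : MIdx) : H3N R N →L[ℝ] L2 R :=
  (PiLp.proj 2 (fun _ : MIdx => L2 R) β : Jet R →L[ℝ] L2 R).comp
    ((sobolev R).subtypeL.comp (PiLp.proj 2 (fun _ : Fin N => H3 R) n : H3N R N →L[ℝ] H3 R))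

theorem evalL_apply {N : ℕ} (n : Fin N) (β : MIdx) (V : H3N R N) : evalL R n β V = wd (V n) β := rfl

theorem IsBddCoeff.memLp {b : E3 → ℂ} (hb : IsBddCoeff R b) : MemLp b ⊤ (cubeMeasure R) := by
  obtain ⟨m, K, hK⟩ := hb
  refine memLp_top_of_bound m.aestronglyMeasurable K ?_
  filter_upwards [ae_mem_cube R] with x hx using hK x hx

/-- The product of a bounded function and an `L²` function. -/
def supMul (R : ℝ) : Lp ℂ ⊤ (cubeMeasure R) →L[ℝ] L2 R →L[ℝ] L2 R :=
  (ContinuousLinearMap.mul ℝ ℂ).holderL (cubeMeasure R) ⊤ 2 2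

theorem coeFn_supMul (f : Lp ℂ ⊤ (cubeMeasure R)) (g : L2 R) :
    supMul R f g =ᵐ[cubeMeasure R] fun x => f x * g x :=
  (ContinuousLinearMap.mul ℝ ℂ).coeFn_holder (r := 2) f g

/-- Multiplication by a bounded function. -/
def coeffMul {b : E3 → ℂ} (hb : IsBddCoeff R b) : L2 R →L[ℝ] L2 R := supMul R (hb.memLp.toLp b)

theorem coeFn_coeffMul {b : E3 → ℂ} (hb : IsBddCoeff R b) (g : L2 R) :
    coeffMul hb g =ᵐ[cubeMeasure R] fun x => b x * g x := by
  filter_upwards [coeFn_supMul (hb.memLp.toLp b) g, hb.memLp.coeFn_toLp] with x h1 h2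
  rw [coeffMul, h1, h2]

theorem coeFn_sum {ι : Type*} [Fintype ι] {f : ι → L2 R} {g : ι → E3 → ℂ}
    (h : ∀ i, f i =ᵐ[cubeMeasure R] g i) :
    (∑ i, f i : L2 R) =ᵐ[cubeMeasure R] fun x => ∑ i, g i x := by
  have h0 : ∀ s : Finset ι, (∑ i ∈ s, f i : L2 R) =ᵐ[cubeMeasure R] fun x => ∑ i ∈ s, g i x := by
    classical
    intro s
    induction s using Finset.induction_on with
    | empty =>
      simp only [Finset.sum_empty]
      exact Lp.coeFn_zero _ _ _
    | insert i s hi ih =>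
      simp only [Finset.sum_insert hi]
      filter_upwards [Lp.coeFn_add (f i) (∑ i ∈ s, f i), h i, ih] with x h1 h2 h3
      rw [h1, Pi.add_apply, h2, h3]
  exact h0 _

/-- The first derivatives are continuous maps into `L^∞`. -/
theorem exists_gradSup (hR : 0 < R) (i : Fin 3) : ∃ G : H3 R →L[ℝ] Lp ℂ ⊤ (cubeMeasure R),
    ∀ u, G u =ᵐ[cubeMeasure R] wd u (idx1 i) := by
  obtain ⟨C, hC, h⟩ := exists_ae_norm_grad_le hR
  have hm : ∀ u : H3 R, MemLp (wd u (idx1 i)) ⊤ (cubeMeasure R) := fun u =>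
    memLp_top_of_bound (Lp.aestronglyMeasurable _) _ (h u i)
  let G : H3 R →ₗ[ℝ] Lp ℂ ⊤ (cubeMeasure R) :=
    { toFun := fun u => (hm u).toLp _
      map_add' := fun u v => by
        rw [← MemLp.toLp_add, MemLp.toLp_eq_toLp_iff]
        exact Lp.coeFn_add (wd u (idx1 i)) (wd v (idx1 i))
      map_smul' := fun c u => by
        rw [RingHom.id_apply, ← MemLp.toLp_const_smul, MemLp.toLp_eq_toLp_iff]
        exact Lp.coeFn_smul c (wd u (idx1 i)) }
  refine ⟨G.mkContinuous C fun u => ?_, fun u => (hm u).coeFn_toLp⟩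
  have h1 := Lp.norm_le_of_ae_bound (f := G u) (C := C * ‖u‖) (by positivity) (by
    filter_upwards [(hm u).coeFn_toLp, h u i] with x h1 h2
    change ‖(hm u).toLp _ x‖ ≤ _
    rwa [h1])
  simpa using h1

/-- Continuous functions are bounded coefficients. -/
theorem isBddCoeff_of_continuous {ψ : E3 → ℝ} (h : Continuous ψ) :
    IsBddCoeff R fun x => ((ψ x : ℝ) : ℂ) := by
  obtain ⟨C, hC⟩ := (isCompact_closedCube R).exists_bound_of_continuousOn h.continuousOn
  refine ⟨(Complex.continuous_ofReal.comp h).measurable, C, fun x hx => ?_⟩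
  rw [Complex.norm_real]
  exact hC x (cube_subset_closedCube R hx)

/-- The weighted operator `V ↦ w (ΔV + b · ∇V + c ∇V · ∇V)` as a quadratic map into `L²`. -/
theorem exists_quadratic_operator (hR : 0 < R) {N : ℕ} {b : Fin N → Fin N → Fin 3 → E3 → ℂ}
    (hb : ∀ m n i, IsBddCoeff R (b m n i)) (c : Fin N → Fin N → Fin N → ℝ) {w : E3 → ℝ}
    (hw : Continuous w) (m : Fin N) :
    ∃ (A : H3N R N →L[ℝ] L2 R) (B : H3N R N →L[ℝ] H3N R N →L[ℝ] L2 R),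
      (∀ V, A V =ᵐ[cubeMeasure R] fun x => (w x : ℂ) * quasi b V x m) ∧
      ∀ V V', B V V' =ᵐ[cubeMeasure R] fun x => (w x : ℂ) * gradForm c V V' x m := by
  choose G hG using fun i => exists_gradSup hR i
  have hwb := isBddCoeff_of_continuous (R := R) hw
  refine ⟨(coeffMul hwb).comp (∑ i, evalL R m (idx2 i)
      + ∑ n, ∑ i, (coeffMul (hb m n i)).comp (evalL R n (idx1 i))),
    -- One gradient is taken in `L^∞` and the other in `L²`; this is what makes the quadratic term a
    -- bounded bilinear map into `L²`.
    ∑ n, ∑ l, ∑ i, c m n l • (supMul R).bilinearComp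
      ((G i).comp (PiLp.proj 2 (fun _ : Fin N => H3 R) n : H3N R N →L[ℝ] H3 R))
      ((coeffMul hwb).comp (evalL R l (idx1 i))), fun V => ?_, fun V V' => ?_⟩
  · simp only [ContinuousLinearMap.comp_apply, add_apply, sum_apply]
    have h1 := coeFn_sum (fun i => EventuallyEq.refl (ae (cubeMeasure R)) (evalL R m (idx2 i) V))
    have h2 := coeFn_sum (fun n => coeFn_sum (fun i => coeFn_coeffMul (hb m n i)
      (evalL R n (idx1 i) V)))
    filter_upwards [coeFn_coeffMul hwb (∑ i, evalL R m (idx2 i) V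
        + ∑ n, ∑ i, coeffMul (hb m n i) (evalL R n (idx1 i) V)), Lp.coeFn_add
        (∑ i, evalL R m (idx2 i) V) (∑ n, ∑ i, coeffMul (hb m n i) (evalL R n (idx1 i) V)),
      h1, h2] with x h3 h4 h5 h6
    rw [h3, h4, Pi.add_apply, h5, h6]
    rfl
  · simp only [sum_apply, smul_apply, ContinuousLinearMap.bilinearComp_apply,
      ContinuousLinearMap.comp_apply]
    have h1 : ∀ n l i, (c m n l • supMul R (G i (V n)) (coeffMul hwb (evalL R l (idx1 i) V')) : L2 R)
        =ᵐ[cubeMeasure R] fun x => (w x : ℂ) * ((c m n l : ℂ) *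
          (grad (V n) x i * grad (V' l) x i)) := by
      intro n l i
      filter_upwards [Lp.coeFn_smul (c m n l) (supMul R (G i (V n)) (coeffMul hwb
        (evalL R l (idx1 i) V'))), coeFn_supMul (G i (V n)) (coeffMul hwb (evalL R l (idx1 i) V')),
        coeFn_coeffMul hwb (evalL R l (idx1 i) V'), hG i (V n)] with x e1 e2 e3 e4
      rw [e1, Pi.smul_apply, e2, e3, e4, evalL_apply, Complex.real_smul]
      simp only [grad]
      ring
    filter_upwards [coeFn_sum fun n => coeFn_sum fun l => coeFn_sum fun i => h1 n l i] with x hx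
    simp only [gradForm, Finset.mul_sum]
    exact hx

theorem norm_sq_L2 (f : L2 R) : ‖f‖ ^ 2 = ∫ x in cube R, ‖f x‖ ^ 2 := by
  rw [← real_inner_self_eq_norm_sq, L2.inner_def]
  simp

theorem integrable_norm_sq (f : L2 R) : Integrable (fun x => ‖f x‖ ^ 2) (cubeMeasure R) :=
  (Lp.memLp f).integrable_norm_pow (p := 2) (by norm_num)

/-- The normalizing factor in front of the integral times the Carleman weight is exactly the square
of `wgt`. -/
theorem J_eq {r a d k lam gam : ℝ} {N : ℕ} {b : Fin N → Fin N → Fin 3 → E3 → ℂ}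
    {c : Fin N → Fin N → Fin N → ℝ}
    (hL : ∀ (V : H3N R N), ∀ x ∈ cube R, ∀ m,
        Lop a d k V x m = quasi b V x m + gradForm c V V x m)
    {A : Fin N → H3N R N →L[ℝ] L2 R} {B : Fin N → H3N R N →L[ℝ] H3N R N →L[ℝ] L2 R}
    (hA : ∀ m V, A m V =ᵐ[cubeMeasure R] fun x => (wgt R r lam x : ℂ) * quasi b V x m)
    (hB : ∀ m V V', B m V V' =ᵐ[cubeMeasure R] fun x => (wgt R r lam x : ℂ) * gradForm c V V' x m)
    (V : H3N R N) :
    J r a d k lam gam V = ∑ m, ‖A m V + B m V V‖ ^ 2 + gam * ‖V‖ ^ 2 := by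
  rw [J]
  congr 1
  simp only [norm_sq_L2]
  rw [← integral_const_mul, ← integral_finsetSum _ fun m _ => integrable_norm_sq _]
  refine integral_congr_ae ?_
  have h : ∀ᵐ x ∂cubeMeasure R, ∀ m, (A m V + B m V V : L2 R) x
      = (wgt R r lam x : ℂ) * Lop a d k V x m := by
    refine ae_all_iff.2 fun m => ?_
    filter_upwards [Lp.coeFn_add (A m V) (B m V V), hA m V, hB m V V, ae_mem_cube R]
      with x h1 h2 h3 h4
    rw [h1, Pi.add_apply, h2, h3, hL V x h4, mul_add]
  filter_upwards [h] with x hx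
  simp only [hx, norm_mul, mul_pow, ← Finset.mul_sum, Complex.norm_real, Real.norm_eq_abs, sq_abs]
  have e : wgt R r lam x ^ 2 = Real.exp (-2 * lam * (R + r) ^ 2) * cwf lam r (x 2) := by
    rw [wgt, cwf, ← Real.exp_add, ← Real.exp_nat_mul]
    congr 1
    push_cast
    ring
  rw [e]
  ring

/-! ### The weighted energy of the Laplacian -/

/-- A real linear functional applied to the Laplacian. -/
def lapPart (T : ℂ →L[ℝ] ℝ) (u : H3 R) (x : E3) : ℝ := ∑ i, part T u (idx2 i) x

theorem lapPart_eq (T : ℂ →L[ℝ] ℝ) (u : H3 R) (x : E3) : lapPart T u x = T (lap u x) := by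
  simp [lapPart, part, lap, map_sum]

theorem memLp_lapPart (T : ℂ →L[ℝ] ℝ) (u : H3 R) : MemLp (lapPart T u) 2 (cubeMeasure R) :=
  memLp_finsetSum _ fun i _ => memLp_part T u (idx2 i)

/-- The weighted energy of the Laplacian. -/
def lapEnergy (r lam : ℝ) (T : ℂ →L[ℝ] ℝ) (u : H3 R) : ℝ :=
  ∫ x in cube R, (wgt R r lam x * lapPart T u x) ^ 2

theorem lapEnergy_nonneg (r lam : ℝ) (T : ℂ →L[ℝ] ℝ) (u : H3 R) : 0 ≤ lapEnergy r lam T u :=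
  integral_nonneg fun _ => sq_nonneg _

theorem norm_wd_le (u : H3 R) (β : MIdx) : ‖wd u β‖ ≤ ‖u‖ := PiLp.norm_apply_le (u.1) β

theorem integral_part_mul_self_le {T : ℂ →L[ℝ] ℝ} (hT : ‖T‖ ≤ 1) (u : H3 R) (β : MIdx) :
    ∫ x in cube R, part T u β x * part T u β x ≤ ‖u‖ ^ 2 := by
  have h1 : ‖wd u β‖ ^ 2 ≤ ‖u‖ ^ 2 := by
    have := norm_wd_le u β
    gcongr
  refine le_trans ?_ h1
  rw [norm_sq_L2]
  refine integral_mono (integrable_mul_L2 (memLp_part T u β) (memLp_part T u β))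
    (integrable_norm_sq _) fun x => ?_
  have h2 : |part T u β x| ≤ ‖wd u β x‖ :=
    (T.le_opNorm _).trans (mul_le_of_le_one_left (norm_nonneg _) hT)
  calc part T u β x * part T u β x = |part T u β x| ^ 2 := by rw [sq_abs, sq]
    _ ≤ ‖wd u β x‖ ^ 2 := by gcongr

theorem add_add_mul_self_le (a b c : ℝ) :
    (a + b + c) * (a + b + c) ≤ 3 * (a * a) + 3 * (b * b) + 3 * (c * c) := by
  linarith [mul_self_nonneg (a - b), mul_self_nonneg (a - c), mul_self_nonneg (b - c)]

theorem integral_sum_mul_self_le {f : Fin 3 → E3 → ℝ} (hf : ∀ i, MemLp (f i) 2 (cubeMeasure R))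
    {M : ℝ} (h : ∀ i, ∫ x in cube R, f i x * f i x ≤ M) :
    ∫ x in cube R, (∑ i, f i x) * (∑ i, f i x) ≤ 9 * M := by
  have hi := fun i => (integrable_mul_L2 (hf i) (hf i)).const_mul 3
  have hs : MemLp (fun x => ∑ i, f i x) 2 (cubeMeasure R) := memLp_finsetSum _ fun i _ => hf i
  have h1 : ∫ x in cube R, (∑ i, f i x) * (∑ i, f i x)
      ≤ ∫ x in cube R, ∑ i, 3 * (f i x * f i x) := by
    refine integral_mono (integrable_mul_L2 hs hs) (integrable_finsetSum _ fun i _ => hi i)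
      fun x => ?_
    simp only [Fin.sum_univ_three]
    exact add_add_mul_self_le _ _ _
  rw [integral_finsetSum _ fun i _ => hi i] at h1
  simp only [integral_const_mul] at h1
  refine h1.trans ((Finset.sum_le_sum fun i _ => mul_le_mul_of_nonneg_left (h i)
    (by norm_num)).trans_eq ?_)
  simp
  ring

/-- The components of the gradient of `lapPart T u`. -/
def lapPartGrad (T : ℂ →L[ℝ] ℝ) (u : H3 R) (j : Fin 3) (x : E3) : ℝ :=
  ∑ i, part T u (idxTriple i i j) x

theorem memLp_lapPartGrad (T : ℂ →L[ℝ] ℝ) (u : H3 R) (j : Fin 3) :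
    MemLp (lapPartGrad T u j) 2 (cubeMeasure R) :=
  memLp_finsetSum _ fun i _ => memLp_part T u (idxTriple i i j)

theorem weakPD_lapPart (T : ℂ →L[ℝ] ℝ) (u : H3 R) (j : Fin 3) :
    WeakPD R j (lapPart T u) (lapPartGrad T u j) := by
  have h : ∀ i, WeakPD R j (part T u (idx2 i)) (part T u (idxTriple i i j)) := fun i => by
    rw [← idxPair_self]
    exact weakPD_part T u (isSucc_triple i i j)
  have m := memLp_part T u
  have h1 := ((h 0).add (h 1) (m _) (m _) (m _) (m _)).add (h 2) ((m _).add (m _))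
    ((m _).add (m _)) (m _) (m _)
  have e1 : lapPart T u = fun x => part T u (idx2 0) x + part T u (idx2 1) x
      + part T u (idx2 2) x := by
    ext x; rw [lapPart, Fin.sum_univ_three]
  have e2 : lapPartGrad T u j = fun x => part T u (idxTriple 0 0 j) x
      + part T u (idxTriple 1 1 j) x + part T u (idxTriple 2 2 j) x := by
    ext x; rw [lapPartGrad, Fin.sum_univ_three]
  rw [e1, e2]
  exact h1

theorem normOneSq_lapPart_le {T : ℂ →L[ℝ] ℝ} (hT : ‖T‖ ≤ 1) (u : H3 R) :
    normOneSq R (lapPart T u) (lapPartGrad T u) ≤ 36 * ‖u‖ ^ 2 := by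
  have h1 := integral_sum_mul_self_le (fun i => memLp_part T u (idx2 i))
    fun i => integral_part_mul_self_le hT u (idx2 i)
  have h2 := fun j => integral_sum_mul_self_le (fun i => memLp_part T u (idxTriple i i j))
    fun i => integral_part_mul_self_le hT u (idxTriple i i j)
  unfold normOneSq lapPart lapPartGrad
  rw [Fin.sum_univ_three (fun j => ∫ x in cube R, (∑ i, part T u (idxTriple i i j) x) *
    ∑ i, part T u (idxTriple i i j) x)]
  linarith [h2 0, h2 1, h2 2]

/-- The trilinear estimate bounds the square of the integral by the squared `H¹` norm of `w∂_iu`, of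
order `λS`, times its squared `L²` norm, of order `S/λ`. The powers of `λ` cancel, so the bound is
uniform in `λ` but not small; smallness has to come from elsewhere. -/
theorem exists_integral_lap_mul_grad_le {r : ℝ} (hR : 0 < R) (hr : R < r) : ∃ K : ℝ, 0 ≤ K ∧
    ∀ lam : ℝ, 1 ≤ lam → ∀ u : H3 R, ZeroOnBoundary u → ZeroNormalOnBottom u →
    ∀ T : ℂ →L[ℝ] ℝ, ∀ (u' : H3 R) (T' : ℂ →L[ℝ] ℝ), ‖T'‖ ≤ 1 → ∀ i,
    Integrable (fun x => lapPart T' u' x ^ 2 * (wgt R r lam x * part T u (idx1 i) x) ^ 2)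
      (cubeMeasure R) ∧
    ∫ x in cube R, lapPart T' u' x ^ 2 * (wgt R r lam x * part T u (idx1 i) x) ^ 2
      ≤ K * ‖u'‖ ^ 2 * lapEnergy r lam T u := by
  obtain ⟨K, hK, hcar⟩ := exists_carleman hR hr
  obtain ⟨L, hL, hmul⟩ := exists_integral_sq_mul_sq_le hR
  refine ⟨72 * √L * K, by positivity, fun lam hlam u hu hb T u' T' hT' i => ?_⟩
  obtain ⟨hS, -, h1, h2, -⟩ := hcar lam hlam u hu hb T
  obtain ⟨i1, i2⟩ := hmul (lapPart T' u') (lapPartGrad T' u')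
    (fun x => wgt R r lam x * part T u (idx1 i) x) (wgtGrad r lam T u i) (memLp_lapPart _ _)
    (memLp_lapPartGrad _ _) (weakPD_lapPart _ _) (memLp_wgt_mul r lam (memLp_part _ _ _))
    (memLp_wgtGrad r lam T u i) (weakPD_wgtGrad r lam T u i)
  refine ⟨i1, ?_⟩
  change 0 ≤ lapEnergy r lam T u at hS
  change ∀ i, lam * _ ≤ K * lapEnergy r lam T u at h1
  change ∀ i j, _ ≤ K * lam * lapEnergy r lam T u at h2
  set S := lapEnergy r lam T u
  have hn := normOneSq_lapPart_le hT' u'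
  have hn0 := normOneSq_nonneg R (lapPart T' u') (lapPartGrad T' u')
  set n := normOneSq R (lapPart T' u') (lapPartGrad T' u')
  have hl : 0 < lam := by linarith
  set Q := ∫ x in cube R, (wgt R r lam x * part T u (idx1 i) x) *
    (wgt R r lam x * part T u (idx1 i) x) with hQ
  have hQ0 : 0 ≤ Q := integral_nonneg fun _ => mul_self_nonneg _
  have hK0 : 0 ≤ K := by linarith
  have hKS : 0 ≤ K * S := by positivity
  have hQ1 : Q ≤ K * lam * S := by
    have h3 : lam * Q ≤ K * S := h1 i
    have h4 : Q ≤ lam * Q := le_mul_of_one_le_left hQ0 hlam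
    have h5 : K * S ≤ lam * (K * S) := le_mul_of_one_le_left hKS hlam
    linarith
  have hm0 := normOneSq_nonneg R (fun x => wgt R r lam x * part T u (idx1 i) x)
    (wgtGrad r lam T u i)
  have hm : normOneSq R (fun x => wgt R r lam x * part T u (idx1 i) x) (wgtGrad r lam T u i)
      ≤ 4 * (K * lam * S) := by
    unfold normOneSq
    rw [Fin.sum_univ_three]
    linarith [h2 i 0, h2 i 1, h2 i 2]
  refine abs_le_of_sq_le_sq' (i2.trans ?_) (by positivity) |>.2
  calc L * n ^ 2 * normOneSq R (fun x => wgt R r lam x * part T u (idx1 i) x)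
        (wgtGrad r lam T u i) * Q
      ≤ L * (36 * ‖u'‖ ^ 2) ^ 2 * (4 * (K * lam * S)) * Q := by gcongr
    _ = L * (36 * ‖u'‖ ^ 2) ^ 2 * (4 * (K * S)) * (lam * Q) := by ring
    _ ≤ L * (36 * ‖u'‖ ^ 2) ^ 2 * (4 * (K * S)) * (K * S) := by
        have h3 : lam * Q ≤ K * S := h1 i
        gcongr
    _ = (72 * √L * K * ‖u'‖ ^ 2 * S) ^ 2 := by
        linear_combination (-(72 * K * ‖u'‖ ^ 2 * S) ^ 2) * Real.sq_sqrt hL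

open scoped RealInnerProductSpace

/-! ### The second order remainder -/

theorem half_sq_sub_le_norm_add_sq {E : Type*} [NormedAddCommGroup E] (x y : E) :
    1 / 2 * ‖x‖ ^ 2 - ‖y‖ ^ 2 ≤ ‖x + y‖ ^ 2 := by
  have h1 : ‖x‖ ≤ ‖x + y‖ + ‖y‖ := by simpa using norm_sub_le (x + y) y
  have h2 : ‖x‖ ^ 2 ≤ (‖x + y‖ + ‖y‖) ^ 2 := by gcongr
  linarith [sq_nonneg (‖x + y‖ - ‖y‖)]

/-- Pointwise lower bound for the second order remainder of `|L(V)|²`. -/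
theorem remainder_pointwise {D e D' f Z : ℂ} {g K₁ K₂ K₃ κ : ℝ} (w : ℝ) (hκ : 0 < κ)
    (he : ‖e‖ ≤ K₁ * g) (hf : ‖f‖ ≤ K₂) (hZ : ‖Z‖ ≤ K₃ * g ^ 2) :
    1 / 2 * (w ^ 2 * ‖D‖ ^ 2) - (K₁ ^ 2 + 2 * K₂ * K₃ + κ * K₃ ^ 2) * (w ^ 2 * g ^ 2)
        - 1 / κ * (w ^ 2 * g ^ 2 * ‖D'‖ ^ 2)
      ≤ ‖(w : ℂ) * (D + e)‖ ^ 2 + 2 * ⟪(w : ℂ) * (D' + f), (w : ℂ) * Z⟫ := by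
  have e1 : ⟪(w : ℂ) * (D' + f), (w : ℂ) * Z⟫ = w ^ 2 * ⟪D' + f, Z⟫ := by
    rw [← Complex.real_smul, ← Complex.real_smul, real_inner_smul_left, real_inner_smul_right]
    ring
  have e2 : ‖(w : ℂ) * (D + e)‖ ^ 2 = w ^ 2 * ‖D + e‖ ^ 2 := by
    rw [norm_mul, mul_pow, Complex.norm_real, Real.norm_eq_abs, sq_abs]
  rw [e1, e2]
  have h1 := half_sq_sub_le_norm_add_sq D e
  have h2 : ‖e‖ ^ 2 ≤ (K₁ * g) ^ 2 := by gcongr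
  have hp : ‖D' + f‖ ≤ ‖D'‖ + K₂ := (norm_add_le _ _).trans (by gcongr)
  have h3 : -((‖D'‖ + K₂) * (K₃ * g ^ 2)) ≤ ⟪D' + f, Z⟫ := by
    refine (abs_le.1 ((abs_real_inner_le_norm _ _).trans ?_)).1
    exact mul_le_mul hp hZ (norm_nonneg _) ((norm_nonneg _).trans hp)
  -- Only `D'`, the Laplacian of the base point, is not bounded pointwise. Young's inequality
  -- isolates its square with the small factor `1/κ`.
  have h4 : 2 * (‖D'‖ * K₃) ≤ κ * K₃ ^ 2 + 1 / κ * ‖D'‖ ^ 2 := by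
    have : κ * K₃ ^ 2 + 1 / κ * ‖D'‖ ^ 2 - 2 * (‖D'‖ * K₃) = 1 / κ * (κ * K₃ - ‖D'‖) ^ 2 := by
      field_simp
      ring
    have h5 : 0 ≤ 1 / κ * (κ * K₃ - ‖D'‖) ^ 2 := by positivity
    linarith
  have h6 := mul_le_mul_of_nonneg_right h4 (sq_nonneg g)
  have h7 : 1 / 2 * ‖D‖ ^ 2 - (K₁ ^ 2 + 2 * K₂ * K₃ + κ * K₃ ^ 2) * g ^ 2
      - 1 / κ * (g ^ 2 * ‖D'‖ ^ 2) ≤ ‖D + e‖ ^ 2 + 2 * ⟪D' + f, Z⟫ := by linarith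
  have h8 := mul_le_mul_of_nonneg_left h7 (sq_nonneg w)
  linarith

variable {N : ℕ}

/-- The sum of the absolute values of all first derivatives. -/
def gradSum (V : H3N R N) (x : E3) : ℝ := ∑ q : Fin N × Fin 3, ‖grad (V q.1) x q.2‖

theorem gradSum_nonneg (V : H3N R N) (x : E3) : 0 ≤ gradSum V x :=
  Finset.sum_nonneg fun _ _ => norm_nonneg _

/-- A bound for all coefficients of the quadratic terms. -/
def coeffBound (c : Fin N → Fin N → Fin N → ℝ) : ℝ := ∑ m, ∑ n, ∑ l, |c m n l|

theorem coeffBound_nonneg (c : Fin N → Fin N → Fin N → ℝ) : 0 ≤ coeffBound c :=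
  Finset.sum_nonneg fun _ _ => Finset.sum_nonneg fun _ _ => Finset.sum_nonneg fun _ _ =>
    abs_nonneg _

theorem abs_le_coeffBound (c : Fin N → Fin N → Fin N → ℝ) (m n l : Fin N) :
    |c m n l| ≤ coeffBound c := by
  refine le_trans ?_ (Finset.single_le_sum (f := fun m => ∑ n, ∑ l, |c m n l|)
    (fun _ _ => Finset.sum_nonneg fun _ _ => Finset.sum_nonneg fun _ _ => abs_nonneg _)
    (Finset.mem_univ m))
  refine le_trans ?_ (Finset.single_le_sum (f := fun n => ∑ l, |c m n l|)
    (fun _ _ => Finset.sum_nonneg fun _ _ => abs_nonneg _) (Finset.mem_univ n))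
  exact Finset.single_le_sum (f := fun l => |c m n l|) (fun _ _ => abs_nonneg _) (Finset.mem_univ l)

theorem norm_gradForm_le (c : Fin N → Fin N → Fin N → ℝ) (V V' : H3N R N) (x : E3) (m : Fin N) :
    ‖gradForm c V V' x m‖ ≤ coeffBound c * (gradSum V x * gradSum V' x) := by
  have h1 : ‖gradForm c V V' x m‖ ≤ ∑ n, ∑ l, ∑ i,
      coeffBound c * (‖grad (V n) x i‖ * ‖grad (V' l) x i‖) := by
    unfold gradForm
    refine (norm_sum_le _ _).trans (Finset.sum_le_sum fun n _ => ?_)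
    refine (norm_sum_le _ _).trans (Finset.sum_le_sum fun l _ => ?_)
    refine (norm_sum_le _ _).trans (Finset.sum_le_sum fun i _ => ?_)
    rw [norm_mul, norm_mul, Complex.norm_real, Real.norm_eq_abs]
    have := abs_le_coeffBound c m n l
    gcongr
  refine h1.trans ?_
  have h2 : ∀ l i, ‖grad (V' l) x i‖ ≤ ∑ j, ‖grad (V' l) x j‖ := fun l i =>
    Finset.single_le_sum (f := fun j => ‖grad (V' l) x j‖) (fun _ _ => norm_nonneg _)
      (Finset.mem_univ i)
  have h3 : ∑ n, ∑ l, ∑ i, coeffBound c * (‖grad (V n) x i‖ * ‖grad (V' l) x i‖)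
      ≤ ∑ n, ∑ l, ∑ i, coeffBound c * (‖grad (V n) x i‖ * ∑ j, ‖grad (V' l) x j‖) := by
    have := coeffBound_nonneg c
    gcongr with n _ l _ i _
    exact h2 l i
  refine h3.trans (le_of_eq ?_)
  unfold gradSum
  rw [Fintype.sum_prod_type, Fintype.sum_prod_type]
  simp only [← Finset.mul_sum, ← Finset.sum_mul]

theorem norm_linear_le {b : Fin N → Fin N → Fin 3 → E3 → ℂ} {K : ℝ} {x : E3}
    (hb : ∀ m n i, ‖b m n i x‖ ≤ K) (V : H3N R N) (m : Fin N) :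
    ‖∑ n, ∑ i, b m n i x * grad (V n) x i‖ ≤ K * gradSum V x := by
  unfold gradSum
  rw [Fintype.sum_prod_type]
  simp only [Finset.mul_sum]
  refine (norm_sum_le _ _).trans (Finset.sum_le_sum fun n _ => ?_)
  refine (norm_sum_le _ _).trans (Finset.sum_le_sum fun i _ => ?_)
  rw [norm_mul]
  exact mul_le_mul_of_nonneg_right (hb m n i) (norm_nonneg _)

/-- The real and the imaginary part. -/
def reIm : Fin 2 → (ℂ →L[ℝ] ℝ) := ![Complex.reCLM, Complex.imCLM]

theorem norm_reIm_le (τ : Fin 2) : ‖reIm τ‖ ≤ 1 := by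
  fin_cases τ
  · exact norm_reCLM_le
  · exact norm_imCLM_le

theorem norm_sq_eq_sum_reIm (z : ℂ) : ‖z‖ ^ 2 = ∑ τ, reIm τ z ^ 2 := by
  rw [Fin.sum_univ_two, ← Complex.normSq_eq_norm_sq, Complex.normSq_apply]
  simp [reIm]
  ring

/-- The real and imaginary parts of all first derivatives of `h`, multiplied by the weight. -/
def wgtPart (r lam : ℝ) (h : H3N R N) (p : Fin N × Fin 3 × Fin 2) (x : E3) : ℝ :=
  wgt R r lam x * part (reIm p.2.2) (h p.1) (idx1 p.2.1) x

theorem wgt_sq_mul_gradSum_sq_le (r lam : ℝ) (h : H3N R N) (x : E3) :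
    wgt R r lam x ^ 2 * gradSum h x ^ 2 ≤ 3 * N * ∑ p, wgtPart r lam h p x ^ 2 := by
  have h1 : gradSum h x ^ 2 ≤ 3 * N * ∑ q : Fin N × Fin 3, ‖grad (h q.1) x q.2‖ ^ 2 := by
    refine (sq_sum_le_card_mul_sum_sq (s := Finset.univ)
      (f := fun q : Fin N × Fin 3 => ‖grad (h q.1) x q.2‖)).trans (le_of_eq ?_)
    rw [Finset.card_univ, Fintype.card_prod, Fintype.card_fin, Fintype.card_fin]
    push_cast
    ring
  have h2 := mul_le_mul_of_nonneg_left h1 (sq_nonneg (wgt R r lam x))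
  refine h2.trans (le_of_eq ?_)
  simp only [wgtPart, mul_pow, norm_sq_eq_sum_reIm, ← Finset.mul_sum, Fintype.sum_prod_type]
  simp only [part, grad]
  ring

theorem exists_gradSum_le (hR : 0 < R) (N : ℕ) : ∃ C : ℝ, 0 ≤ C ∧ ∀ V : H3N R N,
    ∀ᵐ x ∂cubeMeasure R, gradSum V x ≤ C * ‖V‖ := by
  obtain ⟨C, hC, h⟩ := exists_ae_norm_grad_le hR
  refine ⟨Fintype.card (Fin N × Fin 3) * C, by positivity, fun V => ?_⟩
  filter_upwards [ae_all_iff.2 fun q : Fin N × Fin 3 => h (V q.1) q.2] with x hx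
  have h1 : gradSum V x ≤ ∑ _q : Fin N × Fin 3, C * ‖V‖ := by
    refine Finset.sum_le_sum fun q _ => (hx q).trans ?_
    have := PiLp.norm_apply_le V q.1
    gcongr
  refine h1.trans (le_of_eq ?_)
  rw [Finset.sum_const, Finset.card_univ, nsmul_eq_mul, mul_assoc]

theorem exists_coeff_le {b : Fin N → Fin N → Fin 3 → E3 → ℂ}
    (hb : ∀ m n i, IsBddCoeff R (b m n i)) :
    ∃ K : ℝ, 0 ≤ K ∧ ∀ x ∈ cube R, ∀ m n i, ‖b m n i x‖ ≤ K := by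
  choose K hK using fun q : Fin N × Fin N × Fin 3 => (hb q.1 q.2.1 q.2.2).2
  refine ⟨∑ q, |K q|, Finset.sum_nonneg fun _ _ => abs_nonneg _, fun x hx m n i => ?_⟩
  refine (hK (m, n, i) x hx).trans ((le_abs_self _).trans ?_)
  exact Finset.single_le_sum (f := fun q => |K q|) (fun _ _ => abs_nonneg _) (Finset.mem_univ _)

/-- `A` and `B` are the linear and the bilinear part of `V ↦ w L(V)`. -/
structure Represents (w : E3 → ℝ) (b : Fin N → Fin N → Fin 3 → E3 → ℂ)
    (c : Fin N → Fin N → Fin N → ℝ) (A : Fin N → H3N R N →L[ℝ] L2 R)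
    (B : Fin N → H3N R N →L[ℝ] H3N R N →L[ℝ] L2 R) : Prop where
  linear : ∀ m V, A m V =ᵐ[cubeMeasure R] fun x => (w x : ℂ) * quasi b V x m
  bilinear : ∀ m V V', B m V V' =ᵐ[cubeMeasure R] fun x => (w x : ℂ) * gradForm c V V' x m

/-- The pointwise inequality is used with the Laplacians as principal parts and the rest as
perturbation. The coefficient `4` collects the two mixed forms of `V` and `h` and the form of `h`
with itself, whose gradient is bounded by `2CM`. -/
theorem Represents.remainder_ae {w : E3 → ℝ} {b : Fin N → Fin N → Fin 3 → E3 → ℂ}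
    {c : Fin N → Fin N → Fin N → ℝ} {A : Fin N → H3N R N →L[ℝ] L2 R}
    {B : Fin N → H3N R N →L[ℝ] H3N R N →L[ℝ] L2 R} (hAB : Represents w b c A B)
    {K C M κ : ℝ} (hK : 0 ≤ K) (hb : ∀ x ∈ cube R, ∀ m n i, ‖b m n i x‖ ≤ K) (hC : 0 ≤ C)
    (hg : ∀ V : H3N R N, ∀ᵐ x ∂cubeMeasure R, gradSum V x ≤ C * ‖V‖) (hκ : 0 < κ)
    {V h : H3N R N} (hV : ‖V‖ ≤ M) (hh : ‖h‖ ≤ 2 * M) (m : Fin N) :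
    ∀ᵐ x ∂cubeMeasure R,
      1 / 2 * (w x ^ 2 * ‖lap (h m) x‖ ^ 2)
        - ((K + 4 * coeffBound c * (C * M)) ^ 2
          + 2 * (K * (C * M) + coeffBound c * (C * M) ^ 2) * coeffBound c
          + κ * coeffBound c ^ 2) * (w x ^ 2 * gradSum h x ^ 2)
        - 1 / κ * (w x ^ 2 * gradSum h x ^ 2 * ‖lap (V m) x‖ ^ 2)
      ≤ ‖(quadDeriv (A m) (B m) V h + B m h h : L2 R) x‖ ^ 2
        + 2 * ⟪(A m V + B m V V : L2 R) x, (B m h h : L2 R) x⟫ := by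
  unfold quadDeriv
  filter_upwards [hAB.linear m V, hAB.linear m h, hAB.bilinear m V V, hAB.bilinear m V h,
    hAB.bilinear m h V, hAB.bilinear m h h, Lp.coeFn_add (A m V) (B m V V),
    Lp.coeFn_add (A m h + (B m V h + B m h V)) (B m h h),
    Lp.coeFn_add (A m h) (B m V h + B m h V), Lp.coeFn_add (B m V h) (B m h V),
    hg V, hg h, ae_mem_cube R] with x a1 a2 a3 a4 a5 a6 a7 a8 a9 a10 gV gh hx
  have k0 := coeffBound_nonneg c
  have s0 := gradSum_nonneg V x
  have t0 := gradSum_nonneg h x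
  have gV' : gradSum V x ≤ C * M := gV.trans (by gcongr)
  have gh' : gradSum h x ≤ 2 * (C * M) := gh.trans (by
    have : C * ‖h‖ ≤ C * (2 * M) := by gcongr
    linarith)
  have l1 := norm_linear_le (hb x hx) h m
  have l2 := norm_linear_le (hb x hx) V m
  have f1 := norm_gradForm_le c V V x m
  have f2 := norm_gradForm_le c V h x m
  have f3 := norm_gradForm_le c h V x m
  have f4 := norm_gradForm_le c h h x m
  set k := coeffBound c
  set G := C * M
  have hG : 0 ≤ G := s0.trans gV'
  have e1 : (A m h + (B m V h + B m h V) + B m h h : L2 R) x = (w x : ℂ) * (lap (h m) x +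
      ((∑ n, ∑ i, b m n i x * grad (h n) x i) + (gradForm c V h x m + gradForm c h V x m)
        + gradForm c h h x m)) := by
    rw [a8, Pi.add_apply, a9, Pi.add_apply, a10, Pi.add_apply, a2, a4, a5, a6, quasi]
    ring
  have e2 : (A m V + B m V V : L2 R) x = (w x : ℂ) * (lap (V m) x +
      ((∑ n, ∑ i, b m n i x * grad (V n) x i) + gradForm c V V x m)) := by
    rw [a7, Pi.add_apply, a1, a3, quasi]
    ring
  rw [e1, e2, a6]
  refine remainder_pointwise (w x) hκ ?_ ?_ (f4.trans (le_of_eq (by ring)))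
  · refine (norm_add_le _ _).trans ?_
    have n1 := norm_add_le (∑ n, ∑ i, b m n i x * grad (h n) x i)
      (gradForm c V h x m + gradForm c h V x m)
    have n2 := norm_add_le (gradForm c V h x m) (gradForm c h V x m)
    have m1 : k * (gradSum V x * gradSum h x) ≤ k * (G * gradSum h x) := by gcongr
    have m2 : k * (gradSum h x * gradSum h x) ≤ k * (2 * G * gradSum h x) := by gcongr
    linarith
  · refine (norm_add_le _ _).trans ?_
    have m1 : K * gradSum V x ≤ K * G := by gcongr
    have m2 : k * (gradSum V x * gradSum V x) ≤ k * (G * G) := by gcongr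
    linarith

/-! ### Strict convexity -/

/-- The weighted energy of the Laplacian of a vector valued function. -/
def energy (r lam : ℝ) (h : H3N R N) : ℝ :=
  ∑ m, ∑ τ, lapEnergy r lam (reIm τ) (h m)

theorem lapEnergy_le_energy (r lam : ℝ) (h : H3N R N) (m : Fin N) (τ : Fin 2) :
    lapEnergy r lam (reIm τ) (h m) ≤ energy r lam h := by
  refine le_trans ?_ (Finset.single_le_sum (f := fun m => ∑ τ, lapEnergy r lam (reIm τ) (h m))
    (fun _ _ => Finset.sum_nonneg fun _ _ => lapEnergy_nonneg _ _ _ _) (Finset.mem_univ m))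
  exact Finset.single_le_sum (f := fun τ => lapEnergy r lam (reIm τ) (h m))
    (fun _ _ => lapEnergy_nonneg _ _ _ _) (Finset.mem_univ τ)

theorem energy_nonneg (r lam : ℝ) (h : H3N R N) : 0 ≤ energy r lam h :=
  Finset.sum_nonneg fun _ _ => Finset.sum_nonneg fun _ _ => lapEnergy_nonneg _ _ _ _

theorem norm_lap_sq (u : H3 R) (x : E3) : ‖lap u x‖ ^ 2 = ∑ τ, lapPart (reIm τ) u x ^ 2 := by
  simp only [lapPart_eq, norm_sq_eq_sum_reIm]

theorem memLp_wgtPart (r lam : ℝ) (h : H3N R N) (p : Fin N × Fin 3 × Fin 2) :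
    MemLp (wgtPart r lam h p) 2 (cubeMeasure R) :=
  memLp_wgt_mul r lam (memLp_part _ _ _)

/-- The remainder of the quadratic functional `‖A V + B V V‖²`. -/
def remainder {E F : Type*} [NormedAddCommGroup E] [InnerProductSpace ℝ E]
    [NormedAddCommGroup F] [InnerProductSpace ℝ F] (A : E →L[ℝ] F) (B : E →L[ℝ] E →L[ℝ] F)
    (V h : E) : ℝ :=
  ‖quadDeriv A B V h + B h h‖ ^ 2 + 2 * ⟪A V + B V V, B h h⟫

/-- Strict convexity of the weighted functional, for large parameters of the weight. -/
theorem exists_energy_le_remainder {r : ℝ} (hR : 0 < R) (hr : R < r)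
    {b : Fin N → Fin N → Fin 3 → E3 → ℂ} (hb : ∀ m n i, IsBddCoeff R (b m n i))
    (c : Fin N → Fin N → Fin N → ℝ) (M : ℝ) :
    ∃ Λ : ℝ, 1 ≤ Λ ∧ ∀ lam, Λ ≤ lam → ∀ A B, Represents (wgt R r lam) b c A B →
      ∀ V h : H3N R N, ‖V‖ ≤ M → ‖h‖ ≤ 2 * M → h ∈ H03N R N →
        1 / 4 * energy r lam h ≤ ∑ m, remainder (A m) (B m) V h := by
  obtain ⟨K, hK0, hK⟩ := exists_coeff_le hb
  obtain ⟨C, hC, hg⟩ := exists_gradSum_le hR N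
  obtain ⟨K1, hK1, hcar⟩ := exists_carleman hR hr
  obtain ⟨K2, hK2, hmul⟩ := exists_integral_lap_mul_grad_le hR hr
  have hk := coeffBound_nonneg c
  set k := coeffBound c with hkdef
  -- Chosen so that the terms with `ΔV`, at most `36N³K2M²e/κ` in total, use no more than an eighth
  -- of the energy. It must be fixed before `λ`, because it enters `Q`.
  set κ : ℝ := 288 * N ^ 3 * K2 * M ^ 2 + 1 with hκdef
  have hκ : 0 < κ := by positivity
  set Q : ℝ := (K + 4 * k * (C * M)) ^ 2 + 2 * (K * (C * M) + k * (C * M) ^ 2) * k + κ * k ^ 2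
    with hQ
  -- The terms with bounded coefficients total at most `18N³|Q|K1 e/λ`, so this threshold makes them
  -- at most `e/8`. Of the initial `e/2`, a quarter of the energy remains.
  refine ⟨144 * N ^ 3 * |Q| * K1 + 1, by
    have : 0 ≤ 144 * N ^ 3 * |Q| * K1 := by positivity
    linarith, fun lam hlam A B hAB V h hV hh hmem => ?_⟩
  have hl1 : 1 ≤ lam := by
    have : 0 ≤ 144 * N ^ 3 * |Q| * K1 := by positivity
    linarith
  have hl : 0 < lam := by linarith
  set e := energy r lam h with he
  have he0 : 0 ≤ e := energy_nonneg r lam h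
  have hp : ∀ p, lam * ∫ x in cube R, wgtPart r lam h p x ^ 2 ≤ K1 * e := by
    intro p
    obtain ⟨-, -, h1, -⟩ := hcar lam hl1 (h p.1) (hmem p.1).1 (hmem p.1).2 (reIm p.2.2)
    refine le_trans (le_of_eq ?_) ((h1 p.2.1).trans (mul_le_mul_of_nonneg_left
      (lapEnergy_le_energy r lam h p.1 p.2.2) (by linarith)))
    simp only [wgtPart, sq]
  have hq := fun (m : Fin N) (p : Fin N × Fin 3 × Fin 2) (τ : Fin 2) =>
    hmul lam hl1 (h p.1) (hmem p.1).1 (hmem p.1).2 (reIm p.2.2) (V m) (reIm τ) (norm_reIm_le τ)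
      p.2.1
  have hq2 : ∀ m p τ, ∫ x in cube R, lapPart (reIm τ) (V m) x ^ 2 * wgtPart r lam h p x ^ 2
      ≤ K2 * M ^ 2 * e := by
    intro m p τ
    refine (hq m p τ).2.trans ?_
    have h1 : ‖V m‖ ≤ M := (PiLp.norm_apply_le V m).trans hV
    have h2 := lapEnergy_le_energy r lam h p.1 p.2.2
    have h3 := lapEnergy_nonneg (R := R) r lam (reIm p.2.2) (h p.1)
    gcongr
  have ip : ∀ p, Integrable (fun x => wgtPart r lam h p x ^ 2) (cubeMeasure R) := fun p =>
    (memLp_wgtPart r lam h p).integrable_sq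
  have il : ∀ m τ, Integrable (fun x => (wgt R r lam x * lapPart (reIm τ) (h m) x) ^ 2)
      (cubeMeasure R) := fun m τ => (memLp_wgt_mul r lam (memLp_lapPart _ _)).integrable_sq
  have key : ∀ m, 1 / 2 * ∑ τ, lapEnergy r lam (reIm τ) (h m)
      - |Q| * (3 * N) * (∑ p, ∫ x in cube R, wgtPart r lam h p x ^ 2)
      - 1 / κ * (3 * N) * (∑ q : (Fin N × Fin 3 × Fin 2) × Fin 2, ∫ x in cube R,
          lapPart (reIm q.2) (V m) x ^ 2 * wgtPart r lam h q.1 x ^ 2)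
      ≤ remainder (A m) (B m) V h := by
    intro m
    have i1 := (integrable_finsetSum Finset.univ fun τ _ => il m τ).const_mul (1 / 2)
    have i2 := (integrable_finsetSum Finset.univ fun p _ => ip p).const_mul (|Q| * (3 * N))
    have i3 := (integrable_finsetSum Finset.univ fun (q : (Fin N × Fin 3 × Fin 2) × Fin 2) _ =>
      (hq m q.1 q.2).1).const_mul (1 / κ * (3 * N))
    have j1 := integrable_norm_sq (quadDeriv (A m) (B m) V h + B m h h)
    have j2 := (L2.integrable_inner (𝕜 := ℝ) (A m V + B m V V) (B m h h)).const_mul 2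
    have hint := integral_mono_ae ((i1.sub i2).sub i3) (j1.add j2) (by
      filter_upwards [hAB.remainder_ae hK0 hK hC hg hκ hV hh m] with x hx
      refine le_trans ?_ hx
      simp only [Pi.sub_apply]
      have w1 := wgt_sq_mul_gradSum_sq_le r lam h x
      have w0 : 0 ≤ wgt R r lam x ^ 2 * gradSum h x ^ 2 := by positivity
      have w2 : Q * (wgt R r lam x ^ 2 * gradSum h x ^ 2)
          ≤ |Q| * (3 * N) * ∑ p, wgtPart r lam h p x ^ 2 := by
        have := mul_le_mul_of_nonneg_left w1 (abs_nonneg Q)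
        have := mul_le_mul_of_nonneg_right (le_abs_self Q) w0
        linarith
      have w3 : 1 / κ * (wgt R r lam x ^ 2 * gradSum h x ^ 2 * ‖lap (V m) x‖ ^ 2)
          ≤ 1 / κ * (3 * N) * ∑ q : (Fin N × Fin 3 × Fin 2) × Fin 2,
            lapPart (reIm q.2) (V m) x ^ 2 * wgtPart r lam h q.1 x ^ 2 := by
        have e1 : ∑ q : (Fin N × Fin 3 × Fin 2) × Fin 2,
            lapPart (reIm q.2) (V m) x ^ 2 * wgtPart r lam h q.1 x ^ 2
            = (∑ p, wgtPart r lam h p x ^ 2) * ‖lap (V m) x‖ ^ 2 := by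
          rw [Fintype.sum_prod_type, norm_lap_sq, Finset.sum_mul_sum]
          simp only [mul_comm]
        rw [e1]
        have h1 := mul_le_mul_of_nonneg_left (mul_le_mul_of_nonneg_right w1
          (sq_nonneg ‖lap (V m) x‖)) (show 0 ≤ 1 / κ by positivity)
        linarith
      have w4 : wgt R r lam x ^ 2 * ‖lap (h m) x‖ ^ 2
          = ∑ τ, (wgt R r lam x * lapPart (reIm τ) (h m) x) ^ 2 := by
        rw [norm_lap_sq, Finset.mul_sum]
        simp only [mul_pow]
      rw [w4]
      exact sub_le_sub (sub_le_sub le_rfl w2) w3)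
    have e1 := integral_sub (i1.sub i2) i3
    have e2 := integral_sub i1 i2
    have e3 := integral_add j1 j2
    simp only [Pi.sub_apply, Pi.add_apply] at e1 e2 e3 hint
    rw [e1, e2, e3, integral_const_mul, integral_const_mul, integral_const_mul,
      integral_const_mul, integral_finsetSum _ fun τ _ => il m τ,
      integral_finsetSum _ fun p _ => ip p,
      integral_finsetSum _ fun (q : (Fin N × Fin 3 × Fin 2) × Fin 2) _ =>
        (hq m q.1 q.2).1] at hint
    rw [remainder, norm_sq_L2, L2.inner_def]
    exact hint
  have s1 : lam * ∑ p, ∫ x in cube R, wgtPart r lam h p x ^ 2 ≤ 6 * N * (K1 * e) := by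
    rw [Finset.mul_sum]
    refine (Finset.sum_le_sum fun p _ => hp p).trans (le_of_eq ?_)
    rw [Finset.sum_const, Finset.card_univ, nsmul_eq_mul]
    simp only [Fintype.card_prod, Fintype.card_fin]
    push_cast
    ring
  have s2 : ∀ m, ∑ q : (Fin N × Fin 3 × Fin 2) × Fin 2, ∫ x in cube R,
      lapPart (reIm q.2) (V m) x ^ 2 * wgtPart r lam h q.1 x ^ 2 ≤ 12 * N * (K2 * M ^ 2 * e) := by
    intro m
    refine (Finset.sum_le_sum fun q _ => hq2 m q.1 q.2).trans (le_of_eq ?_)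
    rw [Finset.sum_const, Finset.card_univ, nsmul_eq_mul]
    simp only [Fintype.card_prod, Fintype.card_fin]
    push_cast
    ring
  set s := ∑ p, ∫ x in cube R, wgtPart r lam h p x ^ 2 with hs
  have key2 : ∀ m, 1 / 2 * ∑ τ, lapEnergy r lam (reIm τ) (h m)
      - |Q| * (3 * N) * s - 1 / κ * (3 * N) * (12 * N * (K2 * M ^ 2 * e))
      ≤ remainder (A m) (B m) V h := by
    intro m
    have := mul_le_mul_of_nonneg_left (s2 m) (show 0 ≤ 1 / κ * (3 * N) by positivity)
    linarith [key m]
  have tot := Finset.sum_le_sum fun m (_ : m ∈ Finset.univ) => key2 m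
  rw [Finset.sum_sub_distrib, Finset.sum_sub_distrib, ← Finset.mul_sum, Finset.sum_const,
    Finset.sum_const, Finset.card_univ, Fintype.card_fin, nsmul_eq_mul, nsmul_eq_mul] at tot
  change 1 / 2 * e - _ - _ ≤ _ at tot
  have t1 : N * (|Q| * (3 * N) * s) ≤ 1 / 8 * e := by
    have h1 := mul_le_mul_of_nonneg_left s1 (show 0 ≤ N * (|Q| * (3 * N)) by positivity)
    have h2 : 144 * N ^ 3 * |Q| * K1 * e ≤ lam * e := by
      gcongr
      linarith
    have h3 : lam * (N * (|Q| * (3 * N) * s)) ≤ lam * (1 / 8 * e) := by linarith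
    exact le_of_mul_le_mul_left h3 hl
  have t2 : N * (1 / κ * (3 * N) * (12 * N * (K2 * M ^ 2 * e))) ≤ 1 / 8 * e := by
    have h1 : N * (1 / κ * (3 * N) * (12 * N * (K2 * M ^ 2 * e)))
        = (36 * N ^ 3 * K2 * M ^ 2 / κ) * e := by ring
    rw [h1]
    refine mul_le_mul_of_nonneg_right ?_ he0
    rw [div_le_iff₀ hκ, hκdef]
    linarith
  linarith

theorem integral_sq_reIm (u : H3 R) (β : MIdx) :
    ‖wd u β‖ ^ 2 = ∑ τ, ∫ x in cube R, part (reIm τ) u β x * part (reIm τ) u β x := by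
  rw [norm_sq_L2, ← integral_finsetSum _ fun τ _ =>
    integrable_mul_L2 (memLp_part (reIm τ) u β) (memLp_part (reIm τ) u β)]
  simp only [norm_sq_eq_sum_reIm]
  simp only [part, sq]

/-- The weighted energy controls the norm of `H²`. -/
theorem exists_normSqH2_le_energy {r : ℝ} (hR : 0 < R) (hr : R < r) {lam : ℝ} (hlam : 1 ≤ lam)
    (N : ℕ) : ∃ C : ℝ, 0 < C ∧ ∀ h ∈ H03N R N, C * normSqH2 h ≤ energy r lam h := by
  obtain ⟨K, hK, hcar⟩ := exists_carleman hR hr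
  have hl : 0 < lam := by linarith
  set w := Real.exp (-lam * (R + r) ^ 2) with hw
  have hw0 : 0 < w := Real.exp_pos _
  have hK0 : 0 < K := by linarith
  have hcard : 0 < (Fintype.card MIdx : ℝ) := by
    have : Nonempty MIdx := ⟨idx0⟩
    exact_mod_cast Fintype.card_pos
  have main : ∀ u : H3 R, ZeroOnBoundary u → ZeroNormalOnBottom u → ∀ β : MIdx, β.order ≤ 2 →
      w ^ 2 * ‖wd u β‖ ^ 2 ≤ K * lam * ∑ τ, lapEnergy r lam (reIm τ) u := by
    intro u hu hb β hβ
    rw [integral_sq_reIm, Finset.mul_sum, Finset.mul_sum]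
    refine Finset.sum_le_sum fun τ _ => ?_
    obtain ⟨-, h0, h1, -, h2⟩ := hcar lam hlam u hu hb (reIm τ)
    change _ ≤ K * lapEnergy r lam (reIm τ) u at h0
    change ∀ i, lam * _ ≤ K * lapEnergy r lam (reIm τ) u at h1
    change ∀ i j, _ ≤ K * lam * lapEnergy r lam (reIm τ) u at h2
    have hS := lapEnergy_nonneg r lam (reIm τ) u
    set S := lapEnergy r lam (reIm τ) u
    have hKS : K * S ≤ K * lam * S := by
      have : K * 1 ≤ K * lam := by gcongr
      rw [mul_one] at this
      gcongr
    have hwi : w ^ 2 * ∫ x in cube R, part (reIm τ) u β x * part (reIm τ) u β x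
        ≤ ∫ x in cube R, (wgt R r lam x * part (reIm τ) u β x) *
          (wgt R r lam x * part (reIm τ) u β x) := by
      have m := memLp_part (reIm τ) u β
      have mw := memLp_wgt_mul r lam m
      rw [← integral_const_mul]
      refine integral_mono ((integrable_mul_L2 m m).const_mul _) (integrable_mul_L2 mw mw)
        fun x => ?_
      have h3 : w ^ 2 ≤ wgt R r lam x ^ 2 := by
        have := wgt_ge (R := R) (r := r) hl.le x
        gcongr
      have h4 := mul_le_mul_of_nonneg_right h3 (mul_self_nonneg (part (reIm τ) u β x))
      simp only []
      linarith
    refine hwi.trans ?_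
    rcases MIdx.order_le_two hβ with rfl | ⟨i, rfl⟩ | ⟨i, j, rfl⟩
    · exact h0.trans hKS
    · have h3 := h1 i
      have h4 : ∀ q : ℝ, 0 ≤ q → lam * q ≤ K * S → q ≤ K * lam * S := fun q hq hq' => by
        have : q ≤ lam * q := le_mul_of_one_le_left hq hlam
        linarith
      exact h4 _ (integral_nonneg fun _ => mul_self_nonneg _) h3
    · exact h2 i j
  -- The weight is bounded below by `exp(-λ(R+r)²)`, so unweighting costs a factor depending on `λ`;
  -- the cardinality accounts for summing one bound per multi-index.
  refine ⟨w ^ 2 / (Fintype.card MIdx * (K * lam)), by positivity, fun h hh => ?_⟩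
  rw [div_mul_eq_mul_div, div_le_iff₀ (by positivity), normSqH2, energy, Finset.mul_sum,
    Finset.sum_mul]
  refine Finset.sum_le_sum fun n _ => ?_
  rw [Finset.mul_sum]
  have h1 : ∀ β : MIdx, w ^ 2 * (if β.order ≤ 2 then ‖wd (h n) β‖ ^ 2 else 0)
      ≤ K * lam * ∑ τ, lapEnergy r lam (reIm τ) (h n) := by
    intro β
    split_ifs with hβ
    · exact main _ (hh n).1 (hh n).2 β hβ
    · rw [mul_zero]
      have : 0 ≤ ∑ τ, lapEnergy r lam (reIm τ) (h n) :=
        Finset.sum_nonneg fun _ _ => lapEnergy_nonneg _ _ _ _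
      positivity
  refine (Finset.sum_le_sum fun β _ => h1 β).trans (le_of_eq ?_)
  rw [Finset.sum_const, Finset.card_univ, nsmul_eq_mul]
  ring

/-! ### The functional as a sum of squares -/

section Sum

variable {E F ι : Type*} [NormedAddCommGroup E] [InnerProductSpace ℝ E]
  [NormedAddCommGroup F] [InnerProductSpace ℝ F] [Fintype ι]
  (A : ι → E →L[ℝ] F) (B : ι → E →L[ℝ] E →L[ℝ] F)

/-- A sum of squares of quadratic maps, with a regularization term. -/
def sumQuad (gam : ℝ) (V : E) : ℝ := ∑ m, ‖A m V + B m V V‖ ^ 2 + gam * ‖V‖ ^ 2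

theorem hasFDerivAt_sumQuad (gam : ℝ) (V : E) : HasFDerivAt (sumQuad A B gam)
    (∑ m, 2 • (innerSL ℝ (A m V + B m V V)).comp (A m + (B m V + (B m).flip V))
      + gam • (2 • innerSL ℝ V)) V := by
  have h1 := HasFDerivAt.fun_sum (u := Finset.univ) fun m _ => hasFDerivAt_quad (A m) (B m) V
  have h2 := ((hasStrictFDerivAt_norm_sq V).hasFDerivAt).const_mul gam
  exact h1.add h2

theorem fderiv_sumQuad (gam : ℝ) (V h : E) : fderiv ℝ (sumQuad A B gam) V h =
    ∑ m, 2 * ⟪A m V + B m V V, quadDeriv (A m) (B m) V h⟫ + gam * (2 * ⟪V, h⟫) := by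
  rw [(hasFDerivAt_sumQuad A B gam V).fderiv]
  simp [quadDeriv, two_mul, inner_add_left, inner_add_right]
  exact Finset.sum_congr rfl fun m _ => by ring

/-- The regularization contributes its remainder `γ‖h‖²` exactly, so `γ` never interferes with the
Carleman part. -/
theorem sumQuad_sub (gam : ℝ) (V h : E) :
    sumQuad A B gam (V + h) - sumQuad A B gam V - fderiv ℝ (sumQuad A B gam) V h
      = ∑ m, remainder (A m) (B m) V h + gam * ‖h‖ ^ 2 := by
  have e : ∑ m, remainder (A m) (B m) V h = ∑ m, ‖A m (V + h) + B m (V + h) (V + h)‖ ^ 2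
      - ∑ m, ‖A m V + B m V V‖ ^ 2
      - ∑ m, 2 * ⟪A m V + B m V V, quadDeriv (A m) (B m) V h⟫ := by
    rw [← Finset.sum_sub_distrib, ← Finset.sum_sub_distrib]
    exact Finset.sum_congr rfl fun m _ => (quad_add (A m) (B m) V h).symm
  rw [fderiv_sumQuad, e, sumQuad, sumQuad, norm_add_sq_real]
  ring

theorem exists_sumQuad_le {ρ : ℝ} (hρ : 0 ≤ ρ) : ∃ D : ℝ, 0 ≤ D ∧
    (∀ gam ∈ Ioo (0 : ℝ) 1, ∀ V h : E, ‖V‖ ≤ ρ →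
      fderiv ℝ (sumQuad A B gam) V h ≤ (D + 2 * ρ) * ‖h‖) ∧
    ∀ V h : E, ‖V‖ ≤ ρ → ‖h‖ ≤ ρ → ∑ m, remainder (A m) (B m) V h ≤ D * ‖h‖ ^ 2 := by
  choose D hD h1 h2 using fun m => exists_quad_le (A m) (B m) ρ hρ
  refine ⟨∑ m, D m, Finset.sum_nonneg fun m _ => hD m, fun gam hgam V h hV => ?_,
    fun V h hV hh => ?_⟩
  · rw [fderiv_sumQuad, add_mul, Finset.sum_mul]
    refine add_le_add (Finset.sum_le_sum fun m _ => h1 m V h hV) ?_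
    have h3 : ⟪V, h⟫ ≤ ρ * ‖h‖ := (real_inner_le_norm V h).trans (by gcongr)
    have h4 : 0 ≤ ρ * ‖h‖ := by positivity
    have h5 : gam * (2 * ⟪V, h⟫) ≤ gam * (2 * (ρ * ‖h‖)) :=
      mul_le_mul_of_nonneg_left (by linarith) hgam.1.le
    have h6 : gam * (2 * (ρ * ‖h‖)) ≤ 1 * (2 * (ρ * ‖h‖)) :=
      mul_le_mul_of_nonneg_right hgam.2.le (by linarith)
    linarith
  · rw [Finset.sum_mul]
    exact Finset.sum_le_sum fun m _ => h2 m V h hV hh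

end Sum

/-! ### The functional as a sum of squares, and the gradient data it provides. -/

theorem exists_J_eq_sumQuad {a d k : ℝ} (hR : 0 < R) (r lam : ℝ)
    {b : Fin N → Fin N → Fin 3 → E3 → ℂ} {c : Fin N → Fin N → Fin N → ℝ}
    (hb : ∀ m n i, IsBddCoeff R (b m n i))
    (hL : ∀ (V : H3N R N), ∀ x ∈ cube R, ∀ m,
      Lop a d k V x m = quasi b V x m + gradForm c V V x m) :
    ∃ A B, Represents (wgt R r lam) b c A B ∧
      ∀ gam, (J r a d k lam gam : H3N R N → ℝ) = sumQuad A B gam := by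
  choose A B hA hB using fun m =>
    exists_quadratic_operator hR hb c (contDiff_wgt R r lam).continuous m
  exact ⟨A, B, ⟨hA, hB⟩, fun gam => funext fun V => J_eq hL hA hB V⟩

theorem inner_gradJ (r a d k lam gam : ℝ) (V : H3N R N) (h : H03N R N) :
    ⟪gradJ r a d k lam gam V, h⟫ = fderiv ℝ (J r a d k lam gam) V h := by
  rw [gradJ, InnerProductSpace.toDual_symm_apply]
  rfl

/-- The shift by `G` keeps base points in norm at most `3M`, and increments from the ball of radius
`2M` to that of radius `2M + 1` have norm at most `4M + 1`. The strong convexity constant is `γ`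
alone: from the weighted part only nonnegativity is needed. The gradient is bounded by testing the
derivative with the gradient itself. -/
theorem gradData_J {r a d k lam D M : ℝ} {G : H3N R N} {A : Fin N → H3N R N →L[ℝ] L2 R}
    {B : Fin N → H3N R N →L[ℝ] H3N R N →L[ℝ] L2 R} {gam : ℝ}
    (hJ : (J r a d k lam gam : H3N R N → ℝ) = sumQuad A B gam)
    (hgam : gam ∈ Ioo (0 : ℝ) 1) (hM : 0 < M) (hG : ‖G‖ < M) (hD : 0 ≤ D)
    (hpos : ∀ V h : H3N R N, ‖V‖ ≤ 4 * M + 1 → ‖h‖ ≤ 4 * M + 1 → h ∈ H03N R N →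
      0 ≤ ∑ m, remainder (A m) (B m) V h)
    (hder : ∀ V h : H3N R N, ‖V‖ ≤ 4 * M + 1 →
      fderiv ℝ (sumQuad A B gam) V h ≤ (D + 2 * (4 * M + 1)) * ‖h‖)
    (hrem : ∀ V h : H3N R N, ‖V‖ ≤ 4 * M + 1 → ‖h‖ ≤ 4 * M + 1 →
      ∑ m, remainder (A m) (B m) V h ≤ D * ‖h‖ ^ 2) :
    GradData (fun W : H03N R N => J r a d k lam gam ((W : H3N R N) + G))
      (fun W : H03N R N => gradJ r a d k lam gam ((W : H3N R N) + G)) (2 * M) gam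
      (D + 2 * (4 * M + 1)) := by
  have hV : ∀ x : H03N R N, ‖x‖ ≤ 2 * M → ‖(x : H3N R N) + G‖ ≤ 4 * M + 1 := fun x hx => by
    have h1 := norm_add_le (x : H3N R N) G
    have h2 : ‖(x : H3N R N)‖ = ‖x‖ := rfl
    linarith
  have hh : ∀ x y : H03N R N, ‖x‖ ≤ 2 * M → ‖y‖ ≤ 2 * M + 1 →
      ‖((y - x : H03N R N) : H3N R N)‖ ≤ 4 * M + 1 := fun x y hx hy => by
    have h1 := norm_sub_le y x
    have h2 : ‖((y - x : H03N R N) : H3N R N)‖ = ‖y - x‖ := rfl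
    linarith
  have key : ∀ x y : H03N R N, J r a d k lam gam ((y : H3N R N) + G)
      - J r a d k lam gam ((x : H3N R N) + G)
      - ⟪gradJ r a d k lam gam ((x : H3N R N) + G), y - x⟫
      = ∑ m, remainder (A m) (B m) ((x : H3N R N) + G) ((y - x : H03N R N) : H3N R N)
        + gam * ‖y - x‖ ^ 2 := by
    intro x y
    have e : (y : H3N R N) + G = ((x : H3N R N) + G) + ((y - x : H03N R N) : H3N R N) := by
      rw [Submodule.coe_sub]; abel
    rw [inner_gradJ, hJ, e, sumQuad_sub]
    rfl
  refine ⟨fun x y hx hy => ?_, fun x y hx hy => ?_, fun x hx => ?_⟩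
  · rw [key]
    have := hpos _ _ (hV x hx) (hh x y hx hy) (y - x).2
    linarith
  · rw [key]
    have h1 := hrem _ _ (hV x hx) (hh x y hx hy)
    have h2 : ‖((y - x : H03N R N) : H3N R N)‖ = ‖y - x‖ := rfl
    rw [h2] at h1
    have h3 : gam * ‖y - x‖ ^ 2 ≤ (2 * (4 * M + 1)) * ‖y - x‖ ^ 2 :=
      mul_le_mul_of_nonneg_right (by linarith [hgam.2]) (sq_nonneg _)
    linarith
  · set g := gradJ r a d k lam gam ((x : H3N R N) + G) with hg
    have h1 := hder _ (g : H3N R N) (hV x hx)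
    rw [← hJ, ← inner_gradJ, ← hg, real_inner_self_eq_norm_sq] at h1
    change ‖g‖ ^ 2 ≤ _ * ‖g‖ at h1
    rcases (norm_nonneg g).eq_or_lt with h0 | h0
    · rw [← h0]; linarith
    · rw [sq] at h1
      exact le_of_mul_le_mul_right h1 h0

end Convexification

end

/-! ### Choice of the threshold and assembly of the two properties. -/

theorem theorem6p1 (R r a d k : ℝ) (N : ℕ) (hR : 0 < R) (hr : R < r) (ha : 0 < a)
    (hd : R < d) (hk : 0 < k) (hN : 1 ≤ N) :
    ∃ lam2 : ℝ → ℝ,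
      -- the threshold `lam2 M` of strict convexity on the sets `closure B(M)`
      (∀ M : ℝ, 0 < M → 1 < lam2 M ∧
        ∀ lam : ℝ, lam2 M ≤ lam → ∃ C : ℝ, 0 < C ∧ ∀ gam ∈ Set.Ioo (0 : ℝ) 1,
          Differentiable ℝ
            (Convexification.J r a d k lam gam : Convexification.H3N R N → ℝ) ∧
          ∀ V₁ V₂ : Convexification.H3N R N, ‖V₁‖ ≤ M → ‖V₂‖ ≤ M →
            V₂ - V₁ ∈ Convexification.H03N R N →
            C * Convexification.normSqH2 (V₂ - V₁) + gam * ‖V₂ - V₁‖ ^ 2 ≤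
              Convexification.J r a d k lam gam V₂ - Convexification.J r a d k lam gam V₁
                - fderiv ℝ (Convexification.J r a d k lam gam) V₁ (V₂ - V₁)) ∧
      -- convergence of the gradient projection method for `lam ≥ lam2 (2M)`
      (∀ M : ℝ, 0 < M → ∀ lam : ℝ, lam2 (2 * M) ≤ lam →
        ∃ η₀ ∈ Set.Ioo (0 : ℝ) 1, ∀ gam ∈ Set.Ioo (0 : ℝ) 1, ∀ η ∈ Set.Ioo (0 : ℝ) η₀,
          ∃ θ ∈ Set.Ioo (0 : ℝ) 1, ∀ G : Convexification.H3N R N, ‖G‖ < M →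
            ∃ Wmin ∈ Metric.closedBall (0 : Convexification.H03N R N) (2 * M),
              (∀ W ∈ Metric.closedBall (0 : Convexification.H03N R N) (2 * M), W ≠ Wmin →
                Convexification.J r a d k lam gam ((Wmin : Convexification.H3N R N) + G) <
                  Convexification.J r a d k lam gam ((W : Convexification.H3N R N) + G)) ∧
              ∀ W₀ ∈ Metric.ball (0 : Convexification.H03N R N) (2 * M),
                Filter.Tendsto (Convexification.gpSeq r a d k lam gam (2 * M) η G W₀)
                  Filter.atTop (nhds Wmin) ∧
                ∀ n : ℕ,
                  ‖Wmin - Convexification.gpSeq r a d k lam gam (2 * M) η G W₀ n‖ ≤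
                    θ ^ n * ‖Wmin - W₀‖) := by
  obtain ⟨b, c, hb, hL⟩ := Convexification.exists_coefficients (R := R) (k := k) (N := N) ha hd
  choose Λ hΛ1 hΛ using fun M => Convexification.exists_energy_le_remainder hR hr hb c M
  -- Evaluating `Λ` at `2M + 1` is more than (a) needs. At `2M` it gives the radius `4M + 1`, which
  -- covers the auxiliary points outside the ball used in the cocoercivity argument. The final `+ 1`
  -- makes the threshold exceed `1`.
  refine ⟨fun M => Λ (2 * M + 1) + 1, fun M hM => ⟨by linarith [hΛ1 (2 * M + 1)],
    fun lam hlam => ?_⟩, fun M hM lam hlam => ?_⟩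
  · obtain ⟨A, B, hAB, hJ⟩ := Convexification.exists_J_eq_sumQuad hR r lam hb hL
    have hl : 1 ≤ lam := by linarith [hΛ1 (2 * M + 1)]
    obtain ⟨C, hC, hE⟩ := Convexification.exists_normSqH2_le_energy hR hr hl N
    refine ⟨1 / 4 * C, by positivity, fun gam _ => ⟨?_, fun V₁ V₂ h₁ h₂ hmem => ?_⟩⟩
    · rw [hJ]
      exact fun V => (Convexification.hasFDerivAt_sumQuad A B gam V).differentiableAt
    · obtain ⟨h, rfl⟩ : ∃ h, V₂ = V₁ + h := ⟨V₂ - V₁, by abel⟩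
      rw [add_sub_cancel_left] at hmem ⊢
      have hh : ‖h‖ ≤ 2 * M := by
        have h3 := norm_sub_le (V₁ + h) V₁
        rw [add_sub_cancel_left] at h3
        linarith
      rw [hJ, Convexification.sumQuad_sub]
      have h4 := hΛ (2 * M + 1) lam (by linarith) A B hAB V₁ h (by linarith) (by linarith) hmem
      have h5 := hE h hmem
      linarith
  · obtain ⟨A, B, hAB, hJ⟩ := Convexification.exists_J_eq_sumQuad hR r lam hb hL
    obtain ⟨D, hD, hder, hrem⟩ := Convexification.exists_sumQuad_le A B
      (show 0 ≤ 4 * M + 1 by positivity)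
    have hpos : ∀ V h : Convexification.H3N R N, ‖V‖ ≤ 4 * M + 1 → ‖h‖ ≤ 4 * M + 1 →
        h ∈ Convexification.H03N R N → 0 ≤ ∑ m, Convexification.remainder (A m) (B m) V h := by
      intro V h hV hh hmem
      have h1 := hΛ (2 * (2 * M) + 1) lam (by linarith) A B hAB V h (by linarith) (by linarith) hmem
      have h2 := Convexification.energy_nonneg r lam h
      linarith
    set D' := D + 2 * (4 * M + 1) with hD'
    have hD0 : 0 < D' := by positivity
    -- Since `γ < 1` and the radius is `2M`, `8M` dominates the term `4γρ` in the cocoercivity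
    -- condition. Hence `τ`, and with it `η₀`, is independent of `γ` and `G`.
    set τ := 1 / (2 * D' + 8 * M) with hτ
    have hτ0 : 0 < τ := by positivity
    have hτe : τ * (2 * D' + 8 * M) = 1 := by
      rw [hτ]
      field_simp
    refine ⟨min τ (1 / 4), ⟨lt_min hτ0 (by norm_num), (min_le_right _ _).trans_lt (by norm_num)⟩,
      fun gam hgam η hη => ?_⟩
    have hητ : η ≤ τ := hη.2.le.trans (min_le_left _ _)
    have hη4 : η ≤ 1 / 4 := hη.2.le.trans (min_le_right _ _)
    have hηg : 0 < η * gam := mul_pos hη.1 hgam.1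
    have hηg4 : η * gam ≤ 1 / 4 :=
      (mul_le_mul hη4 hgam.2.le hgam.1.le (by norm_num)).trans (by norm_num)
    have hτM : 0 < τ * M := by positivity
    have hτD : 0 < τ * D' := by positivity
    refine ⟨1 - 2 * η * gam, ⟨by linarith, by linarith⟩, fun G hG => ?_⟩
    obtain ⟨w, hw, hmin, hconv⟩ := (Convexification.gradData_J (hJ gam) hgam hM hG hD hpos
      (hder gam hgam) hrem).exists_minimizer (η := η) (τ := τ) (by positivity) hgam.1 hgam.2.le hτ0
      (by linarith) (by
        have h1 : gam * (τ * M) ≤ 1 * (τ * M) := mul_le_mul_of_nonneg_right hgam.2.le hτM.le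
        linarith) hη.1 hητ hη4
    exact ⟨w, hw, hmin, fun W₀ hW₀ => hconv _ hW₀ fun n => rfl⟩
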